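/- Setting. Let $\mathfrak g$ be a finite-dimensional real Lie algebra with $[\mathfrak g,\mathfrak g]$ central, with a scalar product, and let $G=(\mathfrak g,\cdot)$, $u\cdot v=u+v+\frac12[u,v]$. For $\ell\in\mathfrak g^*$ put $\chi_\ell(x)=e^{-2\pi i\ell(x)}$ and $\mathfrak g(\ell)=\{x:\ell([x,\mathfrak g])=0\}$. Let $\ell_k\to\ell$ in $\mathfrak g^*$ and let $X^k_1,\dots,X^k_d,Y^k_1,\dots,Y^k_d,T_k,Z_k,A^k_1,\dots,A^k_p$ be orthonormal bases of $\mathfrak g$ which converge, vector by vector, to an orthonormal basis $X_j,Y_j,T,Z,A_j$, such that for every $k$ and some fixed $\tilde p\le p$: $[\mathfrak g,\mathfrak g]=\mathrm{span}\{Z_k,A^k_1,\dots,A^k_{\tilde p}\}$; $\mathfrak g(\ell_k)=\mathrm{span}\{T_k,Z_k,A^k_1,\dots,A^k_p\}$; $\ell_k$ vanishes on all $X^k_j,Y^k_j,A^k_j$; $\lambda_k:=\ell_k(Z_k)\neq0$; and, modulo $\ker\ell_k\cap[\mathfrak g,\mathfrak g]$, $[X^k_i,X^k_j]=[Y^k_i,Y^k_j]=0$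 and $[X^k_i,Y^k_j]=\delta_{ij}c^k_jZ_k$. Put $\lambda=\ell(Z)=\lim\lambda_k$, $c_j=\lim_k c^k_j$, $\mathfrak u=\mathrm{span}\{T,Z,A_1,\dots,A_p\}=\lim\mathfrak g(\ell_k)$, $U=\exp\mathfrak u$. Identify $G/U$ with $\mathbb R^{2d}$ by $(x,y)\mapsto\sum_jx_jX_j+\sum_jy_jY_j$, with Lebesgue measure. $L^1(G/U,\chi_\ell)$ is the space of measurable $f:G\to\mathbb C$ with $f(gu)=\chi_\ell(u^{-1})f(g)$ for $u\in U$ and $\int_{G/U}|f|<\infty$, with involution $f^*(g)=\overline{f(g^{-1})}$; $C^*(G/U,\chi_\ell)$ is its completion for $\|f\|=\sup_\pi\|\pi(f)\|$, the supremum over the irreducible unitary representations $\pi$ of $G$ with $\pi|_U=\chi_\ell\,\mathrm{Id}$, where $\pi(f)=\int_{G/U}f(g)\pi(g)\,d\dot g$. $\mathcal S(G/U,\chi_\ell)$ consists of the smooth $f\in L^1(G/U,\chi_\ell)$ whose restriction to every linear complement of $\mathfrak u$ is a Schwartz function. Let $\eta_j\in\mathcal S(\mathbb R)$, $\|\eta_j\|_2=1$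 ($1\le j\le d$), let $P_\eta\xi=\langle\xi,\eta\rangle\eta$, and for a set $J\subset\{1,\dots,d\}$ and $\alpha,\beta\in\mathbb R^J$ put $$\eta^J_{k,\alpha,\beta}(s)=e^{2\pi i\alpha\cdot s}\prod_{j\in J}|\lambda_kc^k_j|^{1/4}\,\eta_j\Big(|\lambda_kc^k_j|^{1/2}\Big(s_j+\frac{\beta_j}{\lambda_kc^k_j}\Big)\Big),\qquad s\in\mathbb R^J .$$ (A) Second case: $\lambda=0$, or $c_j=0$ for all $j$. Put $J=\{1,\dots,d\}$. The Fourier transform $h\mapsto\hat h$, $\hat h(\tilde x,\tilde y)=\int_{\mathbb R^{2d}}h(x,y)e^{-2\pi i(\tilde x\cdot x+\tilde y\cdot y)}\,d(x,y)$, on $L^1(G/U,\chi_\ell)$ extends to an isometry $\mathcal F:C^*(G/U,\chi_\ell)\to C_0(\mathbb R^{2d})$, so that $\|h\|_{C^*(G/U,\chi_\ell)}=\|\hat h\|_\infty$. For every $k$ and $h\in\mathcal S(G/U,\chi_\ell)$ the integral $$\nu_k(h)=\int_{\mathbb R^{2d}}\hat h(\tilde x,\tilde y)\,P_{\eta^J_{k,\tilde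 x,\tilde y}}\,\frac{d(\tilde x,\tilde y)}{\prod_{j=1}^d|\lambda_kc^k_j|}$$ converges in the operator norm of $\mathcal B(L^2(\mathbb R^d))$. The map $\nu_k$ extends uniquely to a continuous linear map $\nu_k:C^*(G/U,\chi_\ell)\to\mathcal B(L^2(\mathbb R^d))$, and for every $h\in C^*(G/U,\chi_\ell)$: $\nu_k(h)$ is given by the same integral, with $\mathcal F(h)$ in place of $\hat h$, in the weak sense; $\nu_k(h)$ is compact; $\|\nu_k(h)\|_{op}\le\|h\|_{C^*(G/U,\chi_\ell)}$; and $\nu_k(h)^*=\nu_k(h^*)$. (B) Third case: $\lambda\ne0$ and, for some $1\le m<d$, $c_j\neq0$ for $j\le m$ and $c_j=0$ for $j>m$. Put $J=\{m+1,\dots,d\}$, $\mathfrak p=\mathrm{span}\{X_{m+1},\dots,X_d,Y_1,\dots,Y_d,T,Z,A_1,\dots,A_p\}$, $P=\exp\mathfrak p$, and for $(\tilde x,\tilde y)\in\mathbb R^{2(d-m)}$ let $\pi_{\ell+(\tilde x,\tilde y)}=\mathrm{ind}_P^G\chi_{\ell+(\tilde x,\tilde y)}$, realized on $L^2(\mathbb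 R^m)=L^2(\mathrm{span}\{X_1,\dots,X_m\})$, where $(\tilde x,\tilde y)$ is the functional with values $\tilde x_j,\tilde y_j$ on $X_j,Y_j$ ($j>m$) and $0$ on the other basis vectors. Let $\mathcal K$ be the algebra of compact operators on $L^2(\mathbb R^m)$. Then $\mathcal F(h)(\tilde x,\tilde y)=\pi_{\ell+(\tilde x,\tilde y)}(h)$ ($h\in L^1(G/U,\chi_\ell)$) extends to an isometry $\mathcal F:C^*(G/U,\chi_\ell)\to C_0(\mathbb R^{2(d-m)},\mathcal K)$. For every $k$ the integral $$\mu_k(\varphi)=\int_{\mathbb R^{2(d-m)}}\varphi(\tilde x,\tilde y)\otimes P_{\eta^J_{k,\tilde x,\tilde y}}\,\frac{d(\tilde x,\tilde y)}{\prod_{j=m+1}^d|\lambda_kc^k_j|}$$ exists in the weak sense on $L^2(\mathbb R^d)=L^2(\mathbb R^m\times\mathbb R^{d-m})$ for every $\varphi\in C_0(\mathbb R^{2(d-m)},\mathcal K)$ and defines a continuous linear map with $\|\mu_k(\varphi)\|_{op}\le\|\varphi\|_\infty$. Put $\nu_k(h)=\mu_k(\mathcal F(h))$. For $h\in\mathcal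 S(G/U,\chi_\ell)$ the integral defining $\nu_k(h)$ converges in operator norm; $\nu_k$ is the unique continuous linear extension of its restriction to $\mathcal S(G/U,\chi_\ell)$; and for every $h\in C^*(G/U,\chi_\ell)$, $\nu_k(h)$ is compact, $\|\nu_k(h)\|_{op}\le\|h\|_{C^*(G/U,\chi_\ell)}$ and $\nu_k(h)^*=\nu_k(h^*)$. -/

import Mathlib

open MeasureTheory Filter Topology
open scoped SchwartzMap ContDiff ZeroAtInfty

set_option linter.unusedSectionVars false

noncomputable section

namespace TwoStep

/-- A Lie bracket on a real inner product space for which `[g, g]` is central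
(the Jacobi identity is then automatic). -/
class TwoStepLieAlgebra (g : Type*) [NormedAddCommGroup g] [InnerProductSpace ℝ g]
    extends Bracket g g where
  protected add_lie : ∀ x y z : g, ⁅x + y, z⁆ = ⁅x, z⁆ + ⁅y, z⁆
  protected lie_add : ∀ x y z : g, ⁅x, y + z⁆ = ⁅x, y⁆ + ⁅x, z⁆
  protected lie_self : ∀ x : g, ⁅x, x⁆ = 0
  protected lie_smul : ∀ (t : ℝ) (x y : g), ⁅x, t • y⁆ = t • ⁅x, y⁆
  protected two_step : ∀ x y z : g, ⁅x, ⁅y, z⁆⁆ = 0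

section Lie

variable {g : Type*} [NormedAddCommGroup g] [InnerProductSpace ℝ g] [TwoStepLieAlgebra g]

instance TwoStepLieAlgebra.instLieRing : LieRing g where
  add_lie := TwoStepLieAlgebra.add_lie
  lie_add := TwoStepLieAlgebra.lie_add
  lie_self := TwoStepLieAlgebra.lie_self
  leibniz_lie x y z := by
    have h : ⁅⁅x, y⁆, z⁆ + ⁅z, ⁅x, y⁆⁆ = 0 := by
      have := TwoStepLieAlgebra.lie_self (⁅x, y⁆ + z)
      rw [TwoStepLieAlgebra.add_lie, TwoStepLieAlgebra.lie_add, TwoStepLieAlgebra.lie_add,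
        TwoStepLieAlgebra.lie_self, TwoStepLieAlgebra.lie_self] at this
      simpa using this
    rw [TwoStepLieAlgebra.two_step, add_zero] at h
    rw [TwoStepLieAlgebra.two_step, TwoStepLieAlgebra.two_step, h, add_zero]

instance TwoStepLieAlgebra.instLieAlgebra : LieAlgebra ℝ g where
  lie_smul := TwoStepLieAlgebra.lie_smul

/-- The Campbell-Baker-Hausdorff product: the simply connected group is `G = (g, cbh)`, with
neutral element `0` and inverse `x ↦ -x`. -/
def cbh (x y : g) : g := x + y + (1 / 2 : ℝ) • ⁅x, y⁆

/-- The stabilizer `g(ℓ)`, the radical of the form `(x, y) ↦ ℓ [x, y]`. -/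
def stabilizer (ℓ : g →L[ℝ] ℝ) : Submodule ℝ g where
  carrier := {x | ∀ y, ℓ ⁅x, y⁆ = 0}
  add_mem' := fun {a b} ha hb y => by rw [add_lie, map_add, ha y, hb y, add_zero]
  zero_mem' := fun y => by rw [zero_lie, map_zero]
  smul_mem' := fun t a ha y => by rw [smul_lie, map_smul, ha y, smul_zero]

/-- The derived algebra `[g, g]` as a linear subspace. -/
def derivedSpace (g : Type*) [NormedAddCommGroup g] [InnerProductSpace ℝ g]
    [TwoStepLieAlgebra g] : Submodule ℝ g :=
  Submodule.span ℝ {z | ∃ x y : g, z = ⁅x, y⁆}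

end Lie

/-- `χ_ℓ(x) = exp(-2πi ℓ(x))`. -/
def chi {g : Type*} [NormedAddCommGroup g] [InnerProductSpace ℝ g] (ℓ : g →L[ℝ] ℝ) (x : g) : ℂ :=
  Complex.exp (-(2 * Real.pi * Complex.I * (ℓ x : ℂ)))

/-- A strongly continuous unitary representation of `G = (g, cbh)` on `H`. -/
structure UnitaryRep (g : Type*) [NormedAddCommGroup g] [InnerProductSpace ℝ g]
    [TwoStepLieAlgebra g] (H : Type*) [NormedAddCommGroup H] [InnerProductSpace ℂ H] where
  op : g → (H ≃ₗᵢ[ℂ] H)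
  map_mul : ∀ x y v, op (cbh x y) v = op x (op y v)
  continuous_op : ∀ v, Continuous fun x => op x v

/-- Irreducibility: no closed invariant subspaces except the two trivial ones. -/
def UnitaryRep.IsIrreducible {g : Type*} [NormedAddCommGroup g] [InnerProductSpace ℝ g]
    [TwoStepLieAlgebra g] {H : Type*} [NormedAddCommGroup H] [InnerProductSpace ℂ H]
    (π : UnitaryRep g H) : Prop :=
  Nontrivial H ∧ ∀ K : Submodule ℂ H, IsClosed (K : Set H) →
    (∀ x, ∀ v ∈ K, π.op x v ∈ K) → K = ⊥ ∨ K = ⊤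

/-- `ℝ^d`. -/
abbrev Eucl (d : ℕ) : Type := EuclideanSpace ℝ (Fin d)

/-- `L²` of a measure space, complex valued. -/
abbrev L2 (X : Type) [MeasureSpace X] : Type := Lp ℂ 2 (volume : Measure X)

/-- The data `(u, ℓ)` that define `L¹(G/U, χ_ℓ)`, together with a linear section
`ℝ^d × ℝ^d → g` of `g → g/u`, by which `G/U` is identified with `ℝ^{2d}`; the invariant measure
of `G/U` is Lebesgue measure in these coordinates. -/
structure QuotientData (g : Type*) [NormedAddCommGroup g] [InnerProductSpace ℝ g]
    [TwoStepLieAlgebra g] (d : ℕ) where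
  u : Submodule ℝ g
  ℓ : g →L[ℝ] ℝ
  derived_le : derivedSpace g ≤ u
  le_stabilizer : u ≤ stabilizer ℓ
  sec : (Eucl d × Eucl d) →L[ℝ] g
  sec_injective : Function.Injective sec
  sec_isCompl : IsCompl (LinearMap.range (sec : (Eucl d × Eucl d) →ₗ[ℝ] g)) u

namespace QuotientData

variable {g : Type*} [NormedAddCommGroup g] [InnerProductSpace ℝ g] [FiniteDimensional ℝ g]
  [MeasurableSpace g] [BorelSpace g] [TwoStepLieAlgebra g] {d : ℕ} (D : QuotientData g d)

/-- The functions that make up `L¹(G/U, χ_ℓ)`. -/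
def l1Submodule : Submodule ℂ (g → ℂ) where
  carrier := {f | Measurable f ∧
    (∀ x, ∀ y ∈ D.u, f (cbh x y) = chi D.ℓ (-y) * f x) ∧
    Integrable (fun w => f (D.sec w)) (volume : Measure (Eucl d × Eucl d))}
  add_mem' := fun {a b} ha hb => ⟨ha.1.add hb.1, fun x y hy => by
    simp only [Pi.add_apply]; rw [ha.2.1 x y hy, hb.2.1 x y hy, mul_add], ha.2.2.add hb.2.2⟩
  zero_mem' := ⟨measurable_const, fun x y _ => by simp, integrable_zero _ _ _⟩
  smul_mem' := fun c a ha => ⟨ha.1.const_smul c, fun x y hy => by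
    simp only [Pi.smul_apply, smul_eq_mul]; rw [ha.2.1 x y hy]; ring, ha.2.2.smul c⟩

/-- `L¹(G/U, χ_ℓ)`, as functions; functions that agree almost everywhere are identified in the
completion `CStar` below. -/
def L1 : Type _ := D.l1Submodule

instance : AddCommGroup D.L1 := inferInstanceAs (AddCommGroup D.l1Submodule)
instance : Module ℂ D.L1 := inferInstanceAs (Module ℂ D.l1Submodule)

/-- The function underlying an element of `L¹(G/U, χ_ℓ)`. -/
def L1.toFun {D : QuotientData g d} (f : D.L1) : g → ℂ := f.1

theorem L1.mem {D : QuotientData g d} (f : D.L1) : f.toFun ∈ D.l1Submodule := f.2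

instance : CoeFun D.L1 (fun _ => g → ℂ) := ⟨L1.toFun⟩


theorem isNegInvariant_volume (d : ℕ) :
    (volume : Measure (Eucl d × Eucl d)).IsNegInvariant :=
  ⟨((Measure.measurePreserving_neg (volume : Measure (Eucl d))).prod
    (Measure.measurePreserving_neg (volume : Measure (Eucl d)))).map_eq⟩

section Rep

variable {H : Type*} [NormedAddCommGroup H] [InnerProductSpace ℂ H] [CompleteSpace H]

theorem integrable_rep (π : UnitaryRep g H) (f : D.L1) (v : H) :
    Integrable (fun w => f (D.sec w) • π.op (D.sec w) v) (volume : Measure (Eucl d × Eucl d)) := by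
  have hf : Integrable (fun w => f (D.sec w)) (volume : Measure (Eucl d × Eucl d)) := f.mem.2.2
  have hc : Continuous fun w => π.op (D.sec w) v := (π.continuous_op v).comp D.sec.continuous
  refine (hf.norm.mul_const ‖v‖).mono' (hf.1.smul hc.aestronglyMeasurable)
    (Eventually.of_forall fun w => ?_)
  simp [norm_smul]

/-- `‖f‖₁`. -/
def l1Norm (f : D.L1) : ℝ := ∫ w : Eucl d × Eucl d, ‖f (D.sec w)‖

/-- `π(f) = ∫_{G/U} f(x) π(x) dx`, the integral taken in the strong sense. -/
def repOp (π : UnitaryRep g H) (f : D.L1) : H →L[ℂ] H :=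
  LinearMap.mkContinuous
    { toFun := fun v => ∫ w : Eucl d × Eucl d, f (D.sec w) • π.op (D.sec w) v
      map_add' := fun v v' => by
        simp only [map_add, smul_add]
        exact integral_add (D.integrable_rep π f v) (D.integrable_rep π f v')
      map_smul' := fun c v => by
        simp only [map_smul, RingHom.id_apply, smul_comm _ c]
        exact integral_smul c _ }
    (D.l1Norm f) (fun v => by
      refine (norm_integral_le_integral_norm _).trans (le_of_eq ?_)
      simp [norm_smul, integral_mul_const, l1Norm])

theorem repOp_apply (π : UnitaryRep g H) (f : D.L1) (v : H) :
    D.repOp π f v = ∫ w : Eucl d × Eucl d, f (D.sec w) • π.op (D.sec w) v := rfl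

theorem norm_repOp_le (π : UnitaryRep g H) (f : D.L1) : ‖D.repOp π f‖ ≤ D.l1Norm f :=
  LinearMap.mkContinuous_norm_le _ (integral_nonneg fun _ => norm_nonneg _) _

theorem repOp_add (π : UnitaryRep g H) (f f' : D.L1) :
    D.repOp π (f + f') = D.repOp π f + D.repOp π f' := by
  ext v
  rw [_root_.add_apply, repOp_apply, repOp_apply, repOp_apply,
    ← integral_add (D.integrable_rep π f v) (D.integrable_rep π f' v)]
  exact integral_congr_ae (Eventually.of_forall fun w => add_smul _ _ _)

theorem repOp_smul (π : UnitaryRep g H) (c : ℂ) (f : D.L1) :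
    D.repOp π (c • f) = c • D.repOp π f := by
  ext v
  rw [_root_.smul_apply, repOp_apply, repOp_apply, ← integral_smul]
  exact integral_congr_ae (Eventually.of_forall fun w => mul_smul _ _ _)

end Rep

/-- The irreducible unitary representations `π` of `G` with `π = χ_ℓ · Id` on `U`. -/
structure Spec where
  H : Type
  [normed : NormedAddCommGroup H]
  [inner : InnerProductSpace ℂ H]
  [complete : CompleteSpace H]
  π : UnitaryRep g H
  irreducible : π.IsIrreducible
  restrict : ∀ x ∈ D.u, ∀ v, π.op x v = chi D.ℓ x • v

attribute [instance] Spec.normed Spec.inner Spec.complete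

theorem bddAbove_spec (f : D.L1) : BddAbove (Set.range fun ρ : D.Spec => ‖D.repOp ρ.π f‖) :=
  ⟨D.l1Norm f, by rintro _ ⟨ρ, rfl⟩; exact D.norm_repOp_le ρ.π f⟩

/-- The `C*`-norm `‖f‖ = sup_π ‖π(f)‖` on `L¹(G/U, χ_ℓ)`, the supremum over `Spec`. -/
def cstarSeminorm : Seminorm ℂ D.L1 where
  toFun f := ⨆ ρ : D.Spec, ‖D.repOp ρ.π f‖
  map_zero' := by
    have h : ∀ ρ : D.Spec, D.repOp ρ.π (0 : D.L1) = 0 := fun ρ => by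
      have := D.repOp_smul ρ.π 0 (0 : D.L1)
      rwa [zero_smul, zero_smul] at this
    simp [h]
  add_le' f f' := by
    refine Real.iSup_le (fun ρ => ?_)
      (add_nonneg (Real.iSup_nonneg fun _ => norm_nonneg _)
        (Real.iSup_nonneg fun _ => norm_nonneg _))
    rw [D.repOp_add]
    exact (norm_add_le _ _).trans
      (add_le_add (le_ciSup (D.bddAbove_spec f) ρ) (le_ciSup (D.bddAbove_spec f') ρ))
  neg' f := by
    have h : ∀ ρ : D.Spec, ‖D.repOp ρ.π (-f)‖ = ‖D.repOp ρ.π f‖ := fun ρ => by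
      have := D.repOp_smul ρ.π (-1) f
      rw [neg_one_smul, neg_one_smul] at this
      rw [this, norm_neg]
    simp only [h]
  smul' c f := by
    simp only [D.repOp_smul, norm_smul]
    exact (Real.mul_iSup_of_nonneg (norm_nonneg c) _).symm

instance : SeminormedAddCommGroup D.L1 :=
  AddGroupSeminorm.toSeminormedAddCommGroup D.cstarSeminorm.toAddGroupSeminorm

theorem norm_L1_eq (f : D.L1) : ‖f‖ = ⨆ ρ : D.Spec, ‖D.repOp ρ.π f‖ := rfl

instance : NormedSpace ℂ D.L1 where
  norm_smul_le c f := le_of_eq (D.cstarSeminorm.smul' c f)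

/-- `C*(G/U, χ_ℓ)` with its Banach space structure: the completion of `L¹(G/U, χ_ℓ)` for the
`C*`-norm. (The product plays no role here.) -/
abbrev CStar : Type _ := UniformSpace.Completion D.L1

theorem conj_chi (ℓ : g →L[ℝ] ℝ) (x : g) : (starRingEnd ℂ) (chi ℓ x) = chi ℓ (-x) := by
  unfold chi; rw [← Complex.exp_conj]; congr 1; simp [Complex.conj_ofNat]

/-- The involution `f*(x) = conj f(x⁻¹)` of `L¹(G/U, χ_ℓ)`. -/
def starL1 (f : D.L1) : D.L1 :=
  ⟨fun x => (starRingEnd ℂ) (f (-x)), by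
    obtain ⟨hm, hc, hi⟩ := f.mem
    refine ⟨Complex.continuous_conj.measurable.comp (hm.comp measurable_neg), fun x y hy => ?_, ?_⟩
    · have hxy : ⁅x, y⁆ ∈ D.u := D.derived_le (Submodule.subset_span ⟨x, y, rfl⟩)
      have hl : D.ℓ ⁅x, y⁆ = 0 := by
        rw [← lie_skew, map_neg, D.le_stabilizer hy x, neg_zero]
      have h2 : ⁅x, ⁅x, y⁆⁆ = 0 := TwoStepLieAlgebra.two_step _ _ _
      have key : -cbh x y = cbh (-x) (-y - ⁅x, y⁆) := by
        simp only [cbh, neg_lie, lie_sub, lie_neg, h2]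
        module
      have hmem : -y - ⁅x, y⁆ ∈ D.u := D.u.sub_mem (D.u.neg_mem hy) hxy
      change (starRingEnd ℂ) (L1.toFun f (-cbh x y)) = chi D.ℓ (-y) * (starRingEnd ℂ) (L1.toFun f (-x))
      rw [key, hc _ _ hmem, map_mul, conj_chi]
      have hl' : D.ℓ (-(-y - ⁅x, y⁆)) = D.ℓ y := by
        rw [map_neg, map_sub, map_neg, hl]; ring
      simp only [chi, hl', map_neg]
    · have := isNegInvariant_volume d
      have := (Complex.conjCLE.toContinuousLinearMap.integrable_comp hi).comp_neg
      simpa using this⟩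

theorem starL1_apply (f : D.L1) (x : g) : D.starL1 f x = (starRingEnd ℂ) (f (-x)) := rfl

theorem repOp_starL1 {H : Type*} [NormedAddCommGroup H] [InnerProductSpace ℂ H] [CompleteSpace H]
    (π : UnitaryRep g H) (f : D.L1) :
    D.repOp π (D.starL1 f) = ContinuousLinearMap.adjoint (D.repOp π f) := by
  have := isNegInvariant_volume d
  rw [ContinuousLinearMap.eq_adjoint_iff]
  intro v w
  have h0 : ∀ x : H, π.op 0 x = x := fun x => by
    apply (π.op 0).injective
    have := π.map_mul 0 0 x
    simpa [cbh] using this.symm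
  have hinv : ∀ x : g, ∀ v w : H, inner ℂ (π.op x v) w = inner ℂ v (π.op (-x) w) := fun x v w => by
    rw [← (π.op (-x)).inner_map_map (π.op x v) w, ← π.map_mul]
    simp [cbh, h0]
  rw [repOp_apply, repOp_apply, ← integral_inner (D.integrable_rep π f w), ← inner_conj_symm,
    ← integral_inner (D.integrable_rep π (D.starL1 f) v), ← integral_conj,
    ← integral_neg_eq_self]
  congr 1
  ext x
  simp only [starL1_apply, inner_smul_right, map_mul, map_neg, neg_neg, Complex.conj_conj,
    inner_conj_symm]
  rw [hinv, neg_neg]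

theorem isometry_starL1 : Isometry D.starL1 := by
  refine Isometry.of_dist_eq fun f f' => ?_
  have h : D.starL1 f - D.starL1 f' = D.starL1 (f - f') :=
    Subtype.ext (funext fun x => (map_sub (starRingEnd ℂ) (f (-x)) (f' (-x))).symm)
  rw [dist_eq_norm, dist_eq_norm, h, norm_L1_eq, norm_L1_eq]
  simp only [D.repOp_starL1, LinearIsometryEquiv.norm_map]

/-- The involution of `C*(G/U, χ_ℓ)`, the continuous extension of that of `L¹(G/U, χ_ℓ)`
(which is isometric). -/
def starC : D.CStar → D.CStar := UniformSpace.Completion.map D.starL1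

theorem starC_coe (f : D.L1) : D.starC (f : D.CStar) = (D.starL1 f : D.CStar) :=
  UniformSpace.Completion.map_coe D.isometry_starL1.uniformContinuous f

/-- Membership in the Schwartz space `S(G/U, χ_ℓ)`: `f` is smooth and its restriction to every
linear complement of `u` is a Schwartz function. -/
def IsSchwartz (f : D.L1) : Prop :=
  ContDiff ℝ ∞ (f : g → ℂ) ∧
    ∀ s : Submodule ℝ g, IsCompl s D.u → ∃ φ : 𝓢(s, ℂ), ∀ x : s, φ x = f (x : g)

end QuotientData

/-! ### The limit situation -/

/-- Indices of the bases `X_1..X_d, Y_1..Y_d, T, Z, A_1..A_{p₁}, A_{p₁+1}..A_{p₁+p₂}`. -/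
abbrev Idx (d p₁ p₂ : ℕ) : Type := Fin d ⊕ Fin d ⊕ Unit ⊕ Unit ⊕ Fin p₁ ⊕ Fin p₂

section Frame

variable {g : Type*} [NormedAddCommGroup g] [InnerProductSpace ℝ g] {d p₁ p₂ : ℕ}
  (b : OrthonormalBasis (Idx d p₁ p₂) ℝ g)

def vX (j : Fin d) : g := b (.inl j)
def vY (j : Fin d) : g := b (.inr (.inl j))
def vT : g := b (.inr (.inr (.inl ())))
def vZ : g := b (.inr (.inr (.inr (.inl ()))))
/-- The vectors `A_j` inside `[g, g]`. -/
def vA (j : Fin p₁) : g := b (.inr (.inr (.inr (.inr (.inl j)))))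
/-- The vectors `A_j` outside `[g, g]`. -/
def vA' (j : Fin p₂) : g := b (.inr (.inr (.inr (.inr (.inr j)))))

/-- The span of `T`, `Z` and all the `A_j`. -/
def spanTZA : Submodule ℝ g :=
  Submodule.span ℝ ({vT b, vZ b} ∪ Set.range (vA b) ∪ Set.range (vA' b))

/-- The span of `Z` and the `A_j` inside `[g, g]`. -/
def spanZA : Submodule ℝ g := Submodule.span ℝ ({vZ b} ∪ Set.range (vA b))

/-- `(x, y) ↦ ∑ x_j X_j + ∑ y_j Y_j`. -/
def secXY : (Eucl d × Eucl d) →L[ℝ] g :=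
  (∑ j, ((EuclideanSpace.proj j : Eucl d →L[ℝ] ℝ).comp
      (ContinuousLinearMap.fst ℝ (Eucl d) (Eucl d))).smulRight (vX b j)) +
  ∑ j, ((EuclideanSpace.proj j : Eucl d →L[ℝ] ℝ).comp
      (ContinuousLinearMap.snd ℝ (Eucl d) (Eucl d))).smulRight (vY b j)

theorem secXY_apply (w : Eucl d × Eucl d) :
    secXY b w = ∑ j, w.1 j • vX b j + ∑ j, w.2 j • vY b j := by
  simp [secXY]

theorem inner_vX_secXY (j : Fin d) (w : Eucl d × Eucl d) :
    inner ℝ (vX b j) (secXY b w) = w.1 j := by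
  rw [secXY_apply, inner_add_right, inner_sum, inner_sum]
  simp [inner_smul_right, vX, vY, b.inner_eq_ite]

theorem inner_vY_secXY (j : Fin d) (w : Eucl d × Eucl d) :
    inner ℝ (vY b j) (secXY b w) = w.2 j := by
  rw [secXY_apply, inner_add_right, inner_sum, inner_sum]
  simp [inner_smul_right, vX, vY, b.inner_eq_ite]

theorem secXY_injective : Function.Injective (secXY b) := by
  intro w w' h
  refine Prod.ext (PiLp.ext fun j => ?_) (PiLp.ext fun j => ?_)
  · rw [← inner_vX_secXY b, h, inner_vX_secXY]
  · rw [← inner_vY_secXY b, h, inner_vY_secXY]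

theorem sum_basis (x : g) : x = secXY b
      (WithLp.toLp 2 fun j => inner ℝ (vX b j) x, WithLp.toLp 2 fun j => inner ℝ (vY b j) x) +
    (inner ℝ (vT b) x • vT b + (inner ℝ (vZ b) x • vZ b + (∑ j, inner ℝ (vA b j) x • vA b j +
      ∑ j, inner ℝ (vA' b j) x • vA' b j))) := by
  conv_lhs => rw [← b.sum_repr' x]
  rw [secXY_apply]
  simp only [Fintype.sum_sum_type, Finset.univ_unique, Finset.sum_singleton]
  simp only [vX, vY, vT, vZ, vA, vA', add_assoc]

theorem vT_mem : vT b ∈ spanTZA b := Submodule.subset_span (by simp)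
theorem vZ_mem : vZ b ∈ spanTZA b := Submodule.subset_span (by simp)
theorem vA_mem (j : Fin p₁) : vA b j ∈ spanTZA b := Submodule.subset_span (by simp)
theorem vA'_mem (j : Fin p₂) : vA' b j ∈ spanTZA b := Submodule.subset_span (by simp)

theorem inner_spanTZA {x y : g} (hx : x ∈ spanTZA b) (hT : inner ℝ y (vT b) = (0 : ℝ))
    (hZ : inner ℝ y (vZ b) = (0 : ℝ)) (hA : ∀ j, inner ℝ y (vA b j) = (0 : ℝ))
    (hA' : ∀ j, inner ℝ y (vA' b j) = (0 : ℝ)) : inner ℝ y x = (0 : ℝ) := by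
  have : spanTZA b ≤ LinearMap.ker (innerₛₗ ℝ y) := by
    refine Submodule.span_le.2 ?_
    rintro z (((rfl | rfl) | ⟨j, rfl⟩) | ⟨j, rfl⟩) <;> simp [*]
  exact this hx

theorem inner_vX_spanTZA {x : g} (hx : x ∈ spanTZA b) (j : Fin d) :
    inner ℝ (vX b j) x = (0 : ℝ) := by
  apply inner_spanTZA b hx <;> simp [vX, vT, vZ, vA, vA', b.inner_eq_ite]

theorem inner_vY_spanTZA {x : g} (hx : x ∈ spanTZA b) (j : Fin d) :
    inner ℝ (vY b j) x = (0 : ℝ) := by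
  apply inner_spanTZA b hx <;> simp [vY, vT, vZ, vA, vA', b.inner_eq_ite]

theorem mem_spanTZA {x : g} (hX : ∀ j, inner ℝ (vX b j) x = (0 : ℝ))
    (hY : ∀ j, inner ℝ (vY b j) x = (0 : ℝ)) : x ∈ spanTZA b := by
  rw [sum_basis b x, secXY_apply]
  simp only [hX, hY, zero_smul, Finset.sum_const_zero, zero_add]
  exact Submodule.add_mem _ (Submodule.smul_mem _ _ (vT_mem b)) (Submodule.add_mem _
    (Submodule.smul_mem _ _ (vZ_mem b)) (Submodule.add_mem _
      (Submodule.sum_mem _ fun j _ => Submodule.smul_mem _ _ (vA_mem b j))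
      (Submodule.sum_mem _ fun j _ => Submodule.smul_mem _ _ (vA'_mem b j))))

theorem spanZA_le : spanZA b ≤ spanTZA b := by
  refine Submodule.span_mono ?_
  rintro z (rfl | ⟨j, rfl⟩) <;> simp

theorem isCompl_secXY :
    IsCompl (LinearMap.range (secXY b : (Eucl d × Eucl d) →ₗ[ℝ] g)) (spanTZA b) := by
  constructor
  · rw [Submodule.disjoint_def]
    rintro _ ⟨w, rfl⟩ hw
    have : w = 0 := by
      refine Prod.ext (PiLp.ext fun j => ?_) (PiLp.ext fun j => ?_)
      · rw [← inner_vX_secXY b]; exact inner_vX_spanTZA b hw j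
      · rw [← inner_vY_secXY b]; exact inner_vY_spanTZA b hw j
    simp [this]
  · rw [codisjoint_iff, eq_top_iff]
    intro x _
    rw [Submodule.mem_sup]
    refine ⟨_, ⟨_, rfl⟩, _, ?_, (sum_basis b x).symm⟩
    exact Submodule.add_mem _ (Submodule.smul_mem _ _ (vT_mem b)) (Submodule.add_mem _
      (Submodule.smul_mem _ _ (vZ_mem b)) (Submodule.add_mem _
        (Submodule.sum_mem _ fun j _ => Submodule.smul_mem _ _ (vA_mem b j))
        (Submodule.sum_mem _ fun j _ => Submodule.smul_mem _ _ (vA'_mem b j))))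

end Frame

/-- A sequence of functionals `ℓ_k → ℓ` on `g` with adapted orthonormal bases
`X^k_j, Y^k_j, T_k, Z_k, A^k_j` of `g` that converge to an orthonormal basis
`X_j, Y_j, T, Z, A_j`. -/
structure LimitSetting (g : Type*) [NormedAddCommGroup g] [InnerProductSpace ℝ g]
    [TwoStepLieAlgebra g] (d p₁ p₂ : ℕ) where
  ℓk : ℕ → (g →L[ℝ] ℝ)
  ℓ : g →L[ℝ] ℝ
  bk : ℕ → OrthonormalBasis (Idx d p₁ p₂) ℝ g
  b : OrthonormalBasis (Idx d p₁ p₂) ℝ g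
  tendsto_ℓ : Tendsto ℓk atTop (𝓝 ℓ)
  tendsto_b : ∀ i, Tendsto (fun k => bk k i) atTop (𝓝 (b i))
  derived_eq : ∀ k, derivedSpace g = spanZA (bk k)
  stabilizer_eq : ∀ k, stabilizer (ℓk k) = spanTZA (bk k)
  ℓk_X : ∀ k j, ℓk k (vX (bk k) j) = 0
  ℓk_Y : ∀ k j, ℓk k (vY (bk k) j) = 0
  ℓk_A : ∀ k j, ℓk k (vA (bk k) j) = 0
  ℓk_A' : ∀ k j, ℓk k (vA' (bk k) j) = 0
  /- As `[g, g]` is spanned by `Z_k` and by the `A^k_j` in the kernel of `ℓ_k`, the next three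
  conditions say that `[X_i, X_j]`, `[Y_i, Y_j]` and, for `i ≠ j`, `[X_i, Y_j]` vanish modulo
  this kernel. -/
  ℓk_XX : ∀ k i j, ℓk k ⁅vX (bk k) i, vX (bk k) j⁆ = 0
  ℓk_YY : ∀ k i j, ℓk k ⁅vY (bk k) i, vY (bk k) j⁆ = 0
  ℓk_XY : ∀ k i j, i ≠ j → ℓk k ⁅vX (bk k) i, vY (bk k) j⁆ = 0
  ℓk_Z : ∀ k, ℓk k (vZ (bk k)) ≠ 0

namespace LimitSetting

variable {g : Type*} [NormedAddCommGroup g] [InnerProductSpace ℝ g] [FiniteDimensional ℝ g]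
  [TwoStepLieAlgebra g] {d p₁ p₂ : ℕ} (S : LimitSetting g d p₁ p₂)

/-- `λ_k = ℓ_k(Z_k)`. -/
def lam (k : ℕ) : ℝ := S.ℓk k (vZ (S.bk k))
/-- `λ = ℓ(Z)`. -/
def lamLim : ℝ := S.ℓ (vZ S.b)
/-- `c^k_j`, the number with `[X^k_j, Y^k_j] = c^k_j Z_k` modulo the kernel of `ℓ_k` in `[g, g]`. -/
def c (k : ℕ) (j : Fin d) : ℝ := inner ℝ (vZ (S.bk k)) ⁅vX (S.bk k) j, vY (S.bk k) j⁆
/-- `c_j`, the limit of the `c^k_j`. -/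
def cLim (j : Fin d) : ℝ := inner ℝ (vZ S.b) ⁅vX S.b j, vY S.b j⁆

theorem inner_derived (y : g) (hy : y ∈ derivedSpace g) (j : Fin d) :
    inner ℝ (vX S.b j) y = (0 : ℝ) ∧ inner ℝ (vY S.b j) y = (0 : ℝ) := by
  have hk : ∀ k, y ∈ spanTZA (S.bk k) := fun k => by
    rw [S.derived_eq k] at hy; exact spanZA_le _ hy
  constructor
  · refine tendsto_nhds_unique ((S.tendsto_b (.inl j)).inner tendsto_const_nhds) ?_
    exact tendsto_const_nhds.congr fun k => (inner_vX_spanTZA _ (hk k) j).symm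
  · refine tendsto_nhds_unique ((S.tendsto_b (.inr (.inl j))).inner tendsto_const_nhds) ?_
    exact tendsto_const_nhds.congr fun k => (inner_vY_spanTZA _ (hk k) j).symm

theorem stabilizer_lim (i : Idx d p₁ p₂) (h : ∀ k, S.bk k i ∈ spanTZA (S.bk k)) :
    S.b i ∈ stabilizer S.ℓ := by
  intro y
  have hc : Continuous fun x : g => ⁅x, y⁆ :=
    (IsLinearMap.mk' (fun x : g => ⁅x, y⁆) (⟨fun a a' => add_lie a a' y,
      fun t a => smul_lie t a y⟩ : IsLinearMap ℝ _)).continuous_of_finiteDimensional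
  refine tendsto_nhds_unique
    ((isBoundedBilinearMap_apply.continuous.tendsto (S.ℓ, ⁅S.b i, y⁆)).comp
      (S.tendsto_ℓ.prodMk_nhds ((hc.tendsto _).comp (S.tendsto_b i)))) ?_
  refine tendsto_const_nhds.congr fun k => ?_
  have := h k
  rw [← S.stabilizer_eq k] at this
  exact (this y).symm

/-- The pair `(u, ℓ)` with `u = span (T, Z, A_j)`, the limit of the subspaces `g(ℓ_k)`, and the
identification of `G/U` with `ℝ^{2d}` by the basis `X_j, Y_j`. -/
def quot : QuotientData g d where
  u := spanTZA S.b
  ℓ := S.ℓ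
  derived_le y hy := mem_spanTZA _ (fun j => (S.inner_derived y hy j).1)
    (fun j => (S.inner_derived y hy j).2)
  le_stabilizer := by
    refine Submodule.span_le.2 ?_
    rintro z (((rfl | rfl) | ⟨j, rfl⟩) | ⟨j, rfl⟩)
    · exact S.stabilizer_lim _ fun k => vT_mem _
    · exact S.stabilizer_lim _ fun k => vZ_mem _
    · exact S.stabilizer_lim _ fun k => vA_mem _ j
    · exact S.stabilizer_lim _ fun k => vA'_mem _ j
  sec := secXY S.b
  sec_injective := secXY_injective S.b
  sec_isCompl := isCompl_secXY S.b

/-- `ĥ(x̃, ỹ) = ∫ h(x, y) exp(-2πi (x̃·x + ỹ·y)) d(x, y)` in the coordinates `x_j, y_j`. -/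
def hhat [MeasurableSpace g] [BorelSpace g] (h : S.quot.L1) (q : Eucl d × Eucl d) : ℂ :=
  ∫ w : Eucl d × Eucl d, h (S.quot.sec w) *
    Complex.exp (-(2 * Real.pi * Complex.I *
      ((∑ j, q.1 j * w.1 j + ∑ j, q.2 j * w.2 j : ℝ) : ℂ)))

end LimitSetting

/-! ### Wave packets, tensor products and induced representations -/

/-- `η_{α,β}(s) = exp(2πi α·s) ∏_j |a_j|^{1/4} η_j(|a_j|^{1/2} (s_j + β_j / a_j))`, to be used
with `a_j = λ_k c^k_j`. -/
def packet {n : ℕ} (a : Fin n → ℝ) (η : Fin n → 𝓢(ℝ, ℂ)) (q : Eucl n × Eucl n) (s : Eucl n) : ℂ :=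
  Complex.exp (2 * Real.pi * Complex.I * ((∑ j, q.1 j * s j : ℝ) : ℂ)) *
    ∏ j, ((|a j| ^ (1 / 4 : ℝ) : ℝ) : ℂ) * η j (|a j| ^ (1 / 2 : ℝ) * (s j + q.2 j / a j))

theorem memLp_packet {n : ℕ} (a : Fin n → ℝ) (η : Fin n → 𝓢(ℝ, ℂ)) (q : Eucl n × Eucl n) :
    MemLp (packet a η q) 2 (volume : Measure (Eucl n)) := by
  have hcont : Continuous (packet a η q) := by
    unfold packet
    refine Continuous.mul (by fun_prop) (continuous_finsetProd _ fun j _ => ?_)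
    exact continuous_const.mul ((η j).continuous.comp (by fun_prop))
  refine (memLp_two_iff_integrable_sq_norm hcont.aestronglyMeasurable).2 ?_
  have h1 : ∀ j, Integrable (fun t : ℝ =>
      ‖((|a j| ^ (1 / 4 : ℝ) : ℝ) : ℂ) * η j (|a j| ^ (1 / 2 : ℝ) * (t + q.2 j / a j))‖ ^ 2) := by
    intro j
    by_cases ha : a j = 0
    · simp [ha]
    · have hpos : |a j| ^ (1 / 2 : ℝ) ≠ 0 := (Real.rpow_pos_of_pos (abs_pos.2 ha) _).ne'
      have h0 : Integrable (fun t : ℝ => ‖η j t‖ ^ 2) :=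
        (memLp_two_iff_integrable_sq_norm (η j).continuous.aestronglyMeasurable).1
          ((η j).memLp 2 volume)
      have h2 := ((h0.comp_mul_left' hpos).comp_add_right (q.2 j / a j)).const_mul
        (‖((|a j| ^ (1 / 4 : ℝ) : ℝ) : ℂ)‖ ^ 2)
      refine h2.congr (Eventually.of_forall fun t => ?_)
      simp only [norm_mul, mul_pow]
  have h3 := (EuclideanSpace.volume_preserving_symm_measurableEquiv_toLp
    (Fin n)).integrable_comp_of_integrable (Integrable.fintype_prod h1)
  refine h3.congr (Eventually.of_forall fun s => ?_)
  have hexp : ‖Complex.exp (2 * Real.pi * Complex.I * ((∑ j, q.1 j * s j : ℝ) : ℂ))‖ = 1 := by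
    rw [Complex.norm_exp]; simp
  simp only [packet, norm_mul, hexp, one_mul, Function.comp, norm_prod, Finset.prod_pow]
  rfl

/-- The wave packet as a vector of `L²(ℝ^n)`. -/
def packetL2 {n : ℕ} (a : Fin n → ℝ) (η : Fin n → 𝓢(ℝ, ℂ)) (q : Eucl n × Eucl n) :
    L2 (Eucl n) := (memLp_packet a η q).toLp _

/-- `P_η ξ = ⟨ξ, η⟩ η`. -/
def proj {H : Type*} [NormedAddCommGroup H] [InnerProductSpace ℂ H] (η : H) : H →L[ℂ] H :=
  InnerProductSpace.rankOne ℂ η η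

section Tensor

variable {X Y : Type} [MeasureSpace X] [MeasureSpace Y] [SigmaFinite (volume : Measure X)]
  [SigmaFinite (volume : Measure Y)]

theorem memLp_tensor (ξ : L2 X) (η : L2 Y) :
    MemLp (fun z : X × Y => ξ z.1 * η z.2) 2 (volume : Measure (X × Y)) := by
  have hm : AEStronglyMeasurable (fun z : X × Y => ξ z.1 * η z.2) (volume : Measure (X × Y)) :=
    (Lp.aestronglyMeasurable ξ).comp_fst.mul (Lp.aestronglyMeasurable η).comp_snd
  refine (memLp_two_iff_integrable_sq_norm hm).2 ?_
  have h1 := (memLp_two_iff_integrable_sq_norm (Lp.aestronglyMeasurable ξ)).1 (Lp.memLp ξ)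
  have h2 := (memLp_two_iff_integrable_sq_norm (Lp.aestronglyMeasurable η)).1 (Lp.memLp η)
  refine (h1.mul_prod h2).congr (Eventually.of_forall fun z => ?_)
  simp only [norm_mul, mul_pow]

/-- The elementary tensor `ξ ⊗ η`, the function `(x, y) ↦ ξ(x) η(y)`. -/
def tensor (ξ : L2 X) (η : L2 Y) : L2 (X × Y) := (memLp_tensor ξ η).toLp _

theorem inner_tensor (ξ ξ' : L2 X) (η η' : L2 Y) :
    inner ℂ (tensor ξ η) (tensor ξ' η') = inner ℂ ξ ξ' * inner ℂ η η' := by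
  rw [L2.inner_def, L2.inner_def, L2.inner_def, ← integral_prod_mul]
  refine integral_congr_ae ?_
  filter_upwards [(memLp_tensor ξ η).coeFn_toLp, (memLp_tensor ξ' η').coeFn_toLp] with z h h'
  change inner ℂ (tensor ξ η z) (tensor ξ' η' z) = _
  rw [tensor, tensor, h, h']
  simp only [RCLike.inner_apply, map_mul]
  ring

/-- `ξ ↦ ξ ⊗ η`. -/
def tensorRight (η : L2 Y) : L2 X →L[ℂ] L2 (X × Y) :=
  LinearMap.mkContinuous
    { toFun := fun ξ => tensor ξ η
      map_add' := fun ξ ξ' => by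
        refine Lp.ext ?_
        have h := (Measure.quasiMeasurePreserving_fst
          (μ := (volume : Measure X)) (ν := (volume : Measure Y))).ae (Lp.coeFn_add ξ ξ')
        filter_upwards [(memLp_tensor (ξ + ξ') η).coeFn_toLp, (memLp_tensor ξ η).coeFn_toLp,
          (memLp_tensor ξ' η).coeFn_toLp, Lp.coeFn_add (tensor ξ η) (tensor ξ' η), h]
          with z h1 h2 h3 h4 h5
        rw [h4, Pi.add_apply]
        simp only [tensor]
        rw [h1, h2, h3, h5, Pi.add_apply, add_mul]
      map_smul' := fun c ξ => by
        refine Lp.ext ?_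
        have h := (Measure.quasiMeasurePreserving_fst
          (μ := (volume : Measure X)) (ν := (volume : Measure Y))).ae (Lp.coeFn_smul c ξ)
        filter_upwards [(memLp_tensor (c • ξ) η).coeFn_toLp, (memLp_tensor ξ η).coeFn_toLp,
          Lp.coeFn_smul c (tensor ξ η), h] with z h1 h2 h3 h4
        simp only [RingHom.id_apply]
        rw [h3, Pi.smul_apply]
        simp only [tensor]
        rw [h1, h2, h4, Pi.smul_apply, smul_eq_mul, smul_eq_mul, mul_assoc] }
    ‖η‖ (fun ξ => by
      change ‖tensor ξ η‖ ≤ ‖η‖ * ‖ξ‖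
      have h := inner_tensor ξ ξ η η
      rw [inner_self_eq_norm_sq_to_K, inner_self_eq_norm_sq_to_K,
        inner_self_eq_norm_sq_to_K] at h
      have h' : ‖tensor ξ η‖ ^ 2 = (‖η‖ * ‖ξ‖) ^ 2 := by
        rw [mul_pow, mul_comm]; exact_mod_cast h
      exact le_of_eq ((sq_eq_sq₀ (norm_nonneg _) (by positivity)).1 h'))

/-- `A ⊗ P_η` as an operator on `L²(X × Y)`. -/
def tensorProj (A : L2 X →L[ℂ] L2 X) (η : L2 Y) : L2 (X × Y) →L[ℂ] L2 (X × Y) :=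
  tensorRight η ∘L A ∘L ContinuousLinearMap.adjoint (tensorRight η)

/-- On elementary tensors `A ⊗ P_η` is what its name says. -/
theorem tensorProj_tensor (A : L2 X →L[ℂ] L2 X) (η : L2 Y) (ξ : L2 X) (ζ : L2 Y) :
    tensorProj A η (tensor ξ ζ) = tensor (A ξ) (proj η ζ) := by
  have h : ContinuousLinearMap.adjoint (tensorRight η) (tensor ξ ζ) = inner ℂ η ζ • ξ := by
    refine ext_inner_left ℂ fun ξ' => ?_
    rw [ContinuousLinearMap.adjoint_inner_right, inner_smul_right, mul_comm]
    exact inner_tensor ξ' ξ η ζ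
  have h2 : ∀ (c : ℂ) (ξ' : L2 X), tensor ξ' (c • η) = c • tensor ξ' η := fun c ξ' => by
    refine Lp.ext ?_
    have h := (Measure.quasiMeasurePreserving_snd
      (μ := (volume : Measure X)) (ν := (volume : Measure Y))).ae (Lp.coeFn_smul c η)
    filter_upwards [(memLp_tensor ξ' (c • η)).coeFn_toLp, (memLp_tensor ξ' η).coeFn_toLp,
      Lp.coeFn_smul c (tensor ξ' η), h] with z h1 h2 h3 h4
    rw [h3, Pi.smul_apply]
    simp only [tensor]
    rw [h1, h2, h4, Pi.smul_apply, smul_eq_mul, smul_eq_mul, mul_left_comm]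
  simp only [tensorProj, ContinuousLinearMap.comp_apply, h, map_smul]
  rw [proj, InnerProductSpace.rankOne_apply, h2]
  rfl

end Tensor

namespace LimitSetting

variable {g : Type*} [NormedAddCommGroup g] [InnerProductSpace ℝ g] [FiniteDimensional ℝ g]
  [TwoStepLieAlgebra g] {m n p₁ p₂ : ℕ} (S : LimitSetting g (m + n) p₁ p₂)

/-- `ṡ ↦ ∑_{j ≤ m} s_j X_j`. -/
def secM (r : Eucl m) : g := ∑ j, r j • vX S.b (Fin.castAdd n j)

/-- The coordinates along `X_1, ..., X_m`. -/
def coordM (x : g) : Eucl m := WithLp.toLp 2 fun j => inner ℝ (vX S.b (Fin.castAdd n j)) x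

/-- The functional `ℓ + (x̃, ỹ)`, where `(x̃, ỹ)` is the functional with values `x̃_j` on `X_{m+j}`,
`ỹ_j` on `Y_{m+j}` and `0` on the other basis vectors. -/
def shift (q : Eucl n × Eucl n) : g →L[ℝ] ℝ :=
  S.ℓ + ∑ j, q.1 j • innerSL ℝ (vX S.b (Fin.natAdd m j)) +
    ∑ j, q.2 j • innerSL ℝ (vY S.b (Fin.natAdd m j))

/-- The extension of a function `φ` on `span (X_1, ..., X_m)` to a `P`-covariant function on `G`,
`p = span (X_{m+1}, ..., X_d, Y_1, ..., Y_d, T, Z, A_j)`:  `s · y ↦ χ(y⁻¹) φ(s)` for `y` in `P`,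
where `χ` is the character of `ℓ + q`. -/
def lift (q : Eucl n × Eucl n) (φ : Eucl m → ℂ) (x : g) : ℂ :=
  chi (S.shift q) (-(cbh (-(S.secM (S.coordM x))) x)) * φ (S.coordM x)

theorem coordM_cbh (x : g) (r : Eucl m) :
    S.coordM (cbh (-x) (S.secM r)) = r - S.coordM x := by
  refine PiLp.ext fun j => ?_
  have h : inner ℝ (vX S.b (Fin.castAdd n j)) ⁅-x, S.secM r⁆ = (0 : ℝ) :=
    (S.inner_derived _ (Submodule.subset_span ⟨_, _, rfl⟩) _).1
  have h' : inner ℝ (vX S.b (Fin.castAdd n j)) (S.secM r) = r j := by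
    simp [secM, inner_sum, inner_smul_right, vX, S.b.inner_eq_ite]
  simp only [coordM, cbh, inner_add_right, inner_smul_right, h, h', inner_neg_right,
    PiLp.sub_apply]
  ring

theorem measurePreserving_shift (x : g) :
    MeasurePreserving (fun r : Eucl m => S.coordM (cbh (-x) (S.secM r))) volume volume := by
  simp only [coordM_cbh]
  exact measurePreserving_sub_right volume (S.coordM x)

theorem norm_lift (q : Eucl n × Eucl n) (φ : Eucl m → ℂ) (x : g) :
    ‖S.lift q φ x‖ = ‖φ (S.coordM x)‖ := by
  rw [lift, norm_mul, chi, Complex.norm_exp]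
  simp

theorem continuous_secM : Continuous S.secM := by unfold secM; fun_prop

theorem continuous_coordM : Continuous S.coordM := by
  unfold coordM
  exact (PiLp.continuous_toLp 2 _).comp (by fun_prop)

theorem continuous_phase (q : Eucl n × Eucl n) (x : g) : Continuous fun r : Eucl m =>
    chi (S.shift q) (-(cbh (-(S.secM (S.coordM (cbh (-x) (S.secM r))))) (cbh (-x) (S.secM r)))) := by
  have hs := S.continuous_secM
  have hb : ∀ y : g, Continuous fun z : g => ⁅y, z⁆ := fun y =>
    (IsLinearMap.mk' (fun z : g => ⁅y, z⁆) (⟨fun a a' => lie_add y a a',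
      fun t a => lie_smul t y a⟩ : IsLinearMap ℝ _)).continuous_of_finiteDimensional
  have h2 : Continuous fun z : g × g => ⁅z.1, z.2⁆ := by
    have h : ∀ z : g × g, ⁅z.1, z.2⁆ = ∑ i, inner ℝ (S.b i) z.1 • ⁅S.b i, z.2⁆ := fun z => by
      conv_lhs => rw [← S.b.sum_repr' z.1]
      rw [sum_lie]
      simp only [smul_lie]
    simp only [h]
    refine continuous_finsetSum _ fun i _ => Continuous.smul (by fun_prop) ?_
    exact (hb _).comp continuous_snd
  have hc : ∀ {u v : Eucl m → g}, Continuous u → Continuous v →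
      Continuous fun r => cbh (u r) (v r) := fun hu hv =>
    (hu.add hv).add (Continuous.smul continuous_const (h2.comp (hu.prodMk hv)))
  have h3 := hc (continuous_const (y := -x)) hs
  have h4 := hc ((hs.comp (S.continuous_coordM.comp h3)).neg) h3
  unfold chi
  refine Complex.continuous_exp.comp (Continuous.neg (continuous_const.mul
    (Complex.continuous_ofReal.comp ((S.shift q).continuous.comp h4.neg))))

theorem memLp_ind (q : Eucl n × Eucl n) (x : g) (φ : L2 (Eucl m)) :
    MemLp (fun r : Eucl m => S.lift q φ (cbh (-x) (S.secM r))) 2 volume := by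
  have h := (Lp.memLp φ).comp_measurePreserving (S.measurePreserving_shift x)
  refine h.of_le ((S.continuous_phase q x).aestronglyMeasurable.mul h.1)
    (Eventually.of_forall fun r => le_of_eq (S.norm_lift q _ _))

/-- The operator `π_{ℓ+q}(x)` of the representation `π_{ℓ+q} = ind_P^G χ_{ℓ+q}`, which acts by
left translation on the `P`-covariant functions, realized on `L²(ℝ^m)` by restriction to
`span (X_1, ..., X_m)`:  `(π_{ℓ+q}(x) φ)(r) = (lift φ)(x⁻¹ · r)`. -/
def indOp (q : Eucl n × Eucl n) (x : g) : L2 (Eucl m) →L[ℂ] L2 (Eucl m) :=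
  LinearMap.mkContinuous
    { toFun := fun φ => (S.memLp_ind q x φ).toLp _
      map_add' := fun φ φ' => by
        refine Lp.ext ?_
        have h := (S.measurePreserving_shift x).quasiMeasurePreserving.ae (Lp.coeFn_add φ φ')
        filter_upwards [(S.memLp_ind q x (φ + φ')).coeFn_toLp, (S.memLp_ind q x φ).coeFn_toLp,
          (S.memLp_ind q x φ').coeFn_toLp, Lp.coeFn_add ((S.memLp_ind q x φ).toLp _)
            ((S.memLp_ind q x φ').toLp _), h] with r h1 h2 h3 h4 h5
        rw [h4, Pi.add_apply, h1, h2, h3]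
        simp only [lift]
        rw [h5, Pi.add_apply, mul_add]
      map_smul' := fun c φ => by
        refine Lp.ext ?_
        have h := (S.measurePreserving_shift x).quasiMeasurePreserving.ae (Lp.coeFn_smul c φ)
        filter_upwards [(S.memLp_ind q x (c • φ)).coeFn_toLp, (S.memLp_ind q x φ).coeFn_toLp,
          Lp.coeFn_smul c ((S.memLp_ind q x φ).toLp _), h] with r h1 h2 h3 h4
        simp only [RingHom.id_apply]
        rw [h3, Pi.smul_apply, h1, h2]
        simp only [lift]
        rw [h4, Pi.smul_apply, smul_eq_mul, smul_eq_mul, mul_left_comm] }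
    1 (fun φ => by
      rw [one_mul]
      change ‖(S.memLp_ind q x φ).toLp _‖ ≤ ‖φ‖
      rw [Lp.norm_toLp, Lp.norm_def]
      refine ENNReal.toReal_mono (Lp.eLpNorm_ne_top φ) ?_
      rw [← eLpNorm_comp_measurePreserving (Lp.aestronglyMeasurable φ)
        (S.measurePreserving_shift x)]
      exact eLpNorm_mono fun r => le_of_eq (S.norm_lift q _ _))

end LimitSetting

/-- `T = ∫ Φ(q) dq` in the weak sense: all matrix coefficients are integrable, and
`⟨T ξ, ψ⟩ = ∫ ⟨Φ(q) ξ, ψ⟩ dq`. -/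
def IsWeakIntegral {Q : Type*} [MeasureSpace Q] {H : Type*} [NormedAddCommGroup H]
    [InnerProductSpace ℂ H] (T : H →L[ℂ] H) (Φ : Q → (H →L[ℂ] H)) : Prop :=
  ∀ ξ ψ : H, Integrable (fun q => inner ℂ ψ (Φ q ξ)) ∧
    inner ℂ ψ (T ξ) = ∫ q, inner ℂ ψ (Φ q ξ)

/-- The compact operators on `L²(X)`. -/
abbrev KL2 (X : Type) [MeasureSpace X] : Type :=
  compactOperator (RingHom.id ℂ) (L2 X) (L2 X)

namespace LimitSetting

variable {g : Type*} [NormedAddCommGroup g] [InnerProductSpace ℝ g] [FiniteDimensional ℝ g]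
  [TwoStepLieAlgebra g]

/-- The integrand of `ν_k`, second case: `φ(q) P_{η_{k,q}} / ∏_j |λ_k c^k_j|`. -/
def integrand₂ {d p₁ p₂ : ℕ} (S : LimitSetting g d p₁ p₂) (η : Fin d → 𝓢(ℝ, ℂ)) (k : ℕ)
    (φ : Eucl d × Eucl d → ℂ) (q : Eucl d × Eucl d) : L2 (Eucl d) →L[ℂ] L2 (Eucl d) :=
  (((∏ j, |S.lam k * S.c k j|)⁻¹ : ℝ) : ℂ) • φ q •
    proj (packetL2 (fun j => S.lam k * S.c k j) η q)

/-- The integrand of `ν_k` and `μ_k`, third case, where `d = m + n` and `L²(ℝ^d)` is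
`L²(ℝ^m × ℝ^n)`: `φ(q) ⊗ P_{η_{k,q}} / ∏_{j > m} |λ_k c^k_j|`. -/
def integrand₃ {m n p₁ p₂ : ℕ} (S : LimitSetting g (m + n) p₁ p₂) (η : Fin (m + n) → 𝓢(ℝ, ℂ))
    (k : ℕ) (φ : Eucl n × Eucl n → KL2 (Eucl m)) (q : Eucl n × Eucl n) :
    L2 (Eucl m × Eucl n) →L[ℂ] L2 (Eucl m × Eucl n) :=
  (((∏ j, |S.lam k * S.c k (Fin.natAdd m j)|)⁻¹ : ℝ) : ℂ) •
    tensorProj (φ q : L2 (Eucl m) →L[ℂ] L2 (Eucl m))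
      (packetL2 (fun j => S.lam k * S.c k (Fin.natAdd m j)) (fun j => η (Fin.natAdd m j)) q)

end LimitSetting

end TwoStep

end

open TwoStep

set_option linter.unusedSectionVars false

noncomputable section

namespace TwoStep

/-! On `g / u` the form `ℓ [·, ·]` is diagonal in the limit basis: it pairs `X_j` with `Y_j` with
coefficient `kappa j = λ c_j`. Its radical is all of `g / u` in the second case and the span of the
`X_j, Y_j` with `j > m` in the third. Both cases are instances of one argument.

Dual. Let `π` be irreducible and equal to `χ_ℓ` on `U`. The radical acts by scalars (Schur), hence
through a character with some parameter `q`; the symplectic complement acts through a Weyl system. A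
Weyl system on a nonzero space has a unit vacuum vector whose diagonal coefficient is the Gaussian,
because smearing with the Gaussian gives a projection `P` with `P W(w) P = gauss(w) P`. So
representations with the same `q` share a diagonal coefficient, and comparing cyclic vectors shows
that `‖π(f)‖` depends on `q` only (`SymplecticFrame.norm_repOp_le`). The `C*`-norm is therefore the
supremum over an explicit family: characters in the second case, the Schrödinger model of `π_{ℓ+q}`
in the third. In such a family `q` enters only through a scalar phase, so `q ↦ π_q(h)` is continuous
by dominated convergence. For Schwartz `h` it decays faster than any power, by integration by parts
along the radical, and approximation puts it in `C₀` for every `h`. This gives the isometry `F`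
(`RadicalFamily.exists_linearIsometry`). Its values are compact because a smeared Weyl operator is
approximated by integrals of rank one projections onto translates of the vacuum.

Wave packets. Write the integrand as `c V_q φ(q) V_q^*`, with `V_q z = z η_q` or `V_q ξ = ξ ⊗ η_q`.
Plancherel in `α` and a change of variables in `β` give the Bessel inequality `c ∫ ‖V_q^* ξ‖² dq ≤
‖ξ‖²` (`lintegral_enorm_inner_packetL2_le`); the weight `∏ |λ_k c^k_j|` is exactly the `β`-integral
of the squared envelope, and it is nonzero since `X^k_j` is not in the stabilizer. By Cauchy-Schwarz
the weak integral exists with norm at most `sup ‖φ‖`. For Schwartz `h` the integral is a Bochner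
integral of compact operators; density of Schwartz elements gives compactness and uniqueness on the
whole completion, and adjoints can be taken under the weak integral. -/

/-! ### Schur's lemma, characters of the line, injectivity of the Fourier transform. -/

/-- Schur's lemma through the continuous functional calculus: two distinct points of the spectrum
would give functions of `T` that are nonzero with product zero, and the kernel of the first would be
a nontrivial closed invariant subspace. So the spectrum is one point and the normal operator is
scalar. -/
theorem exists_eq_smul_of_commute {H : Type*} [NormedAddCommGroup H] [InnerProductSpace ℂ H]
    [CompleteSpace H] [Nontrivial H] (T : H →L[ℂ] H) [IsStarNormal T] (S : Set (H →L[ℂ] H))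
    (hirr : ∀ K : Submodule ℂ H, IsClosed (K : Set H) → (∀ A ∈ S, ∀ v ∈ K, A v ∈ K) →
      K = ⊥ ∨ K = ⊤)
    (hT : ∀ A ∈ S, Commute T A) (hT' : ∀ A ∈ S, Commute (star T) A) :
    ∃ c : ℂ, ∀ v, T v = c • v := by
  obtain ⟨z, hz⟩ := spectrum.nonempty T
  have hsub : ∀ w ∈ spectrum ℂ T, w = z := by
    intro w hw
    by_contra hne
    have hpos : 0 < ‖z - w‖ := norm_pos_iff.2 (sub_ne_zero.2 (Ne.symm hne))
    -- Tents around `z` and `w` of radius half their distance, so that the supports do not overlap.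
    let f : ℂ → ℂ := fun x => ((max 0 (‖z - w‖ / 2 - ‖x - z‖) : ℝ) : ℂ)
    let g : ℂ → ℂ := fun x => ((max 0 (‖z - w‖ / 2 - ‖x - w‖) : ℝ) : ℂ)
    have hf : Continuous f := by fun_prop
    have hg : Continuous g := by fun_prop
    have hfg : ∀ x, f x * g x = 0 := fun x => by
      have htri : ‖z - w‖ ≤ ‖x - z‖ + ‖x - w‖ := by
        rw [← norm_neg (x - z), neg_sub]
        simpa using norm_add_le (z - x) (x - w)
      rcases le_total (‖z - w‖ / 2) ‖x - z‖ with h | h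
      · simp [f, max_eq_left (sub_nonpos.2 h)]
      · have h' : ‖z - w‖ / 2 ≤ ‖x - w‖ := by linarith
        simp [g, max_eq_left (sub_nonpos.2 h')]
    have hmul : cfc f T * cfc g T = 0 := by
      rw [← cfc_mul f g T hf.continuousOn hg.continuousOn]
      simp only [hfg]
      rw [cfc_const 0 T ‹_›, map_zero]
    have hne0 : ∀ (φ : ℂ → ℂ) (y : ℂ), Continuous φ → y ∈ spectrum ℂ T → φ y ≠ 0 →
        cfc φ T ≠ 0 := fun φ y hφ hy hyne h0 => by
      have h1 := cfc_map_spectrum φ T (hf := hφ.continuousOn)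
      rw [h0, spectrum.zero_eq] at h1
      have h2 : φ y ∈ ({0} : Set ℂ) := by rw [h1]; exact ⟨y, hy, rfl⟩
      exact hyne (by simpa using h2)
    have hpos' : ((‖z - w‖ / 2 : ℝ) : ℂ) ≠ 0 := by exact_mod_cast (half_pos hpos).ne'
    have hfz : f z ≠ 0 := by
      simpa [f, max_eq_right (half_pos hpos).le] using sub_ne_zero.2 (Ne.symm hne)
    have hgw : g w ≠ 0 := by
      simpa [g, max_eq_right (half_pos hpos).le] using sub_ne_zero.2 (Ne.symm hne)
    let R : H →L[ℂ] H := cfc f T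
    -- The kernel of `f(T)` contains the range of `g(T)`: if it is zero then `g(T) = 0`, if it is
    -- everything then `f(T) = 0`.
    rcases hirr (LinearMap.ker (R : H →ₗ[ℂ] H)) R.isClosed_ker (fun A hA v hv => by
        have hc := DFunLike.congr_fun ((hT A hA).cfc (hT' A hA) f).eq v
        simp only [mul_apply_eq_comp] at hc
        have hv' : cfc f T v = 0 := hv
        change cfc f T (A v) = 0
        rw [hc, hv', map_zero]) with h | h
    · refine hne0 g w hg hw hgw (ContinuousLinearMap.ext fun v => ?_)
      have : cfc g T v ∈ LinearMap.ker (R : H →ₗ[ℂ] H) := DFunLike.congr_fun hmul v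
      rw [h] at this
      exact (Submodule.mem_bot ℂ).1 this
    · refine hne0 f z hf hz hfz (ContinuousLinearMap.ext fun v => ?_)
      have : v ∈ LinearMap.ker (R : H →ₗ[ℂ] H) := by rw [h]; trivial
      exact this
  refine ⟨z, fun v => ?_⟩
  have h1 : cfc (fun x : ℂ => x) T = cfc (fun _ : ℂ => z) T := cfc_congr fun w hw => hsub w hw
  rw [cfc_id' ℂ T ‹_›, cfc_const z T ‹_›] at h1
  rw [h1]
  rfl

/-- Multiplying by `∫₀^δ f` turns `f` into a difference of primitives, so a continuous character is
differentiable. It then solves `f' = c f`, and unit modulus makes `c` imaginary. -/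
theorem exists_eq_exp_of_continuous (f : ℝ → ℂ) (hf : Continuous f)
    (hadd : ∀ s t, f (s + t) = f s * f t) (hnorm : ∀ t, ‖f t‖ = 1) :
    ∃ q : ℝ, ∀ t, f t = Complex.exp (-(2 * Real.pi * Complex.I * ((q * t : ℝ) : ℂ))) := by
  have h0 : f 0 = 1 := by
    have h := hadd 0 0
    rw [add_zero] at h
    have hne : f 0 ≠ 0 := fun h' => by simpa [h'] using hnorm 0
    exact mul_left_cancel₀ hne (by rw [← h, mul_one])
  have hint : ∀ a b, IntervalIntegrable f volume a b := fun a b => hf.intervalIntegrable a b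
  have hder : ∀ t, HasDerivAt (fun t => ∫ s in (0 : ℝ)..t, f s) (f t) t := fun t =>
    intervalIntegral.integral_hasDerivAt_right (hint _ _)
      (hf.stronglyMeasurableAtFilter _ _) hf.continuousAt
  -- The primitive cannot vanish identically, its derivative at `0` being `f 0 = 1`.
  obtain ⟨δ, hδ⟩ : ∃ δ : ℝ, ∫ s in (0 : ℝ)..δ, f s ≠ 0 := by
    by_contra! h
    have := (hder 0).unique (by simpa only [h] using hasDerivAt_const (0 : ℝ) (0 : ℂ))
    rw [h0] at this
    exact one_ne_zero this
  set I := ∫ s in (0 : ℝ)..δ, f s with hI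
  have key : ∀ t, f t * I = (∫ s in (0 : ℝ)..(t + δ), f s) - ∫ s in (0 : ℝ)..t, f s := fun t => by
    rw [intervalIntegral.integral_interval_sub_left (hint _ _) (hint _ _), hI,
      ← intervalIntegral.integral_const_mul]
    simp only [← hadd]
    rw [intervalIntegral.integral_comp_add_left (fun s => f s) t, add_zero]
  have hfd : ∀ t, HasDerivAt f ((f (t + δ) - f t) / I) t := fun t => by
    have h1 := (((hder (t + δ)).comp_add_const t δ).sub (hder t)).div_const I
    refine h1.congr_of_eventuallyEq (Eventually.of_forall fun s => ?_)
    simp only [Pi.sub_apply]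
    rw [← key, mul_div_cancel_right₀ _ hδ]
  set c := (f δ - 1) / I with hc
  have hfd' : ∀ t, HasDerivAt f (c * f t) t := fun t => by
    convert hfd t using 1
    rw [hadd, hc]; ring
  have hconst : ∀ t : ℝ, f t * Complex.exp (-(c * t)) = 1 := by
    have hd : ∀ t : ℝ, HasDerivAt (fun t : ℝ => f t * Complex.exp (-(c * t))) 0 t := fun t => by
      have h1 : HasDerivAt (fun t : ℝ => -(c * (t : ℂ))) (-(c * 1)) t :=
        ((Complex.ofRealCLM.hasDerivAt (x := t)).const_mul c).neg
      have h2 := (hfd' t).mul h1.cexp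
      rwa [show c * f t * Complex.exp (-(c * t)) + f t * (Complex.exp (-(c * t)) * -(c * 1)) = 0 by
        ring] at h2
    intro t
    have := is_const_of_deriv_eq_zero (fun t => (hd t).differentiableAt) (fun t => (hd t).deriv) t 0
    simpa [h0] using this
  have hexp : ∀ t : ℝ, f t = Complex.exp (c * t) := fun t => by
    have := hconst t
    rw [Complex.exp_neg] at this
    exact (mul_inv_eq_one₀ (Complex.exp_ne_zero _)).1 this
  have hre : c.re = 0 := by
    have := hnorm 1
    rw [hexp, Complex.norm_exp] at this
    simpa using this
  refine ⟨-c.im / (2 * Real.pi), fun t => ?_⟩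
  rw [hexp]
  congr 1
  have hpi : (Real.pi : ℂ) ≠ 0 := by exact_mod_cast Real.pi_ne_zero
  have : c = c.im * Complex.I := by
    apply Complex.ext <;> simp [hre]
  conv_lhs => rw [this]
  push_cast
  field_simp

/-- A smooth compactly supported test function is the Fourier transform of a Schwartz function, and
the transform can be moved from it onto `f`. -/
theorem ae_eq_zero_of_fourier_eq_zero {V : Type*} [NormedAddCommGroup V] [InnerProductSpace ℝ V]
    [FiniteDimensional ℝ V] [MeasurableSpace V] [BorelSpace V] {f : V → ℂ} (hf : Integrable f)
    (h : ∀ w, ∫ v, Complex.exp (-(2 * Real.pi * Complex.I * ((inner ℝ v w : ℝ) : ℂ))) * f v = 0) :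
    f =ᵐ[volume] 0 := by
  have h0 : FourierTransform.fourier f = 0 := by
    ext w
    rw [Real.fourier_eq', Pi.zero_apply, ← h w]
    refine integral_congr_ae (Eventually.of_forall fun v => ?_)
    simp only [smul_eq_mul]
    congr 2
    push_cast
    ring
  refine ae_eq_zero_of_integral_contDiff_smul_eq_zero hf.locallyIntegrable fun g hg hgc => ?_
  let φ : 𝓢(V, ℂ) := (hgc.comp_left (g := ((↑) : ℝ → ℂ)) rfl).toSchwartzMap
    (Complex.ofRealCLM.contDiff.comp hg)
  obtain ⟨ψ, hψ⟩ : ∃ ψ : 𝓢(V, ℂ), FourierTransform.fourier ψ = φ :=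
    ⟨FourierTransformInv.fourierInv φ, FourierTransform.fourier_fourierInv_eq φ⟩
  have key := VectorFourier.integral_fourierIntegral_smul_eq_flip (L := innerₗ V)
    Real.continuous_fourierChar continuous_inner hf (ψ.integrable (μ := volume))
  have h1 : VectorFourier.fourierIntegral Real.fourierChar volume (innerₗ V) f = 0 := h0
  have h2 : VectorFourier.fourierIntegral Real.fourierChar volume (innerₗ V).flip ψ = φ := by
    rw [flip_innerₗ, ← hψ]; rfl
  rw [h1, h2] at key
  simp only [Pi.zero_apply, zero_smul, integral_zero] at key
  rw [key]
  refine integral_congr_ae (Eventually.of_forall fun v => ?_)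
  change (g v : ℝ) • f v = f v • ((g v : ℝ) : ℂ)
  rw [Complex.real_smul, smul_eq_mul, mul_comm]

/-! ### Phases, the symplectic structure and the Gaussian on phase space. -/

/-- `exp(-2πi t)`. -/
def phase (t : ℝ) : ℂ := Complex.exp (-(2 * Real.pi * Complex.I * (t : ℂ)))

theorem chi_eq_phase {g : Type*} [NormedAddCommGroup g] [InnerProductSpace ℝ g] (ℓ : g →L[ℝ] ℝ)
    (x : g) : chi ℓ x = phase (ℓ x) := rfl

theorem phase_add (s t : ℝ) : phase (s + t) = phase s * phase t := by
  rw [phase, phase, phase, ← Complex.exp_add]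
  push_cast
  ring_nf

@[simp] theorem phase_zero : phase 0 = 1 := by simp [phase]

@[simp] theorem norm_phase (t : ℝ) : ‖phase t‖ = 1 := by
  rw [phase, Complex.norm_exp]; simp

@[fun_prop] theorem continuous_phase : Continuous phase := by
  unfold phase; fun_prop

theorem exists_eq_phase (f : ℝ → ℂ) (hf : Continuous f)
    (hadd : ∀ s t, f (s + t) = f s * f t) (hnorm : ∀ t, ‖f t‖ = 1) :
    ∃ q : ℝ, ∀ t, f t = phase (q * t) :=
  exists_eq_exp_of_continuous f hf hadd hnorm

/-- The phase space `ℝ^m × ℝ^m` with its Euclidean structure. -/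
abbrev PhaseSpace (m : ℕ) : Type := EuclideanSpace ℝ (Fin m ⊕ Fin m)

/-- The complex structure `(x, y) ↦ (y, -x)` of phase space. -/
def rot (m : ℕ) : PhaseSpace m →ₗ[ℝ] PhaseSpace m where
  toFun z := WithLp.toLp 2 (Sum.elim (fun j => z (.inr j)) (fun j => -z (.inl j)))
  map_add' z y := by
    ext (j | j) <;> simp [add_comm]
  map_smul' c z := by
    ext (j | j) <;> simp

theorem rot_rot {m : ℕ} (z : PhaseSpace m) : rot m (rot m z) = -z := by
  ext (j | j) <;> simp [rot]

theorem inner_rot {m : ℕ} (z y : PhaseSpace m) : inner ℝ z (rot m y) =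
    ∑ j, (z (.inl j) * y (.inr j) - z (.inr j) * y (.inl j)) := by
  simp [PiLp.inner_apply, rot, mul_comm, sub_eq_add_neg,
    Finset.sum_add_distrib]

theorem inner_rot_swap {m : ℕ} (z y : PhaseSpace m) :
    inner ℝ z (rot m y) = -inner ℝ y (rot m z) := by
  rw [inner_rot, inner_rot, ← Finset.sum_neg_distrib]
  exact Finset.sum_congr rfl fun j _ => by ring

theorem inner_rot_self {m : ℕ} (z : PhaseSpace m) : inner ℝ z (rot m z) = 0 := by
  have := inner_rot_swap z z
  linarith

theorem norm_rot {m : ℕ} (z : PhaseSpace m) : ‖rot m z‖ ^ 2 = ‖z‖ ^ 2 := by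
  rw [← real_inner_self_eq_norm_sq, inner_rot_swap, rot_rot, inner_neg_right, neg_neg,
    real_inner_self_eq_norm_sq]

theorem continuous_rot (m : ℕ) : Continuous (rot m) :=
  LinearMap.continuous_of_finiteDimensional _

/-- The Gaussian `exp(-π |z|² / 2)` on phase space. -/
def gauss {m : ℕ} (z : PhaseSpace m) : ℝ := Real.exp (-(Real.pi / 2) * ‖z‖ ^ 2)

theorem gauss_pos {m : ℕ} (z : PhaseSpace m) : 0 < gauss z := Real.exp_pos _

@[simp] theorem gauss_neg {m : ℕ} (z : PhaseSpace m) : gauss (-z) = gauss z := by simp [gauss]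

theorem gauss_zero {m : ℕ} : gauss (0 : PhaseSpace m) = 1 := by simp [gauss]

theorem contDiff_gauss {m : ℕ} : ContDiff ℝ ∞ (gauss (m := m)) :=
  Real.contDiff_exp.comp (contDiff_const.mul (contDiff_norm_sq ℝ))

@[fun_prop] theorem continuous_gauss {m : ℕ} : Continuous (gauss (m := m)) :=
  contDiff_gauss.continuous

theorem integrable_gauss {m : ℕ} : Integrable (fun z : PhaseSpace m => (gauss z : ℂ)) := by
  have h := GaussianFourier.integrable_cexp_neg_mul_sq_norm_add (V := PhaseSpace m)
    (b := ((Real.pi / 2 : ℝ) : ℂ)) (by simpa using Real.pi_pos) 0 0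
  refine h.congr (Eventually.of_forall fun z => ?_)
  simp only [gauss, Complex.ofReal_exp]
  congr 1
  push_cast
  ring

/-- The twisted convolution of the Gaussian, a point mass at `w` and the Gaussian again. This is the
scalar identity behind `P W(w) P = gauss(w) P`. In `y` it is a Gaussian integral with quadratic part
exactly `π |y|²`, so its prefactor is `1` and only a completed square remains. -/
theorem integral_gauss_twisted {m : ℕ} (w z : PhaseSpace m) :
    ∫ y : PhaseSpace m, (gauss y : ℂ) * gauss (z - w - y) *
      phase ((inner ℝ y (rot m w) + inner ℝ (y + w) (rot m (z - w - y))) / 2) =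
    gauss w * gauss z := by
  have hpi : (Real.pi : ℂ) ≠ 0 := by exact_mod_cast Real.pi_ne_zero
  -- The coefficient of `y` in the exponent: the real part comes from `‖z - w - y‖²`, the imaginary
  -- part from the phase.
  let c : Fin m ⊕ Fin m → ℂ := fun i =>
    Real.pi * ((z - w) i : ℂ) - Real.pi * Complex.I * (rot m (z + w) i : ℂ)
  have hG := GaussianFourier.integral_cexp_neg_sum_mul_add (ι := Fin m ⊕ Fin m)
    (b := fun _ => (Real.pi : ℂ)) (fun _ => by simpa using Real.pi_pos) c
  have hprod : (∏ i, ((Real.pi : ℂ) / Real.pi) ^ (1 / 2 : ℂ) * Complex.exp (c i ^ 2 / (4 * Real.pi)))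
      = Complex.exp (∑ i, c i ^ 2 / (4 * Real.pi)) := by
    rw [Complex.exp_sum]
    simp only [div_self hpi, Complex.one_cpow, one_mul]
  have hr : ∀ u v : PhaseSpace m, ∑ i, (u i : ℂ) * (v i : ℂ) = ((inner ℝ u v : ℝ) : ℂ) := by
    intro u v
    simp [PiLp.inner_apply, mul_comm]
  have hc : ∑ i, c i ^ 2 / (4 * Real.pi) = ((Real.pi / 4 * (‖z - w‖ ^ 2 - ‖z + w‖ ^ 2) : ℝ) : ℂ)
      - Real.pi * Complex.I * ((inner ℝ z (rot m w) : ℝ) : ℂ) := by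
    have h1 : ∀ i, c i ^ 2 / (4 * Real.pi) = Real.pi / 4 * (((z - w) i : ℂ) * ((z - w) i : ℂ)) -
        Real.pi / 4 * ((rot m (z + w) i : ℂ) * (rot m (z + w) i : ℂ)) -
        Real.pi * Complex.I / 2 * (((z - w) i : ℂ) * (rot m (z + w) i : ℂ)) := fun i => by
      have hI : Complex.I ^ 2 = -1 := Complex.I_sq
      simp only [c]
      field_simp
      ring_nf
      rw [hI]
      ring
    simp only [h1]
    rw [Finset.sum_sub_distrib, Finset.sum_sub_distrib, ← Finset.mul_sum, ← Finset.mul_sum,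
      ← Finset.mul_sum, hr, hr, hr, real_inner_self_eq_norm_sq, real_inner_self_eq_norm_sq,
      norm_rot]
    have h2 : inner ℝ (z - w) (rot m (z + w)) = 2 * inner ℝ z (rot m w) := by
      rw [map_add, inner_sub_left, inner_add_right, inner_add_right, inner_rot_self,
        inner_rot_self, inner_rot_swap w z]
      ring
    rw [h2]
    push_cast
    ring
  rw [hprod, hc, ← (EuclideanSpace.volume_preserving_symm_measurableEquiv_toLp
    (Fin m ⊕ Fin m)).integral_comp'] at hG
  have hint : ∀ y : PhaseSpace m, (gauss y : ℂ) * gauss (z - w - y) *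
      phase ((inner ℝ y (rot m w) + inner ℝ (y + w) (rot m (z - w - y))) / 2) =
      Complex.exp (((-(Real.pi / 2) * ‖z - w‖ ^ 2 : ℝ) : ℂ) +
        Real.pi * Complex.I * ((inner ℝ z (rot m w) : ℝ) : ℂ)) *
      Complex.exp (-∑ i, (Real.pi : ℂ) * (y i : ℂ) ^ 2 + ∑ i, c i * (y i : ℂ)) := fun y => by
    have e1 : ∑ i, (Real.pi : ℂ) * (y i : ℂ) ^ 2 = ((Real.pi * ‖y‖ ^ 2 : ℝ) : ℂ) := by
      rw [← Finset.mul_sum]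
      simp only [sq (_ : ℂ)]
      rw [hr, real_inner_self_eq_norm_sq]
      push_cast
      rfl
    have e2 : ∑ i, c i * (y i : ℂ) = ((Real.pi * inner ℝ (z - w) y : ℝ) : ℂ) -
        Real.pi * Complex.I * ((inner ℝ (rot m (z + w)) y : ℝ) : ℂ) := by
      simp only [c, sub_mul, Finset.sum_sub_distrib, mul_assoc]
      rw [← Finset.mul_sum, hr, ← Finset.mul_sum, ← Finset.mul_sum, hr]
      push_cast
      rfl
    have e3 : inner ℝ y (rot m w) + inner ℝ (y + w) (rot m (z - w - y)) =
        inner ℝ (rot m (z + w)) y - inner ℝ z (rot m w) := by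
      rw [real_inner_comm]
      simp only [map_add, map_sub, inner_add_left, inner_sub_right, inner_rot_self]
      rw [inner_rot_swap w z, inner_rot_swap w y, real_inner_comm (rot m w) y,
        real_inner_comm (rot m z) y]
      ring
    have e4 : ‖z - w - y‖ ^ 2 = ‖z - w‖ ^ 2 - 2 * inner ℝ (z - w) y + ‖y‖ ^ 2 :=
      norm_sub_sq_real _ _
    rw [e1, e2, e3, gauss, gauss, phase, e4, Complex.ofReal_exp, Complex.ofReal_exp,
      ← Complex.exp_add, ← Complex.exp_add, ← Complex.exp_add]
    congr 1
    push_cast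
    ring
  simp only [hint]
  rw [integral_const_mul]
  refine (congrArg _ hG).trans ?_
  -- What is left is a Gaussian in `z - w` and `z + w`, which the parallelogram law separates into
  -- `gauss w * gauss z`.
  have hpar : ‖z + w‖ ^ 2 = 2 * (‖z‖ ^ 2 + ‖w‖ ^ 2) - ‖z - w‖ ^ 2 := by
    have := parallelogram_law_with_norm ℝ z w
    nlinarith [this]
  rw [← Complex.exp_add, gauss, gauss, Complex.ofReal_exp, Complex.ofReal_exp, ← Complex.exp_add,
    hpar]
  congr 1
  push_cast
  ring

/-! ### Weyl systems and their vacuum vectors. -/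

/-- A strongly continuous projective representation of phase space for the standard symplectic
form: a representation of the canonical commutation relations in Weyl's form. -/
structure WeylSystem (m : ℕ) (H : Type*) [NormedAddCommGroup H] [InnerProductSpace ℂ H] where
  op : PhaseSpace m → (H ≃ₗᵢ[ℂ] H)
  map_mul : ∀ z y v, op z (op y v) = phase (inner ℝ z (rot m y) / 2) • op (z + y) v
  continuous_op : ∀ v, Continuous fun z => op z v

namespace WeylSystem

variable {m : ℕ} {H : Type*} [NormedAddCommGroup H] [InnerProductSpace ℂ H] [CompleteSpace H]
  (W : WeylSystem m H)

theorem op_zero (v : H) : W.op 0 v = v := by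
  apply (W.op 0).injective
  simpa using W.map_mul 0 0 v

theorem op_neg_op (z : PhaseSpace m) (v : H) : W.op (-z) (W.op z v) = v := by
  simp [W.map_mul, inner_rot_self, W.op_zero]

theorem inner_op_left (z : PhaseSpace m) (v w : H) :
    inner ℂ (W.op z v) w = inner ℂ v (W.op (-z) w) := by
  rw [← (W.op (-z)).inner_map_map, W.op_neg_op]

/-- The two half-phases of the Weyl relation add up to a full symplectic phase. Read as a function
of `y` this phase is a Fourier character, which is how Fourier transforms enter the study of Weyl
systems below. -/
theorem op_conj (z y : PhaseSpace m) (v : H) :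
    W.op z (W.op y (W.op (-z) v)) = phase (inner ℝ z (rot m y)) • W.op y v := by
  rw [W.map_mul y, map_smul, W.map_mul, smul_smul, ← phase_add]
  congr 2
  · simp only [map_neg, map_add, inner_neg_right, inner_add_right, inner_rot_self]
    rw [inner_rot_swap y z]
    ring
  · abel_nf

theorem integrable_smear {f : PhaseSpace m → ℂ} (hf : Integrable f) (v : H) :
    Integrable fun z => f z • W.op z v := by
  refine (hf.norm.mul_const ‖v‖).mono' (hf.1.smul (W.continuous_op v).aestronglyMeasurable)
    (Eventually.of_forall fun w => ?_)
  simp [norm_smul]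

/-- `∫ f(z) W(z) dz`, in the strong sense. -/
def smear (f : PhaseSpace m → ℂ) (hf : Integrable f) : H →L[ℂ] H :=
  LinearMap.mkContinuous
    { toFun := fun v => ∫ z, f z • W.op z v
      map_add' := fun v v' => by
        simp only [map_add, smul_add]
        exact integral_add (W.integrable_smear hf v) (W.integrable_smear hf v')
      map_smul' := fun c v => by
        simp only [map_smul, RingHom.id_apply, smul_comm _ c]
        exact integral_smul c _ }
    (∫ z, ‖f z‖) (fun v => by
      refine (norm_integral_le_integral_norm _).trans (le_of_eq ?_)
      simp [norm_smul, integral_mul_const])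

theorem smear_apply {f : PhaseSpace m → ℂ} (hf : Integrable f) (v : H) :
    W.smear f hf v = ∫ z, f z • W.op z v := rfl

theorem norm_smear_le {f : PhaseSpace m → ℂ} (hf : Integrable f) :
    ‖W.smear f hf‖ ≤ ∫ z, ‖f z‖ :=
  LinearMap.mkContinuous_norm_le _ (integral_nonneg fun _ => norm_nonneg _) _

theorem smear_sub {f f' : PhaseSpace m → ℂ} (hf : Integrable f) (hf' : Integrable f') :
    W.smear (f - f') (hf.sub hf') = W.smear f hf - W.smear f' hf' := by
  ext v
  rw [sub_apply, smear_apply, smear_apply, smear_apply,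
    ← integral_sub (W.integrable_smear hf v) (W.integrable_smear hf' v)]
  exact integral_congr_ae (Eventually.of_forall fun z => sub_smul _ _ _)

theorem inner_smear {f : PhaseSpace m → ℂ} (hf : Integrable f) (u v : H) :
    inner ℂ u (W.smear f hf v) = ∫ z, f z * inner ℂ u (W.op z v) := by
  rw [smear_apply, ← integral_inner (W.integrable_smear hf v)]
  simp only [inner_smul_right]

/-- The smearing with the Gaussian, the projection onto the vacuum vectors. -/
def vacuum : H →L[ℂ] H := W.smear _ integrable_gauss

theorem inner_vacuum_left (u v : H) : inner ℂ (W.vacuum u) v = inner ℂ u (W.vacuum v) := by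
  rw [← inner_conj_symm, vacuum, inner_smear, inner_smear, ← integral_conj, ← integral_neg_eq_self]
  congr 1
  ext z
  rw [_root_.map_mul, inner_conj_symm, W.inner_op_left, neg_neg, gauss_neg, Complex.conj_ofReal]

/-- Writing out both smearings and merging the three Weyl operators leaves an integral of `W(z)`
against the twisted convolution computed in `integral_gauss_twisted`. -/
theorem vacuum_op_vacuum (w : PhaseSpace m) (v : H) :
    W.vacuum (W.op w (W.vacuum v)) = (gauss w : ℂ) • W.vacuum v := by
  let k : PhaseSpace m → PhaseSpace m → ℂ := fun y z => (gauss y : ℂ) * gauss (z - w - y) *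
    phase ((inner ℝ y (rot m w) + inner ℝ (y + w) (rot m (z - w - y))) / 2)
  have h1 : ∀ y, (gauss y : ℂ) • W.op y (W.op w (W.vacuum v)) = ∫ z, k y z • W.op z v := by
    intro y
    have h2 : W.op y (W.op w (W.vacuum v)) =
        ∫ z, (gauss z : ℂ) • W.op y (W.op w (W.op z v)) := by
      have := ((W.op w).trans (W.op y)).toContinuousLinearEquiv.toContinuousLinearMap.integral_comp_comm
        (W.integrable_smear integrable_gauss v)
      rw [vacuum, smear_apply]
      refine this.symm.trans (integral_congr_ae (Eventually.of_forall fun z => ?_))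
      simp
    -- Translate `z` by `w + y`, so that the product of the three Weyl operators is a multiple of
    -- `W(z)`, free of `y`.
    rw [h2, ← integral_smul, ← integral_sub_right_eq_self _ (w + y)]
    refine integral_congr_ae (Eventually.of_forall fun z => ?_)
    have e : y + w + (z - (w + y)) = z := by abel
    have e' : z - (w + y) = z - w - y := by abel
    simp only [W.map_mul, map_smul, smul_smul]
    rw [← add_assoc, e]
    congr 1
    simp only [k, e', add_div, phase_add]
    rw [inner_add_left]
    have e'' : inner ℝ y (rot m (w + (z - w - y))) / 2 + inner ℝ w (rot m (z - w - y)) / 2 =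
      inner ℝ y (rot m w) / 2 + (inner ℝ y (rot m (z - w - y)) + inner ℝ w (rot m (z - w - y))) / 2 := by
      rw [map_add, inner_add_right]; ring
    have e3 := congrArg phase e''
    rw [phase_add, phase_add] at e3
    linear_combination (gauss y : ℂ) * gauss (z - w - y) * e3
  have hint : Integrable (Function.uncurry fun y z => k y z • W.op z v)
      ((volume : Measure (PhaseSpace m)).prod volume) := by
    have hg : Integrable (fun z : PhaseSpace m => (gauss (z - w) : ℂ)) :=
      integrable_gauss.comp_sub_right w
    -- In norm the kernel is the integrand of an ordinary convolution of two Gaussians, which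
    -- justifies Fubini.
    have hc := ((integrable_gauss (m := m)).convolution_integrand
      (ContinuousLinearMap.mul ℂ ℂ) hg).swap
    refine (hc.norm.mul_const ‖v‖).mono' ?_ (Eventually.of_forall fun p => ?_)
    · have hk : Continuous fun p : PhaseSpace m × PhaseSpace m => k p.1 p.2 := by
        have := continuous_rot m
        simp only [k]
        fun_prop
      exact (hk.smul ((W.continuous_op v).comp continuous_snd)).aestronglyMeasurable
    · simp only [Function.uncurry, norm_smul, k, norm_mul, norm_phase, mul_one,
        LinearIsometryEquiv.norm_map, Function.comp, Prod.fst_swap, Prod.snd_swap,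
        ContinuousLinearMap.mul_apply', sub_right_comm]
      exact le_rfl
  have h3 : W.vacuum (W.op w (W.vacuum v)) = ∫ y, ∫ z, k y z • W.op z v := by
    rw [← integral_congr_ae (Eventually.of_forall h1)]
    rfl
  rw [h3, integral_integral_swap hint, vacuum, smear_apply, ← integral_smul]
  refine integral_congr_ae (Eventually.of_forall fun z => ?_)
  simp only [integral_smul_const, smul_smul]
  rw [integral_gauss_twisted]

/-- If `P = 0`, then every conjugate `W(z) P W(-z)` vanishes. Their coefficients at `v` are the
Fourier transform of `gauss(y) ⟨v, W(y) v⟩`, a continuous function that would then be zero, although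
at the origin it equals `‖v‖²`. -/
theorem exists_vacuum_ne_zero [Nontrivial H] : ∃ v, W.vacuum v ≠ 0 := by
  by_contra! h0
  obtain ⟨v, hv⟩ := exists_ne (0 : H)
  let f : PhaseSpace m → ℂ := fun y => (gauss y : ℂ) * inner ℂ v (W.op y v)
  have hfc : Continuous f := by
    have := W.continuous_op v
    simp only [f]
    fun_prop
  have hf : Integrable f := by
    refine (integrable_gauss.norm.mul_const (‖v‖ * ‖v‖)).mono' hfc.aestronglyMeasurable
      (Eventually.of_forall fun y => ?_)
    simp only [f, norm_mul]
    gcongr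
    simpa using norm_inner_le_norm (𝕜 := ℂ) v (W.op y v)
  have h := ae_eq_zero_of_fourier_eq_zero hf fun w => by
    -- Conjugating by `rot w` makes the symplectic phase the character of frequency `w`, as `rot`
    -- squares to `-1`.
    have h1 : inner ℂ v (W.op (rot m w) (W.vacuum (W.op (-(rot m w)) v))) = 0 := by
      rw [h0, map_zero, inner_zero_right]
    rw [← neg_neg (rot m w), ← W.inner_op_left, vacuum, inner_smear, neg_neg] at h1
    rw [← h1]
    refine integral_congr_ae (Eventually.of_forall fun y => ?_)
    simp only [W.inner_op_left, neg_neg, W.op_conj, inner_smul_right, f]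
    change phase (inner ℝ y w) * _ = _
    rw [inner_rot_swap, rot_rot, inner_neg_right, neg_neg]
    ring
  have h2 : f = 0 := Continuous.ae_eq_iff_eq volume hfc continuous_const |>.1 h
  have h3 := congrFun h2 0
  simp only [f, gauss_zero, W.op_zero, Pi.zero_apply, Complex.ofReal_one, one_mul] at h3
  exact hv (inner_self_eq_zero.1 h3)

theorem exists_vacuum_vector [Nontrivial H] : ∃ v, ‖v‖ = 1 ∧ W.vacuum v = v ∧
    ∀ z, inner ℂ v (W.op z v) = gauss z := by
  obtain ⟨u, hu⟩ := W.exists_vacuum_ne_zero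
  -- The case `w = 0` of `vacuum_op_vacuum`: `P` is idempotent.
  have hidem : W.vacuum (W.vacuum u) = W.vacuum u := by
    simpa [W.op_zero, gauss_zero] using W.vacuum_op_vacuum 0 u
  set v := ((‖W.vacuum u‖⁻¹ : ℝ) : ℂ) • W.vacuum u with hv
  have hnorm : ‖v‖ = 1 := by
    rw [hv, norm_smul]
    simp [inv_mul_cancel₀ (norm_ne_zero_iff.2 hu)]
  have hfix : W.vacuum v = v := by rw [hv, map_smul, hidem]
  refine ⟨v, hnorm, hfix, fun z => ?_⟩
  have h := W.vacuum_op_vacuum z v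
  rw [hfix] at h
  conv_lhs => rw [← hfix]
  rw [inner_vacuum_left, hfix, h, inner_smul_right, inner_self_eq_norm_sq_to_K, hnorm]
  simp

end WeylSystem

/-! ### Compactness of rank one operators and of integrals of compact operators. -/

theorem isCompactOperator_rankOne {H K : Type*} [NormedAddCommGroup H] [InnerProductSpace ℂ H]
    [NormedAddCommGroup K] [InnerProductSpace ℂ K] (x : K) (y : H) :
    IsCompactOperator (InnerProductSpace.rankOne ℂ x y : H →L[ℂ] K) := by
  have h1 : IsCompactOperator (innerSL ℂ y : H →L[ℂ] ℂ) :=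
    isCompactOperator_of_locallyCompactSpace_dom (innerSL ℂ y)
  exact h1.clm_comp (ContinuousLinearMap.toSpanSingleton ℂ x)

theorem integral_mem_of_isClosed {Q : Type*} [MeasurableSpace Q] {μ : Measure Q} {E : Type*}
    [NormedAddCommGroup E] [NormedSpace ℂ E] [CompleteSpace E] (K : Submodule ℂ E)
    (hK : IsClosed (K : Set E)) {f : Q → E} (hf : ∀ q, f q ∈ K) : ∫ q, f q ∂μ ∈ K := by
  by_cases hi : Integrable f μ
  swap
  -- A non-integrable function has integral `0` by convention, and `0` lies in `K`.
  · rw [integral_undef hi]; exact K.zero_mem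
  have : CompleteSpace K := hK.completeSpace_coe
  let F : Q → K := fun q => ⟨f q, hf q⟩
  have hF : Integrable F μ := by
    refine hi.mono ?_ (Eventually.of_forall fun q => le_rfl)
    exact Topology.IsEmbedding.subtypeVal.aestronglyMeasurable_comp_iff.1 hi.1
  have h : ∫ q, f q ∂μ = (∫ q, F q ∂μ : K) := K.subtypeL.integral_comp_comm hF
  rw [h]
  exact (∫ q, F q ∂μ : K).2

theorem isCompactOperator_integral {Q : Type*} [MeasurableSpace Q] {μ : Measure Q} {H : Type*}
    [NormedAddCommGroup H] [NormedSpace ℂ H] [CompleteSpace H] {Φ : Q → (H →L[ℂ] H)}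
    (hc : ∀ q, IsCompactOperator (Φ q)) : IsCompactOperator (∫ q, Φ q ∂μ : H →L[ℂ] H) :=
  integral_mem_of_isClosed (compactOperator (RingHom.id ℂ) H H)
    isClosed_setOfPred_isCompactOperator hc

theorem continuous_rankOne_self {X H : Type*} [TopologicalSpace X] [NormedAddCommGroup H]
    [InnerProductSpace ℂ H] {f : X → H} (hf : Continuous f) :
    Continuous fun x => (InnerProductSpace.rankOne ℂ (f x) (f x) : H →L[ℂ] H) := by
  have h : Continuous fun x => (ContinuousLinearMap.toSpanSingleton ℂ (f x)).comp
      (innerSL ℂ (f x)) :=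
    ((ContinuousLinearMap.toSpanSingletonCLE (𝕜 := ℂ) (E := H)).continuous.comp hf).clm_comp
      ((innerSL ℂ).continuous.comp hf)
  exact h

/-! ### Compactness of smeared Weyl operators. -/

namespace WeylSystem

variable {m : ℕ} {H : Type*} [NormedAddCommGroup H] [InnerProductSpace ℂ H] [CompleteSpace H]
  (W : WeylSystem m H)

/-- Both sides are bounded, so it suffices to compare them on the orbit of `v`, where `P W(z) v = P
W(z) P v = gauss(z) v`. -/
theorem vacuum_eq_of_dense {v : H} (hfix : W.vacuum v = v)
    (hv : ∀ z, inner ℂ v (W.op z v) = gauss z)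
    (hd : Dense (Submodule.span ℂ (Set.range fun z => W.op z v) : Set H)) (u : H) :
    W.vacuum u = inner ℂ v u • v := by
  have h : W.vacuum = InnerProductSpace.rankOne ℂ v v := by
    refine ContinuousLinearMap.ext_on hd ?_
    rintro _ ⟨z, rfl⟩
    have h1 := W.vacuum_op_vacuum z v
    rw [hfix] at h1
    rw [h1, InnerProductSpace.rankOne_apply, hv]
  rw [h, InnerProductSpace.rankOne_apply]

/-- The operator is an integral of rank one operators: `W(z) P W(-z)` is the projection onto `W(z)
v`, and by `op_conj` it is the smearing with the Gaussian times a character. Integrating over `z`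
against `ψ` turns the character into the Fourier transform of `ψ`. -/
theorem isCompactOperator_smear_gauss_mul {v : H} (hvac : ∀ u, W.vacuum u = inner ℂ v u • v)
    (ψ : 𝓢(PhaseSpace m, ℂ)) {f : PhaseSpace m → ℂ} (hf : Integrable f)
    (hfψ : ∀ y, f y = gauss y * FourierTransform.fourier ψ (rot m y)) :
    IsCompactOperator (W.smear f hf) := by
  let Φ : PhaseSpace m → (H →L[ℂ] H) := fun z =>
    ψ z • InnerProductSpace.rankOne ℂ (W.op z v) (W.op z v)
  have hcont : Continuous Φ := by
    have h1 := W.continuous_op v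
    exact ψ.continuous.smul (continuous_rankOne_self h1)
  have hΦ : Integrable Φ := by
    refine ((ψ.integrable (μ := volume)).norm.mul_const (‖v‖ * ‖v‖)).mono'
      hcont.aestronglyMeasurable (Eventually.of_forall fun z => ?_)
    simp [Φ, norm_smul]
  have hT : W.smear f hf = ∫ z, Φ z := by
    refine ContinuousLinearMap.ext fun u => ext_inner_left ℂ fun w => ?_
    rw [ContinuousLinearMap.integral_apply hΦ, ← integral_inner (hΦ.apply_continuousLinearMap u),
      inner_smear]
    have hint : Integrable (Function.uncurry fun z y : PhaseSpace m =>
        (ψ z * gauss y) * (phase (inner ℝ z (rot m y)) * inner ℂ w (W.op y u)))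
        ((volume : Measure (PhaseSpace m)).prod volume) := by
      refine (((ψ.integrable (μ := volume)).mul_prod integrable_gauss).norm.mul_const
        (‖w‖ * ‖u‖)).mono' ?_ (Eventually.of_forall fun p => ?_)
      · have h1 := W.continuous_op u
        have h2 := continuous_rot m
        have h3 : Continuous ψ := ψ.continuous
        refine Continuous.aestronglyMeasurable ?_
        simp only [Function.uncurry_def]
        fun_prop
      · simp only [Function.uncurry, norm_mul, norm_phase, one_mul]
        gcongr
        simpa using norm_inner_le_norm (𝕜 := ℂ) w (W.op p.2 u)
    have h1 : ∀ z, inner ℂ w (Φ z u) = ∫ y, (ψ z * gauss y) *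
        (phase (inner ℝ z (rot m y)) * inner ℂ w (W.op y u)) := fun z => by
      have e1 : Φ z u = ψ z • W.op z (W.vacuum (W.op (-z) u)) := by
        simp only [Φ, smul_apply, InnerProductSpace.rankOne_apply, hvac, map_smul,
          W.inner_op_left]
      have e2 : ∀ u', inner ℂ w (W.op z u') = inner ℂ (W.op (-z) w) u' := fun u' => by
        rw [W.inner_op_left, neg_neg]
      rw [e1, inner_smul_right, e2, vacuum, inner_smear, ← integral_const_mul]
      refine integral_congr_ae (Eventually.of_forall fun y => ?_)
      simp only [W.inner_op_left, neg_neg, W.op_conj, inner_smul_right]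
      ring
    simp only [h1]
    -- After the interchange the inner integral over `z` is the Fourier integral of `ψ` at `rot m
    -- y`.
    rw [integral_integral_swap hint]
    refine integral_congr_ae (Eventually.of_forall fun y => ?_)
    simp only
    rw [hfψ, SchwartzMap.fourier_coe, Real.fourier_eq', ← integral_const_mul,
      ← integral_mul_const]
    refine integral_congr_ae (Eventually.of_forall fun z => ?_)
    have e : phase (inner ℝ z (rot m y)) =
        Complex.exp (((-2 * Real.pi * inner ℝ z (rot m y) : ℝ) : ℂ) * Complex.I) := by
      rw [phase]; congr 1; push_cast; ring
    simp only [e, smul_eq_mul]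
    ring
  rw [hT]
  exact isCompactOperator_integral (Φ := Φ) fun z => (isCompactOperator_rankOne _ _).smul (ψ z)

/-- Smearing is continuous for the `L¹` norm and compactness is a closed condition, so smooth
compactly supported functions suffice. Compact support allows division by the Gaussian, and the
quotient, carried over by the invertible map `rot`, is the Fourier transform of a Schwartz function.
-/
theorem isCompactOperator_smear {v : H} (hvac : ∀ u, W.vacuum u = inner ℂ v u • v)
    {f : PhaseSpace m → ℂ} (hf : Integrable f) : IsCompactOperator (W.smear f hf) := by
  have hcl : IsClosed {T : H →L[ℂ] H | IsCompactOperator T} := isClosed_setOfPred_isCompactOperator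
  refine hcl.closure_subset (Metric.mem_closure_iff.2 fun ε hε => ?_)
  obtain ⟨k, hk1, hk2, hk3⟩ := MemLp.exist_eLpNorm_sub_le (p := 1) ENNReal.one_ne_top le_rfl
    (memLp_one_iff_integrable.2 hf) (half_pos hε)
  have hk : Integrable k := hk2.continuous.integrable_of_hasCompactSupport hk1
  refine ⟨W.smear k hk, ?_, ?_⟩
  -- `-rot` inverts `rot`; composing with it brings `k / gauss` into the form required by
  -- `isCompactOperator_smear_gauss_mul`.
  · let r : PhaseSpace m ≃L[ℝ] PhaseSpace m := (LinearEquiv.ofLinearMap (rot m) (-(rot m))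
      (by ext1 z; simp [rot_rot]) (by ext1 z; simp [rot_rot])).toContinuousLinearEquiv
    let k' : PhaseSpace m → ℂ := (fun y : PhaseSpace m => ((gauss y)⁻¹ : ℝ)) • k
    have h1 : HasCompactSupport k' := hk1.smul_left
    have h2 : ContDiff ℝ ∞ k' :=
      (contDiff_gauss.inv fun y => (gauss_pos y).ne').smul hk2
    let φ : 𝓢(PhaseSpace m, ℂ) := SchwartzMap.compCLMOfContinuousLinearEquiv ℂ r.symm
      (h1.toSchwartzMap h2)
    refine W.isCompactOperator_smear_gauss_mul hvac (FourierTransformInv.fourierInv φ) hk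
      fun y => ?_
    rw [FourierTransform.fourier_fourierInv_eq]
    have h3 : φ (rot m y) = k' (r.symm (r y)) := rfl
    rw [h3, r.symm_apply_apply]
    simp only [k', Pi.smul_apply', Complex.real_smul]
    rw [← mul_assoc, ← Complex.ofReal_mul, mul_inv_cancel₀ (gauss_pos y).ne', Complex.ofReal_one,
      one_mul]
  · rw [dist_eq_norm, ← W.smear_sub]
    refine (W.norm_smear_le _).trans_lt ?_
    have h4 : ∫ z, ‖(f - k) z‖ = (eLpNorm (f - k) 1 volume).toReal := by
      rw [eLpNorm_one_eq_lintegral_enorm, integral_norm_eq_lintegral_enorm (hf.sub hk).1]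
    rw [h4]
    have h5 := ENNReal.toReal_mono ENNReal.ofReal_ne_top hk3
    rw [ENNReal.toReal_ofReal (half_pos hε).le] at h5
    linarith

end WeylSystem

/-! ### Cyclic vectors and the comparison of representations. -/

namespace UnitaryRep

variable {g : Type*} [NormedAddCommGroup g] [InnerProductSpace ℝ g] [TwoStepLieAlgebra g]
  {H : Type*} [NormedAddCommGroup H] [InnerProductSpace ℂ H] (π : UnitaryRep g H)

theorem op_zero (v : H) : π.op 0 v = v := by
  apply (π.op 0).injective
  have := π.map_mul 0 0 v
  simpa [cbh] using this.symm

theorem inner_op_left (x : g) (v w : H) : inner ℂ (π.op x v) w = inner ℂ v (π.op (-x) w) := by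
  rw [← (π.op (-x)).inner_map_map (π.op x v) w, ← π.map_mul]
  simp [cbh, π.op_zero]

theorem dense_span_of_isIrreducible (hπ : π.IsIrreducible) {v : H} (hv : v ≠ 0) :
    Dense (Submodule.span ℂ (Set.range fun x => π.op x v) : Set H) := by
  rw [Submodule.dense_iff_topologicalClosure_eq_top]
  refine (hπ.2 _ (Submodule.isClosed_topologicalClosure _) fun x => ?_).resolve_left fun h => ?_
  · have h1 : Submodule.span ℂ (Set.range fun x => π.op x v) ≤
        (Submodule.span ℂ (Set.range fun x => π.op x v)).comap
          ((π.op x).toLinearEquiv : H →ₗ[ℂ] H) := by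
      refine Submodule.span_le.2 ?_
      rintro _ ⟨y, rfl⟩
      exact Submodule.subset_span ⟨cbh x y, π.map_mul x y v⟩
    intro u hu
    have h2 : Set.MapsTo (π.op x) (Submodule.span ℂ (Set.range fun x => π.op x v) : Set H)
        (Submodule.span ℂ (Set.range fun x => π.op x v) : Set H) := fun w hw => h1 hw
    exact h2.closure (π.op x).continuous hu
  · have : v ∈ (Submodule.span ℂ (Set.range fun x => π.op x v)).topologicalClosure :=
      Submodule.le_topologicalClosure _ (Submodule.subset_span ⟨0, π.op_zero v⟩)
    rw [h] at this
    exact hv ((Submodule.mem_bot ℂ).1 this)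

end UnitaryRep

namespace QuotientData

variable {g : Type*} [NormedAddCommGroup g] [InnerProductSpace ℝ g] [FiniteDimensional ℝ g]
  [MeasurableSpace g] [BorelSpace g] [TwoStepLieAlgebra g] {d : ℕ} (D : QuotientData g d)
  {H : Type*} [NormedAddCommGroup H] [InnerProductSpace ℂ H] [CompleteSpace H]
  {H' : Type*} [NormedAddCommGroup H'] [InnerProductSpace ℂ H'] [CompleteSpace H']

theorem exists_eq_sec_add (x : g) : ∃ w, ∃ y ∈ D.u, x = D.sec w + y := by
  have hx : x ∈ LinearMap.range (D.sec : (Eucl d × Eucl d) →ₗ[ℝ] g) ⊔ D.u := by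
    rw [D.sec_isCompl.sup_eq_top]; trivial
  obtain ⟨_, ⟨w, rfl⟩, y, hy, rfl⟩ := Submodule.mem_sup.1 hx
  exact ⟨w, y, hy, rfl⟩

theorem inner_repOp (π : UnitaryRep g H) (f : D.L1) (u v : H) :
    inner ℂ u (D.repOp π f v) = ∫ w, f (D.sec w) * inner ℂ u (π.op (D.sec w) v) := by
  rw [repOp_apply, ← integral_inner (D.integrable_rep π f v)]
  simp only [inner_smul_right]

/-- The GNS argument without constructing the intertwiner: equal diagonal coefficients make all
inner products between orbit combinations of `v` and of `v'` agree, also after applying `f`. Hence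
the norms agree on orbit combinations, which are dense on the left. On the right `v'` need not be
cyclic, so only an inequality results. -/
theorem norm_repOp_le_of_coeff_eq (π : UnitaryRep g H) (π' : UnitaryRep g H') {v : H} {v' : H'}
    (hd : Dense (Submodule.span ℂ (Set.range fun x => π.op x v) : Set H))
    (h : ∀ x, inner ℂ v (π.op x v) = inner ℂ v' (π'.op x v')) (f : D.L1) :
    ‖D.repOp π f‖ ≤ ‖D.repOp π' f‖ := by
  let L := Finsupp.linearCombination ℂ fun x => π.op x v
  let L' := Finsupp.linearCombination ℂ fun x => π'.op x v'
  have h1 : ∀ (a b : g) (s t : g →₀ ℂ),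
      inner ℂ (π.op a (L s)) (π.op b (L t)) = inner ℂ (π'.op a (L' s)) (π'.op b (L' t)) := by
    intro a b s t
    simp only [L, L', Finsupp.linearCombination_apply, Finsupp.sum, map_sum, map_smul, sum_inner,
      inner_sum, inner_smul_left, inner_smul_right]
    refine Finset.sum_congr rfl fun x _ => congrArg _ (Finset.sum_congr rfl fun y _ => ?_)
    rw [π.inner_op_left, π.inner_op_left, π'.inner_op_left, π'.inner_op_left]
    simp only [← π.map_mul, ← π'.map_mul, h]
  have h2 : ∀ (a : g) (s : g →₀ ℂ), inner ℂ (π.op a (L s)) (D.repOp π f (L s)) =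
      inner ℂ (π'.op a (L' s)) (D.repOp π' f (L' s)) := fun a s => by
    simp only [inner_repOp, h1]
  -- Expand the integral in the second slot of the squared norm; `h2`, conjugated, then deals with
  -- the integral left in the first.
  have h3 : ∀ s : g →₀ ℂ, ‖D.repOp π f (L s)‖ = ‖D.repOp π' f (L' s)‖ := fun s => by
    have h4 : inner ℂ (D.repOp π f (L s)) (D.repOp π f (L s)) =
        inner ℂ (D.repOp π' f (L' s)) (D.repOp π' f (L' s)) := by
      rw [inner_repOp, inner_repOp]
      refine integral_congr_ae (Eventually.of_forall fun w => ?_)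
      simp only
      rw [← inner_conj_symm, h2, inner_conj_symm]
    rw [inner_self_eq_norm_sq_to_K, inner_self_eq_norm_sq_to_K] at h4
    exact (sq_eq_sq₀ (norm_nonneg _) (norm_nonneg _)).1 (by exact_mod_cast h4)
  have h5 : ∀ s : g →₀ ℂ, ‖L s‖ = ‖L' s‖ := fun s => by
    have h4 := h1 0 0 s s
    simp only [π.op_zero, π'.op_zero] at h4
    rw [inner_self_eq_norm_sq_to_K, inner_self_eq_norm_sq_to_K] at h4
    exact (sq_eq_sq₀ (norm_nonneg _) (norm_nonneg _)).1 (by exact_mod_cast h4)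
  refine ContinuousLinearMap.opNorm_le_bound _ (norm_nonneg _) fun u => ?_
  have hcl : IsClosed {u : H | ‖D.repOp π f u‖ ≤ ‖D.repOp π' f‖ * ‖u‖} :=
    isClosed_le (by fun_prop) (by fun_prop)
  refine hcl.closure_subset_iff.2 ?_ (hd u)
  intro u hu
  rw [SetLike.mem_coe, ← Finsupp.range_linearCombination] at hu
  obtain ⟨s, rfl⟩ := hu
  change ‖D.repOp π f (L s)‖ ≤ ‖D.repOp π' f‖ * ‖L s‖
  rw [h3, h5]
  exact (D.repOp π' f).le_opNorm _

/-- The commutator term of the group product lies in `[g, g] ⊆ u` and is central, so it splits off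
and acts through `χ_ℓ`. -/
theorem op_op_eq (π : UnitaryRep g H) (hres : ∀ x ∈ D.u, ∀ v, π.op x v = chi D.ℓ x • v)
    (x y : g) (v : H) : π.op x (π.op y v) = phase (D.ℓ ⁅x, y⁆ / 2) • π.op (x + y) v := by
  have hmem : (1 / 2 : ℝ) • ⁅x, y⁆ ∈ D.u :=
    D.u.smul_mem _ (D.derived_le (Submodule.subset_span ⟨x, y, rfl⟩))
  have h : cbh x y = cbh (x + y) ((1 / 2 : ℝ) • ⁅x, y⁆) := by
    simp only [cbh, lie_smul]
    rw [TwoStepLieAlgebra.two_step]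
    simp
  rw [← π.map_mul, h, π.map_mul, hres _ hmem, map_smul, chi_eq_phase, map_smul, smul_eq_mul]
  congr 2
  ring

theorem op_add_mem (π : UnitaryRep g H) (hres : ∀ x ∈ D.u, ∀ v, π.op x v = chi D.ℓ x • v)
    (x : g) {y : g} (hy : y ∈ D.u) (v : H) : π.op (x + y) v = chi D.ℓ y • π.op x v := by
  have h1 := D.op_op_eq π hres x y v
  have h2 : D.ℓ ⁅x, y⁆ = 0 := by
    rw [← lie_skew, map_neg, D.le_stabilizer hy x, neg_zero]
  rw [h2, zero_div, phase_zero, one_smul, hres y hy, map_smul] at h1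
  exact h1.symm

end QuotientData

/-! ### Characters of the radical. -/

instance isAddHaarMeasure_volume_prod (n : ℕ) :
    (volume : Measure (Eucl n × Eucl n)).IsAddHaarMeasure :=
  inferInstanceAs ((volume : Measure (Eucl n)).prod (volume : Measure (Eucl n))).IsAddHaarMeasure

/-- The standard bilinear pairing on `ℝ^n × ℝ^n`. -/
def pairing {n : ℕ} (q r : Eucl n × Eucl n) : ℝ := ∑ j, q.1 j * r.1 j + ∑ j, q.2 j * r.2 j

theorem pairing_add_right {n : ℕ} (q r r' : Eucl n × Eucl n) :
    pairing q (r + r') = pairing q r + pairing q r' := by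
  simp only [pairing, Prod.fst_add, Prod.snd_add, PiLp.add_apply, mul_add, Finset.sum_add_distrib]
  ring

theorem pairing_smul_right {n : ℕ} (q r : Eucl n × Eucl n) (t : ℝ) :
    pairing q (t • r) = t * pairing q r := by
  simp only [pairing, Prod.smul_fst, Prod.smul_snd, PiLp.smul_apply, smul_eq_mul, mul_add,
    Finset.mul_sum]
  congr 1 <;> exact Finset.sum_congr rfl fun j _ => by ring

@[fun_prop] theorem continuous_pairing {n : ℕ} :
    Continuous fun p : (Eucl n × Eucl n) × (Eucl n × Eucl n) => pairing p.1 p.2 := by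
  unfold pairing
  fun_prop

theorem map_sum_eq_prod_of_map_add {A ι : Type*} [AddCommMonoid A] (c : A → ℂ) (h0 : c 0 = 1)
    (hadd : ∀ r s, c (r + s) = c r * c s) (s : Finset ι) (f : ι → A) :
    c (∑ i ∈ s, f i) = ∏ i ∈ s, c (f i) := by
  classical
  induction s using Finset.induction_on with
  | empty => simpa using h0
  | insert i s hi ih => rw [Finset.sum_insert hi, Finset.prod_insert hi, hadd, ih]

/-- Restrict to the coordinate lines, where the one-dimensional classification applies, and multiply
the results. -/
theorem exists_eq_phase_pairing {n : ℕ} (c : Eucl n × Eucl n → ℂ) (hc : Continuous c)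
    (hadd : ∀ r s, c (r + s) = c r * c s) (hnorm : ∀ r, ‖c r‖ = 1) :
    ∃ q, ∀ r, c r = phase (pairing q r) := by
  have h0 : c 0 = 1 := by
    have h := hadd 0 0
    rw [add_zero] at h
    have hne : c 0 ≠ 0 := fun h' => by simpa [h'] using hnorm 0
    exact mul_left_cancel₀ hne (by rw [← h, mul_one])
  have hline : ∀ e, ∃ a : ℝ, ∀ t : ℝ, c (t • e) = phase (a * t) := fun e =>
    exists_eq_phase (fun t => c (t • e)) (by fun_prop) (fun s t => by rw [add_smul, hadd])
      fun t => hnorm _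
  choose a ha using hline
  let e₁ : Fin n → Eucl n × Eucl n := fun j => (EuclideanSpace.single j 1, 0)
  let e₂ : Fin n → Eucl n × Eucl n := fun j => (0, EuclideanSpace.single j 1)
  refine ⟨(WithLp.toLp 2 fun j => a (e₁ j), WithLp.toLp 2 fun j => a (e₂ j)), fun r => ?_⟩
  have hr : r = ∑ j, r.1 j • e₁ j + ∑ j, r.2 j • e₂ j := by
    refine Prod.ext (PiLp.ext fun i => ?_) (PiLp.ext fun i => ?_)
    · simp [e₁, e₂, Prod.fst_sum, Finset.sum_apply, Pi.single_apply]
    · simp [e₁, e₂, Prod.snd_sum, Finset.sum_apply, Pi.single_apply]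
  conv_lhs => rw [hr]
  rw [pairing, hadd, phase_add, map_sum_eq_prod_of_map_add c h0 hadd,
    map_sum_eq_prod_of_map_add c h0 hadd,
    map_sum_eq_prod_of_map_add phase phase_zero phase_add,
    map_sum_eq_prod_of_map_add phase phase_zero phase_add]
  simp only [ha]

/-! ### Symplectic frames: splitting representations into a radical character and a Weyl system. -/

/-- Linear coordinates on `G/U` in which the form `ℓ [·, ·]` is the standard symplectic form of
`ℝ^m × ℝ^m`, with radical `ℝ^n × ℝ^n`. -/
structure SymplecticFrame {g : Type*} [NormedAddCommGroup g] [InnerProductSpace ℝ g]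
    [TwoStepLieAlgebra g] {d : ℕ} (D : QuotientData g d) (m n : ℕ) where
  equiv : (PhaseSpace m × (Eucl n × Eucl n)) ≃L[ℝ] (Eucl d × Eucl d)
  lie : ∀ ζ ζ', D.ℓ ⁅D.sec (equiv ζ), D.sec (equiv ζ')⁆ = inner ℝ ζ.1 (rot m ζ'.1)

namespace SymplecticFrame

variable {g : Type*} [NormedAddCommGroup g] [InnerProductSpace ℝ g] [FiniteDimensional ℝ g]
  [MeasurableSpace g] [BorelSpace g] [TwoStepLieAlgebra g] {d m n : ℕ} {D : QuotientData g d}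
  (B : SymplecticFrame D m n)
  {H : Type*} [NormedAddCommGroup H] [InnerProductSpace ℂ H] [CompleteSpace H]
  {H' : Type*} [NormedAddCommGroup H'] [InnerProductSpace ℂ H'] [CompleteSpace H']

theorem exists_decomp (x : g) : ∃ ζ, ∃ y ∈ D.u, x = D.sec (B.equiv ζ) + y := by
  obtain ⟨w, y, hy, rfl⟩ := D.exists_eq_sec_add x
  exact ⟨B.equiv.symm w, y, hy, by simp⟩

theorem op_equiv (π : UnitaryRep g H) (hres : ∀ x ∈ D.u, ∀ v, π.op x v = chi D.ℓ x • v)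
    (ζ : PhaseSpace m × (Eucl n × Eucl n)) (v : H) : π.op (D.sec (B.equiv ζ)) v =
      π.op (D.sec (B.equiv (ζ.1, 0))) (π.op (D.sec (B.equiv (0, ζ.2))) v) := by
  rw [D.op_op_eq π hres, B.lie]
  simp [← map_add]

/-- The Weyl system defined by a representation of `G` that is a multiple of `χ_ℓ` on `U`. -/
def weyl (π : UnitaryRep g H) (hres : ∀ x ∈ D.u, ∀ v, π.op x v = chi D.ℓ x • v) :
    WeylSystem m H where
  op z := π.op (D.sec (B.equiv (z, 0)))
  map_mul z y v := by
    rw [D.op_op_eq π hres, B.lie, ← map_add, ← map_add]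
    simp
  continuous_op v := (π.continuous_op v).comp (by fun_prop)

theorem weyl_op (π : UnitaryRep g H) (hres : ∀ x ∈ D.u, ∀ v, π.op x v = chi D.ℓ x • v)
    (z : PhaseSpace m) (v : H) : (B.weyl π hres).op z v = π.op (D.sec (B.equiv (z, 0))) v := rfl

/-- Radical elements commute with all of `G` under `π`, because `ℓ` kills their commutators, so
Schur's lemma makes them scalar. The scalars form a continuous unitary character. -/
theorem exists_radical_character (π : UnitaryRep g H)
    (hres : ∀ x ∈ D.u, ∀ v, π.op x v = chi D.ℓ x • v) (hirr : π.IsIrreducible) :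
    ∃ q, ∀ r v, π.op (D.sec (B.equiv (0, r))) v = phase (pairing q r) • v := by
  have : Nontrivial H := hirr.1
  let R : Eucl n × Eucl n → g := fun r => D.sec (B.equiv (0, r))
  have hRlie : ∀ r x, D.ℓ ⁅R r, x⁆ = 0 := fun r x => by
    obtain ⟨ζ, y, hy, rfl⟩ := B.exists_decomp x
    rw [lie_add, map_add, B.lie, ← lie_skew, map_neg, D.le_stabilizer hy]
    simp
  let U : g → (H →L[ℂ] H) := fun x => ((π.op x).toContinuousLinearEquiv : H →L[ℂ] H)
  have hUapp : ∀ x v, U x v = π.op x v := fun _ _ => rfl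
  have hcomm : ∀ r x, Commute (U (R r)) (U x) := fun r x => by
    refine ContinuousLinearMap.ext fun v => ?_
    have h1 : D.ℓ ⁅x, R r⁆ = 0 := by rw [← lie_skew, map_neg, hRlie, neg_zero]
    simp only [mul_apply_eq_comp, hUapp, D.op_op_eq π hres, hRlie, h1, add_comm x]
  have hstar : ∀ x, star (U x) = U (-x) := fun x => by
    rw [ContinuousLinearMap.star_eq_adjoint]
    symm
    rw [ContinuousLinearMap.eq_adjoint_iff]
    intro v w
    rw [hUapp, hUapp, π.inner_op_left, neg_neg]
  have hscal : ∀ r, ∃ c : ℂ, ∀ v, π.op (R r) v = c • v := fun r => by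
    have hneg : R (-r) = -R r := by
      simp only [R, ← map_neg, Prod.neg_mk, neg_zero]
    -- The adjoint belongs to the radical element `-r`, hence also commutes with everything.
    have hn : IsStarNormal (U (R r)) := ⟨by rw [hstar, ← hneg]; exact hcomm _ _⟩
    refine exists_eq_smul_of_commute (U (R r)) (Set.range U) (fun K hK hinv => ?_) ?_ ?_
    · exact hirr.2 K hK fun x v hv => hinv _ ⟨x, rfl⟩ v hv
    · rintro _ ⟨x, rfl⟩; exact hcomm _ _
    · rintro _ ⟨x, rfl⟩; rw [hstar, ← hneg]; exact hcomm _ _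
  choose c hc using hscal
  obtain ⟨v, hv⟩ := exists_ne (0 : H)
  suffices h : Continuous c ∧ (∀ r s, c (r + s) = c r * c s) ∧ ∀ r, ‖c r‖ = 1 by
    obtain ⟨q, hq⟩ := exists_eq_phase_pairing c h.1 h.2.1 h.2.2
    exact ⟨q, fun r u => by rw [← hq]; exact hc r u⟩
  refine ⟨?_, ?_, ?_⟩
  -- A quotient of matrix coefficients of one fixed vector inherits the strong continuity of `π`.
  · have h1 : ∀ r, c r = inner ℂ v (π.op (R r) v) / inner ℂ v v := fun r => by
      rw [hc, inner_smul_right, mul_div_cancel_right₀]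
      exact fun h => hv (inner_self_eq_zero.1 h)
    have h2 : Continuous fun r => π.op (R r) v := (π.continuous_op v).comp (by fun_prop)
    have h3 : c = fun r => inner ℂ v (π.op (R r) v) / inner ℂ v v := funext h1
    rw [h3]
    fun_prop
  · intro r s
    have h2 : R r + R s = R (r + s) := by simp [R, ← map_add]
    have h1 : (c r * c s) • v = c (r + s) • v := by
      rw [mul_comm, mul_smul, ← hc r, ← map_smul, ← hc s, D.op_op_eq π hres, hRlie, zero_div,
        phase_zero, one_smul, h2, hc]
    exact (smul_left_injective ℂ hv h1).symm
  · intro r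
    have h1 : ‖π.op (R r) v‖ = ‖v‖ := (π.op _).norm_map v
    rw [hc, norm_smul] at h1
    exact mul_right_cancel₀ (norm_ne_zero_iff.2 hv) (h1.trans (one_mul _).symm)

theorem op_eq_smul_weyl (π : UnitaryRep g H)
    (hres : ∀ x ∈ D.u, ∀ v, π.op x v = chi D.ℓ x • v) {q : Eucl n × Eucl n}
    (hq : ∀ r v, π.op (D.sec (B.equiv (0, r))) v = phase (pairing q r) • v)
    (ζ : PhaseSpace m × (Eucl n × Eucl n)) {y : g} (hy : y ∈ D.u) (v : H) :
    π.op (D.sec (B.equiv ζ) + y) v =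
      (chi D.ℓ y * phase (pairing q ζ.2)) • (B.weyl π hres).op ζ.1 v := by
  rw [D.op_add_mem π hres _ hy, B.op_equiv π hres, hq, map_smul, smul_smul, weyl_op]

/-- This plays the part of Stone-von Neumann uniqueness: the vacuum vectors have equal diagonal
coefficients, a radical character times a Gaussian, and the one of the irreducible `π` is cyclic.
Irreducibility of `π'` is not needed. -/
theorem norm_repOp_le (π : UnitaryRep g H) (hres : ∀ x ∈ D.u, ∀ v, π.op x v = chi D.ℓ x • v)
    (hirr : π.IsIrreducible) (π' : UnitaryRep g H') [Nontrivial H']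
    (hres' : ∀ x ∈ D.u, ∀ v, π'.op x v = chi D.ℓ x • v) {q : Eucl n × Eucl n}
    (hq : ∀ r v, π.op (D.sec (B.equiv (0, r))) v = phase (pairing q r) • v)
    (hq' : ∀ r v, π'.op (D.sec (B.equiv (0, r))) v = phase (pairing q r) • v) (f : D.L1) :
    ‖D.repOp π f‖ ≤ ‖D.repOp π' f‖ := by
  have : Nontrivial H := hirr.1
  obtain ⟨v, hv, -, hc⟩ := (B.weyl π hres).exists_vacuum_vector
  obtain ⟨v', -, -, hc'⟩ := (B.weyl π' hres').exists_vacuum_vector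
  refine D.norm_repOp_le_of_coeff_eq π π' (π.dense_span_of_isIrreducible hirr
    (norm_ne_zero_iff.1 (by rw [hv]; exact one_ne_zero))) (fun x => ?_) f (v' := v')
  obtain ⟨ζ, y, hy, rfl⟩ := B.exists_decomp x
  rw [B.op_eq_smul_weyl π hres hq ζ hy, B.op_eq_smul_weyl π' hres' hq' ζ hy, inner_smul_right,
    inner_smul_right, hc, hc']

/-- Integrating `f` against the radical character over the radical leaves a Weyl smearing with an
`L¹` function, up to the Jacobian of the frame. -/
theorem isCompactOperator_repOp (B : SymplecticFrame D m n) (π : UnitaryRep g H)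
    (hres : ∀ x ∈ D.u, ∀ v, π.op x v = chi D.ℓ x • v) (hirr : π.IsIrreducible) (f : D.L1) :
    IsCompactOperator (D.repOp π f) := by
  have : Nontrivial H := hirr.1
  obtain ⟨q, hq⟩ := B.exists_radical_character π hres hirr
  let W := B.weyl π hres
  obtain ⟨v, hv, hfix, hc⟩ := W.exists_vacuum_vector
  have hv0 : v ≠ 0 := norm_ne_zero_iff.1 (by rw [hv]; exact one_ne_zero)
  -- `U` and the radical only multiply by scalars, so the Weyl orbit spans the same dense space as
  -- the full orbit.
  have hd : Dense (Submodule.span ℂ (Set.range fun z => W.op z v) : Set H) := by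
    refine (π.dense_span_of_isIrreducible hirr hv0).mono (Submodule.span_le.2 ?_)
    rintro _ ⟨x, rfl⟩
    obtain ⟨ζ, y, hy, rfl⟩ := B.exists_decomp x
    simp only [B.op_eq_smul_weyl π hres hq ζ hy]
    exact Submodule.smul_mem _ _ (Submodule.subset_span ⟨_, rfl⟩)
  let e : (PhaseSpace m × (Eucl n × Eucl n)) ≃ᵐ (Eucl d × Eucl d) :=
    B.equiv.toHomeomorph.toMeasurableEquiv
  let ν : Measure (PhaseSpace m × (Eucl n × Eucl n)) := Measure.map e.symm volume
  have hν : ν.IsAddHaarMeasure := B.equiv.symm.isAddHaarMeasure_map volume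
  have : ((volume : Measure (PhaseSpace m)).prod
      (volume : Measure (Eucl n × Eucl n))).IsAddHaarMeasure :=
    Measure.prod.instIsAddHaarMeasure _ _
  -- The Jacobian of the frame, obtained from uniqueness of Haar measure; its value does not matter,
  -- only that it is nonzero.
  obtain ⟨c, hcne, hcν⟩ : ∃ c : NNReal, c ≠ 0 ∧
      ν = c • ((volume : Measure (PhaseSpace m)).prod (volume : Measure (Eucl n × Eucl n))) :=
    ⟨_, (Measure.addHaarScalarFactor_pos_of_isAddHaarMeasure _ _).ne',
      Measure.isAddLeftInvariant_eq_smul _ _⟩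
  have hmp : MeasurePreserving e ν volume := ⟨e.measurable, by simp [ν, e.map_map_symm]⟩
  let k : PhaseSpace m × (Eucl n × Eucl n) → ℂ := fun ζ =>
    f (D.sec (B.equiv ζ)) * phase (pairing q ζ.2)
  have hk : Integrable k ((volume : Measure (PhaseSpace m)).prod volume) := by
    have h1 : Integrable (fun ζ => f (D.sec (B.equiv ζ))) ν :=
      hmp.integrable_comp_of_integrable f.mem.2.2
    rw [hcν] at h1
    replace h1 := (integrable_smul_measure (ENNReal.coe_ne_zero.2 hcne) ENNReal.coe_ne_top).1 h1
    refine h1.norm.mono' (h1.1.mul (Continuous.aestronglyMeasurable (by fun_prop)))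
      (Eventually.of_forall fun ζ => ?_)
    simp [k]
  let F : PhaseSpace m → ℂ := fun z => ∫ r, k (z, r)
  have hF : Integrable F := hk.integral_prod_left
  have hrep : D.repOp π f = ((c : ℝ) : ℂ) • W.smear F hF := by
    ext u
    have hku : Integrable (fun ζ => k ζ • W.op ζ.1 u)
        ((volume : Measure (PhaseSpace m)).prod volume) := by
      refine (hk.norm.mul_const ‖u‖).mono' (hk.1.smul
        ((W.continuous_op u).comp continuous_fst).aestronglyMeasurable)
        (Eventually.of_forall fun ζ => ?_)
      simp [norm_smul]
    rw [D.repOp_apply, ← hmp.integral_comp', hcν, integral_smul_nnreal_measure, smul_apply,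
      W.smear_apply]
    have h1 : ∀ ζ, f (D.sec (e ζ)) • π.op (D.sec (e ζ)) u = k ζ • W.op ζ.1 u := fun ζ => by
      change f (D.sec (B.equiv ζ)) • π.op (D.sec (B.equiv ζ)) u = _
      rw [B.op_equiv π hres, hq, map_smul, smul_smul]
      rfl
    simp only [h1]
    rw [integral_prod _ hku, Complex.coe_smul, NNReal.smul_def]
    simp only [F, integral_smul_const]
  rw [hrep]
  exact (W.isCompactOperator_smear (W.vacuum_eq_of_dense hfix hc hd) hF).smul _

end SymplecticFrame

/-! ### Schwartz elements and their density. -/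

namespace QuotientData

variable {g : Type*} [NormedAddCommGroup g] [InnerProductSpace ℝ g] [FiniteDimensional ℝ g]
  [MeasurableSpace g] [BorelSpace g] [TwoStepLieAlgebra g] {d : ℕ} (D : QuotientData g d)

/-- The coordinates of `g → g/u ≃ ℝ^d × ℝ^d`. -/
def coord : g →ₗ[ℝ] (Eucl d × Eucl d) :=
  ((LinearEquiv.ofInjective (D.sec : (Eucl d × Eucl d) →ₗ[ℝ] g) D.sec_injective).symm :
    LinearMap.range (D.sec : (Eucl d × Eucl d) →ₗ[ℝ] g) →ₗ[ℝ] (Eucl d × Eucl d)) ∘ₗ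
    Submodule.projectionOnto _ _ D.sec_isCompl

theorem coord_sec (w : Eucl d × Eucl d) : D.coord (D.sec w) = w := by
  have h := Submodule.projectionOnto_apply_left D.sec_isCompl
    (LinearEquiv.ofInjective (D.sec : (Eucl d × Eucl d) →ₗ[ℝ] g) D.sec_injective w)
  change (LinearEquiv.ofInjective (D.sec : (Eucl d × Eucl d) →ₗ[ℝ] g) D.sec_injective).symm
    (Submodule.projectionOnto _ _ D.sec_isCompl (D.sec w)) = w
  rw [LinearEquiv.symm_apply_eq]
  exact h

theorem coord_eq_zero {y : g} (hy : y ∈ D.u) : D.coord y = 0 := by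
  have h := Submodule.projectionOnto_apply_right D.sec_isCompl ⟨y, hy⟩
  change (LinearEquiv.ofInjective (D.sec : (Eucl d × Eucl d) →ₗ[ℝ] g) D.sec_injective).symm
    (Submodule.projectionOnto _ _ D.sec_isCompl y) = 0
  rw [h, map_zero]

theorem mem_u_of_coord_eq_zero {x : g} (hx : D.coord x = 0) : x ∈ D.u := by
  obtain ⟨w, y, hy, rfl⟩ := D.exists_eq_sec_add x
  rw [map_add, D.coord_sec, D.coord_eq_zero hy, add_zero] at hx
  simpa [hx] using hy

theorem continuous_coord : Continuous D.coord := D.coord.continuous_of_finiteDimensional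

/-- The covariant function on `G` with given restriction to `ℝ^d × ℝ^d`. -/
def extend (f : Eucl d × Eucl d → ℂ) (x : g) : ℂ :=
  phase (-(D.ℓ (x - D.sec (D.coord x)))) * f (D.coord x)

theorem extend_sec (f : Eucl d × Eucl d → ℂ) (w : Eucl d × Eucl d) :
    D.extend f (D.sec w) = f w := by
  simp [extend, coord_sec]

theorem extend_cbh (f : Eucl d × Eucl d → ℂ) (x : g) {y : g} (hy : y ∈ D.u) :
    D.extend f (cbh x y) = chi D.ℓ (-y) * D.extend f x := by
  have h1 : D.coord (cbh x y) = D.coord x := by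
    have hxy : ⁅x, y⁆ ∈ D.u := D.derived_le (Submodule.subset_span ⟨x, y, rfl⟩)
    rw [cbh, map_add, map_add, map_smul, D.coord_eq_zero hy, D.coord_eq_zero hxy]
    simp
  have h2 : D.ℓ ⁅x, y⁆ = 0 := by
    rw [← lie_skew, map_neg, D.le_stabilizer hy x, neg_zero]
  rw [extend, extend, h1, chi_eq_phase, ← mul_assoc, ← phase_add]
  congr 2
  simp only [cbh, map_add, map_sub, map_neg, map_smul, h2]
  simp
  ring

/-- The element of `L¹(G/U, χ_ℓ)` with given restriction to `ℝ^d × ℝ^d`. -/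
def ofFun (f : Eucl d × Eucl d → ℂ) (hm : Measurable f) (hf : Integrable f) : D.L1 :=
  ⟨D.extend f, by
    refine ⟨?_, fun x y hy => D.extend_cbh f x hy, ?_⟩
    · have h := D.continuous_coord
      have h1 : Continuous fun x => phase (-(D.ℓ (x - D.sec (D.coord x)))) := by fun_prop
      exact h1.measurable.mul (hm.comp h.measurable)
    · simpa only [extend_sec] using hf⟩

theorem ofFun_sec {f : Eucl d × Eucl d → ℂ} (hm : Measurable f) (hf : Integrable f)
    (w : Eucl d × Eucl d) : D.ofFun f hm hf (D.sec w) = f w :=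
  D.extend_sec f w

/-- Along any complement of `u` the coordinate map is a linear isomorphism, so the restriction of
the covariant extension is smooth with compact support; the extra phase factor is harmless. -/
theorem isSchwartz_ofFun {f : Eucl d × Eucl d → ℂ} (hs : ContDiff ℝ ∞ f)
    (hc : HasCompactSupport f) (hm : Measurable f) (hf : Integrable f) :
    D.IsSchwartz (D.ofFun f hm hf) := by
  have hcoord : ContDiff ℝ ∞ D.coord := D.coord.toContinuousLinearMap.contDiff
  have hsm : ContDiff ℝ ∞ (D.extend f) := by
    refine ContDiff.mul ?_ (hs.comp hcoord)
    have h1 : ContDiff ℝ ∞ phase := by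
      unfold phase
      have := Complex.ofRealCLM.contDiff (n := ∞)
      exact Complex.contDiff_exp.comp (contDiff_const.mul this).neg
    exact h1.comp (D.ℓ.contDiff.comp (contDiff_id.sub (D.sec.contDiff.comp hcoord))).neg
  refine ⟨hsm, fun s hsu => ?_⟩
  let κ : s →ₗ[ℝ] (Eucl d × Eucl d) := D.coord ∘ₗ s.subtype
  have hκ : Function.Bijective κ := by
    constructor
    · rw [← LinearMap.ker_eq_bot, LinearMap.ker_eq_bot']
      intro x hx
      have := (Submodule.disjoint_def.1 hsu.disjoint) x x.2 (D.mem_u_of_coord_eq_zero hx)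
      exact Subtype.ext this
    · intro w
      have hw : D.sec w ∈ s ⊔ D.u := by rw [hsu.sup_eq_top]; trivial
      obtain ⟨a, ha, y, hy, hay⟩ := Submodule.mem_sup.1 hw
      refine ⟨⟨a, ha⟩, ?_⟩
      have : D.coord (a + y) = w := by rw [hay, D.coord_sec]
      rwa [map_add, D.coord_eq_zero hy, add_zero] at this
  let e : s ≃L[ℝ] (Eucl d × Eucl d) := (LinearEquiv.ofBijective κ hκ).toContinuousLinearEquiv
  have h1 : HasCompactSupport fun x : s => D.extend f (x : g) := by
    have h2 : HasCompactSupport (f ∘ e) := hc.comp_homeomorph e.toHomeomorph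
    exact h2.mul_left
  exact ⟨h1.toSchwartzMap (hsm.comp s.subtypeL.contDiff), fun x => rfl⟩

theorem exists_schwartzMap_of_isSchwartz {h : D.L1} (hh : D.IsSchwartz h) :
    ∃ φ : 𝓢(Eucl d × Eucl d, ℂ), ∀ w, φ w = h (D.sec w) := by
  obtain ⟨φ, hφ⟩ := hh.2 _ D.sec_isCompl
  exact ⟨SchwartzMap.compCLMOfContinuousLinearEquiv ℂ
    (LinearEquiv.ofInjective (D.sec : (Eucl d × Eucl d) →ₗ[ℝ] g)
      D.sec_injective).toContinuousLinearEquiv φ, fun w => hφ _⟩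

theorem norm_le_l1Norm (h : D.L1) : ‖h‖ ≤ D.l1Norm h := by
  rw [norm_L1_eq]
  exact Real.iSup_le (fun ρ => D.norm_repOp_le ρ.π h) (integral_nonneg fun _ => norm_nonneg _)

/-- In the coordinates of `G/U` this is the density of smooth compactly supported functions in `L¹`;
`ofFun` lifts them back to covariant functions. -/
theorem exists_isSchwartz_l1Norm_sub_lt (h : D.L1) {ε : ℝ} (hε : 0 < ε) :
    ∃ h' : D.L1, D.IsSchwartz h' ∧ D.l1Norm (h - h') < ε := by
  have hi : Integrable (fun w => h (D.sec w)) := h.mem.2.2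
  obtain ⟨k, hk1, hk2, hk3⟩ := MemLp.exist_eLpNorm_sub_le (p := 1) ENNReal.one_ne_top le_rfl
    (memLp_one_iff_integrable.2 hi) (half_pos hε)
  have hk : Integrable k := hk2.continuous.integrable_of_hasCompactSupport hk1
  refine ⟨D.ofFun k hk2.continuous.measurable hk, D.isSchwartz_ofFun hk2 hk1 _ _, ?_⟩
  have h4 : D.l1Norm (h - D.ofFun k hk2.continuous.measurable hk) =
      (eLpNorm ((fun w => h (D.sec w)) - k) 1 volume).toReal := by
    rw [eLpNorm_one_eq_lintegral_enorm, ← integral_norm_eq_lintegral_enorm (hi.sub hk).1, l1Norm]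
    refine integral_congr_ae (Eventually.of_forall fun w => ?_)
    change ‖h (D.sec w) - D.ofFun k hk2.continuous.measurable hk (D.sec w)‖ = _
    rw [ofFun_sec]
    rfl
  rw [h4]
  have h5 := ENNReal.toReal_mono ENNReal.ofReal_ne_top hk3
  rw [ENNReal.toReal_ofReal (half_pos hε).le] at h5
  linarith

theorem dense_isSchwartz :
    Dense {a : D.CStar | ∃ h : D.L1, D.IsSchwartz h ∧ a = (h : D.CStar)} := by
  intro a
  refine Metric.mem_closure_iff.2 fun ε hε => ?_
  obtain ⟨_, ⟨h, rfl⟩, hh⟩ := Metric.mem_closure_iff.1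
    ((UniformSpace.Completion.denseRange_coe (α := D.L1)) a) (ε / 2) (half_pos hε)
  obtain ⟨h', hS, hh'⟩ := D.exists_isSchwartz_l1Norm_sub_lt h (half_pos hε)
  refine ⟨h', ⟨h', hS, rfl⟩, (dist_triangle _ (h : D.CStar) _).trans_lt ?_⟩
  have : dist (h : D.CStar) (h' : D.CStar) < ε / 2 := by
    rw [UniformSpace.Completion.dist_eq, dist_eq_norm]
    exact (D.norm_le_l1Norm _).trans_lt hh'
  linarith

end QuotientData

/-! ### Decay of oscillatory integrals along the radical. -/

theorem norm_le_sum_abs {n : ℕ} (x : Eucl n) : ‖x‖ ≤ ∑ j, |x j| := by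
  have h : x = ∑ j, x j • EuclideanSpace.single j (1 : ℝ) := by
    refine PiLp.ext fun i => ?_
    simp [Finset.sum_apply, Pi.single_apply]
  conv_lhs => rw [h]
  refine (norm_sum_le _ _).trans (le_of_eq ?_)
  simp [norm_smul]

theorem norm_le_sum_abs_pairing {n : ℕ} (q : Eucl n × Eucl n) :
    ‖q‖ ≤ ∑ i, |pairing q (Sum.elim (fun j => (EuclideanSpace.single j (1 : ℝ), 0))
      (fun j => (0, EuclideanSpace.single j (1 : ℝ))) i)| := by
  have h1 : ∀ j, pairing q (EuclideanSpace.single j (1 : ℝ), 0) = q.1 j := fun j => by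
    simp [pairing]
  have h2 : ∀ j, pairing q (0, EuclideanSpace.single j (1 : ℝ)) = q.2 j := fun j => by
    simp [pairing]
  simp only [Fintype.sum_sum_type, Sum.elim_inl, Sum.elim_inr, h1, h2]
  have h3 := norm_le_sum_abs q.1
  have h4 := norm_le_sum_abs q.2
  have h5 : 0 ≤ ∑ j, |q.1 j| := Finset.sum_nonneg fun _ _ => abs_nonneg _
  have h6 : 0 ≤ ∑ j, |q.2 j| := Finset.sum_nonneg fun _ _ => abs_nonneg _
  rw [Prod.norm_def]
  exact max_le (by linarith) (by linarith)

theorem hasDerivAt_phase_mul (c : ℝ) : HasDerivAt (fun t : ℝ => phase (t * c))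
    (-(2 * Real.pi * Complex.I * c)) 0 := by
  have h1 : HasDerivAt (fun t : ℝ => -(2 * Real.pi * Complex.I * ((t * c : ℝ) : ℂ)))
      (-(2 * Real.pi * Complex.I * c)) 0 := by
    have h := (((Complex.ofRealCLM.hasDerivAt (x := (0 : ℝ))).mul_const (c : ℂ)).const_mul
      (2 * Real.pi * Complex.I)).neg
    exact (h.congr_deriv (by simp)).congr_of_eventuallyEq (Eventually.of_forall fun t => by simp)
  have h2 := h1.cexp
  simpa [phase] using h2

section Decay

variable {V : Type*} [NormedAddCommGroup V] [NormedSpace ℝ V] [FiniteDimensional ℝ V]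
  [MeasurableSpace V] [BorelSpace V] {μ : Measure V} [μ.IsAddHaarMeasure] {n : ℕ}
  {ρ : V →L[ℝ] (Eucl n × Eucl n)} {ι : (Eucl n × Eucl n) →L[ℝ] V}

theorem integrable_schwartz_mul_phase (φ : 𝓢(V, ℂ)) (q : Eucl n × Eucl n) {G : V → ℂ}
    (hG : Continuous G) (hG1 : ∀ w, ‖G w‖ ≤ 1) :
    Integrable (fun w => φ w * (phase (pairing q (ρ w)) * G w)) μ := by
  refine (φ.integrable (μ := μ)).norm.mono' (Continuous.aestronglyMeasurable ?_)
    (Eventually.of_forall fun w => ?_)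
  · have := φ.continuous
    fun_prop
  · rw [norm_mul, norm_mul, norm_phase, one_mul]
    exact mul_le_of_le_one_right (norm_nonneg _) (hG1 w)

/-- Integration by parts in a radical direction: `G` is constant along it, so only the phase is
differentiated and it yields a factor `pairing q r`. -/
theorem integral_lineDeriv_mul_phase (hρ : ∀ r, ρ (ι r) = r) (φ : 𝓢(V, ℂ))
    (q r : Eucl n × Eucl n) {G : V → ℂ} (hG : Continuous G) (hG1 : ∀ w, ‖G w‖ ≤ 1)
    (hGι : ∀ w r, G (w + ι r) = G w) :
    ∫ w, (LineDeriv.lineDerivOp (ι r) φ : 𝓢(V, ℂ)) w * (phase (pairing q (ρ w)) * G w) ∂μ =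
      2 * Real.pi * Complex.I * pairing q r *
        ∫ w, φ w * (phase (pairing q (ρ w)) * G w) ∂μ := by
  set c : ℂ := 2 * Real.pi * Complex.I * pairing q r with hc
  let k : V → ℂ := fun w => phase (pairing q (ρ w)) * G w
  have hk : ∀ w, HasLineDerivAt ℝ k (-c * k w) w (ι r) := fun w => by
    have h1 := (hasDerivAt_phase_mul (pairing q r)).mul_const (k w)
    refine h1.congr_of_eventuallyEq (Eventually.of_forall fun t => ?_)
    simp only [k]
    rw [← map_smul, hGι, map_add, hρ, pairing_add_right, pairing_smul_right, phase_add]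
    ring
  have hφ : ∀ w, HasLineDerivAt ℝ φ ((LineDeriv.lineDerivOp (ι r) φ : 𝓢(V, ℂ)) w) w (ι r) :=
    fun w => by
      rw [SchwartzMap.lineDerivOp_apply_eq_fderiv]
      exact φ.differentiableAt.hasFDerivAt.hasLineDerivAt _
  have hi := integrable_schwartz_mul_phase (μ := μ) (ρ := ρ) φ q hG hG1
  have h := integral_bilinear_hasLineDerivAt_right_eq_neg_left_of_integrable (μ := μ)
    (B := ContinuousLinearMap.mul ℝ ℂ) (f := φ) (g := k) (v := ι r)
    (f' := (LineDeriv.lineDerivOp (ι r) φ : 𝓢(V, ℂ))) (g' := fun w => -c * k w)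
    (integrable_schwartz_mul_phase _ q hG hG1)
    ((hi.const_mul (-c)).congr (Eventually.of_forall fun w => by
      simp only [ContinuousLinearMap.mul_apply', k]; ring))
    hi (fun w _ => hφ w) (fun w _ => hk w)
  simp only [ContinuousLinearMap.mul_apply', k] at h
  rw [← neg_eq_iff_eq_neg, ← integral_neg] at h
  rw [← h, ← integral_const_mul]
  refine integral_congr_ae (Eventually.of_forall fun w => ?_)
  simp only
  ring

/-- Each power of `‖q‖` costs one derivative of `φ`. The constant must not depend on `G`: later `G`
is an arbitrary matrix coefficient, and uniformity is what gives decay in operator norm. -/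
theorem exists_norm_pow_mul_integral_le (hρ : ∀ r, ρ (ι r) = r) (N : ℕ) (φ : 𝓢(V, ℂ)) :
    ∃ C, 0 ≤ C ∧ ∀ (q : Eucl n × Eucl n) (G : V → ℂ), Continuous G → (∀ w, ‖G w‖ ≤ 1) →
      (∀ w r, G (w + ι r) = G w) →
      ‖q‖ ^ N * ‖∫ w, φ w * (phase (pairing q (ρ w)) * G w) ∂μ‖ ≤ C := by
  induction N generalizing φ with
  | zero =>
    refine ⟨∫ w, ‖φ w‖ ∂μ, integral_nonneg fun _ => norm_nonneg _, fun q G hG hG1 _ => ?_⟩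
    rw [pow_zero, one_mul]
    refine norm_integral_le_of_norm_le (φ.integrable (μ := μ)).norm
      (Eventually.of_forall fun w => ?_)
    rw [norm_mul, norm_mul, norm_phase, one_mul]
    exact mul_le_of_le_one_right (norm_nonneg _) (hG1 w)
  | succ N ih =>
    let e : Fin n ⊕ Fin n → Eucl n × Eucl n :=
      Sum.elim (fun j => (EuclideanSpace.single j (1 : ℝ), 0))
        (fun j => (0, EuclideanSpace.single j (1 : ℝ)))
    choose C hC0 hC using fun i => ih (LineDeriv.lineDerivOp (ι (e i)) φ)
    refine ⟨∑ i, C i, Finset.sum_nonneg fun i _ => hC0 i, fun q G hG hG1 hGι => ?_⟩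
    set I := ∫ w, φ w * (phase (pairing q (ρ w)) * G w) ∂μ
    have h1 : ∀ i, ‖q‖ ^ N * (|pairing q (e i)| * ‖I‖) ≤ C i := fun i => by
      refine le_trans ?_ (hC i q G hG hG1 hGι)
      rw [integral_lineDeriv_mul_phase hρ φ q (e i) hG hG1 hGι, norm_mul]
      gcongr
      have h2 : ‖(2 * Real.pi * Complex.I * pairing q (e i) : ℂ)‖ =
          2 * Real.pi * |pairing q (e i)| := by
        simp [abs_of_pos Real.pi_pos]
      rw [h2]
      -- The factor `2π` from the derivative is at least `1` and can be dropped.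
      have : 1 ≤ 2 * Real.pi := by linarith [Real.pi_gt_three]
      exact le_mul_of_one_le_left (abs_nonneg _) this
    calc ‖q‖ ^ (N + 1) * ‖I‖ = ‖q‖ ^ N * (‖q‖ * ‖I‖) := by ring
      _ ≤ ‖q‖ ^ N * ((∑ i, |pairing q (e i)|) * ‖I‖) := by
        gcongr
        exact norm_le_sum_abs_pairing q
      _ = ∑ i, ‖q‖ ^ N * (|pairing q (e i)| * ‖I‖) := by
        rw [Finset.sum_mul, Finset.mul_sum]
      _ ≤ ∑ i, C i := Finset.sum_le_sum fun i _ => h1 i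

end Decay

/-! ### Families of representations parametrized by the radical characters. -/

/-- The irreducible representations of `G` that are multiples of `χ_ℓ` on `U`, realized on one
Hilbert space and parametrized by their characters on the radical. -/
structure RadicalFamily {g : Type*} [NormedAddCommGroup g] [InnerProductSpace ℝ g]
    [TwoStepLieAlgebra g] {d m n : ℕ} {D : QuotientData g d} (B : SymplecticFrame D m n)
    (K : Type) [NormedAddCommGroup K] [InnerProductSpace ℂ K] where
  rep : Eucl n × Eucl n → UnitaryRep g K
  irreducible : ∀ q, (rep q).IsIrreducible
  restrict : ∀ q, ∀ x ∈ D.u, ∀ v, (rep q).op x v = chi D.ℓ x • v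
  radical : ∀ q r v, (rep q).op (D.sec (B.equiv (0, r))) v = phase (pairing q r) • v
  twist : ∀ q w v, (rep q).op (D.sec w) v =
    phase (pairing q (B.equiv.symm w).2) • (rep 0).op (D.sec w) v

namespace RadicalFamily

variable {g : Type*} [NormedAddCommGroup g] [InnerProductSpace ℝ g] [FiniteDimensional ℝ g]
  [MeasurableSpace g] [BorelSpace g] [TwoStepLieAlgebra g] {d m n : ℕ} {D : QuotientData g d}
  {B : SymplecticFrame D m n} {K : Type} [NormedAddCommGroup K] [InnerProductSpace ℂ K]
  [CompleteSpace K] (R : RadicalFamily B K)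

theorem norm_repOp_le_norm (h : D.L1) (q : Eucl n × Eucl n) : ‖D.repOp (R.rep q) h‖ ≤ ‖h‖ := by
  let ρ : D.Spec :=
    { H := K, π := R.rep q, irreducible := R.irreducible q, restrict := R.restrict q }
  rw [D.norm_L1_eq]
  exact le_ciSup (D.bddAbove_spec h) ρ

/-- The family computes the `C*`-norm: an arbitrary member of `Spec` has some radical character `q`,
and is dominated by the member of the family with that same `q`. -/
theorem norm_le_of_forall_norm_repOp_le (h : D.L1) {C : ℝ}
    (hC : ∀ q, ‖D.repOp (R.rep q) h‖ ≤ C) : ‖h‖ ≤ C := by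
  rw [D.norm_L1_eq]
  refine Real.iSup_le (fun ρ => ?_) ((norm_nonneg _).trans (hC 0))
  obtain ⟨q, hq⟩ := B.exists_radical_character ρ.π ρ.restrict ρ.irreducible
  have : Nontrivial K := (R.irreducible q).1
  exact (B.norm_repOp_le ρ.π ρ.restrict ρ.irreducible (R.rep q) (R.restrict q) hq
    (R.radical q) h).trans (hC q)

/-- By `twist` two members differ only by a scalar phase at each point, so the operator norm of the
difference is at most an integral of `‖h‖` times a difference of phases, which tends to `0` by
dominated convergence. -/
theorem continuous_repOp (h : D.L1) : Continuous fun q => D.repOp (R.rep q) h := by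
  have hi : Integrable (fun w => h (D.sec w)) := h.mem.2.2
  let θ : Eucl n × Eucl n → Eucl d × Eucl d → ℂ := fun q w =>
    phase (pairing q (B.equiv.symm w).2)
  have hθ : ∀ q, Continuous (θ q) := fun q => by
    simp only [θ]
    fun_prop
  refine continuous_iff_continuousAt.2 fun q₀ => ?_
  have hb : ∀ q, ‖D.repOp (R.rep q) h - D.repOp (R.rep q₀) h‖ ≤
      ∫ w, ‖h (D.sec w)‖ * ‖θ q w - θ q₀ w‖ := fun q => by
    have hint : Integrable (fun w => ‖h (D.sec w)‖ * ‖θ q w - θ q₀ w‖) := by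
      refine (hi.norm.mul_const 2).mono' (hi.norm.1.mul
        ((hθ q).sub (hθ q₀)).norm.aestronglyMeasurable) (Eventually.of_forall fun w => ?_)
      rw [Real.norm_of_nonneg (by positivity)]
      gcongr
      refine (norm_sub_le _ _).trans ?_
      simp only [θ, norm_phase]
      norm_num
    refine ContinuousLinearMap.opNorm_le_bound _ (integral_nonneg fun w => by positivity)
      fun v => ?_
    rw [sub_apply, D.repOp_apply, D.repOp_apply,
      ← integral_sub (D.integrable_rep _ h v) (D.integrable_rep _ h v), ← integral_mul_const]
    refine norm_integral_le_of_norm_le (hint.mul_const _) (Eventually.of_forall fun w => ?_)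
    rw [R.twist q, R.twist q₀, ← smul_sub, ← sub_smul, norm_smul, norm_smul, mul_assoc]
    simp [θ]
  have hlim : Tendsto (fun q => ∫ w, ‖h (D.sec w)‖ * ‖θ q w - θ q₀ w‖) (𝓝 q₀) (𝓝 0) := by
    have h0 : (0 : ℝ) = ∫ w, ‖h (D.sec w)‖ * ‖θ q₀ w - θ q₀ w‖ := by simp
    rw [h0]
    have hcont : Continuous fun q => ∫ w, ‖h (D.sec w)‖ * ‖θ q w - θ q₀ w‖ := by
      refine continuous_of_dominated (bound := fun w => ‖h (D.sec w)‖ * 2)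
        (fun q => hi.norm.1.mul ((hθ q).sub (hθ q₀)).norm.aestronglyMeasurable)
        (fun q => Eventually.of_forall fun w => ?_) (hi.norm.mul_const 2)
        (Eventually.of_forall fun w => ?_)
      · rw [Real.norm_of_nonneg (by positivity)]
        gcongr
        refine (norm_sub_le _ _).trans ?_
        simp only [θ, norm_phase]
        norm_num
      · simp only [θ]
        fun_prop
    exact hcont.tendsto q₀
  exact tendsto_iff_norm_sub_tendsto_zero.2
    (squeeze_zero (fun _ => norm_nonneg _) hb hlim)

/-- A matrix coefficient of `rep q` is the radical phase times one of `rep 0`, and the latter is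
invariant under the radical. So the uniform decay estimate applies to all pairs of unit vectors at
once. -/
theorem exists_norm_pow_mul_norm_repOp_le {h : D.L1} (hh : D.IsSchwartz h) (N : ℕ) :
    ∃ C, 0 ≤ C ∧ ∀ q, ‖q‖ ^ N * ‖D.repOp (R.rep q) h‖ ≤ C := by
  obtain ⟨φ, hφ⟩ := D.exists_schwartzMap_of_isSchwartz hh
  let ρ : (Eucl d × Eucl d) →L[ℝ] (Eucl n × Eucl n) :=
    (ContinuousLinearMap.snd ℝ _ _).comp
      (B.equiv.symm : (Eucl d × Eucl d) →L[ℝ] (PhaseSpace m × (Eucl n × Eucl n)))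
  let ι : (Eucl n × Eucl n) →L[ℝ] (Eucl d × Eucl d) :=
    (B.equiv : (PhaseSpace m × (Eucl n × Eucl n)) →L[ℝ] (Eucl d × Eucl d)).comp
      (ContinuousLinearMap.inr ℝ _ _)
  have hι : ∀ r, ι r = B.equiv (0, r) := fun _ => rfl
  have hρ : ∀ r, ρ (ι r) = r := fun r => by simp [ρ, ι]
  obtain ⟨C, hC0, hC⟩ := exists_norm_pow_mul_integral_le (μ := volume) hρ N φ
  refine ⟨C, hC0, fun q => ?_⟩
  have key : ‖((‖q‖ ^ N : ℝ) : ℂ) • D.repOp (R.rep q) h‖ ≤ C := by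
    refine ContinuousLinearMap.opNorm_le_of_re_inner_le hC0 fun v u hv hu => ?_
    refine (RCLike.re_le_norm _).trans ?_
    rw [norm_inner_symm, smul_apply, inner_smul_right, norm_mul, D.inner_repOp]
    have h1 := hC q (fun w => inner ℂ u ((R.rep 0).op (D.sec w) v)) ?_ ?_ ?_
    · have h2 : ‖((‖q‖ ^ N : ℝ) : ℂ)‖ = ‖q‖ ^ N := by simp
      rw [h2]
      refine le_trans (le_of_eq ?_) h1
      congr 2
      refine integral_congr_ae (Eventually.of_forall fun w => ?_)
      simp only [R.twist q, inner_smul_right, hφ]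
      rfl
    · have h3 := ((R.rep 0).continuous_op v).comp D.sec.continuous
      simp only [Function.comp_def] at h3
      fun_prop
    · intro w
      refine (norm_inner_le_norm _ _).trans ?_
      simp [hu, hv]
    -- Invariance of the coefficient: the radical is orthogonal to everything for `ℓ [·, ·]`, and it
    -- acts trivially in `rep 0`.
    · intro w r
      have h4 := D.op_op_eq (R.rep 0) (R.restrict 0) (D.sec w) (D.sec (ι r)) v
      have h5 : D.ℓ ⁅D.sec w, D.sec (ι r)⁆ = 0 := by
        have := B.lie (B.equiv.symm w) (0, r)
        rw [B.equiv.apply_symm_apply] at this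
        simpa [hι] using this
      have h6 : (R.rep 0).op (D.sec (ι r)) v = v := by
        have := R.radical 0 r v
        simpa [pairing, hι] using this
      rw [h5, zero_div, phase_zero, one_smul, h6] at h4
      rw [map_add, ← h4]
  rwa [norm_smul, Complex.norm_real, norm_pow, norm_norm] at key

theorem integrable_norm_repOp {h : D.L1} (hh : D.IsSchwartz h) :
    Integrable fun q => ‖D.repOp (R.rep q) h‖ := by
  -- One more than the dimension, so that `(1 + ‖q‖)^(-N)` is integrable.
  let N := Module.finrank ℝ (Eucl n × Eucl n) + 1
  obtain ⟨C₀, hC₀, h0⟩ := R.exists_norm_pow_mul_norm_repOp_le hh 0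
  obtain ⟨C₁, hC₁, h1⟩ := R.exists_norm_pow_mul_norm_repOp_le hh N
  have hint : Integrable fun q : Eucl n × Eucl n => (1 + ‖q‖) ^ (-(N : ℝ)) :=
    integrable_one_add_norm (by simp [N])
  refine (hint.const_mul (2 ^ (N - 1) * (C₀ + C₁))).mono'
    (R.continuous_repOp h).norm.aestronglyMeasurable (Eventually.of_forall fun q => ?_)
  rw [norm_norm, Real.rpow_neg (by positivity), Real.rpow_natCast, ← div_eq_mul_inv,
    le_div_iff₀ (by positivity)]
  have h2 := add_pow_le (zero_le_one (α := ℝ)) (norm_nonneg q) N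
  rw [one_pow] at h2
  have h3 := h0 q
  have h4 := h1 q
  rw [pow_zero, one_mul] at h3
  calc ‖D.repOp (R.rep q) h‖ * (1 + ‖q‖) ^ N
      ≤ ‖D.repOp (R.rep q) h‖ * (2 ^ (N - 1) * (1 + ‖q‖ ^ N)) := by gcongr
    _ = 2 ^ (N - 1) * (‖D.repOp (R.rep q) h‖ + ‖q‖ ^ N * ‖D.repOp (R.rep q) h‖) := by ring
    _ ≤ 2 ^ (N - 1) * (C₀ + C₁) := by gcongr

/-- Riemann-Lebesgue: Schwartz elements decay at least like `1/‖q‖`, and the remainder is bounded by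
its `L¹` norm uniformly in `q`. -/
theorem tendsto_repOp_cocompact (h : D.L1) :
    Tendsto (fun q => D.repOp (R.rep q) h) (cocompact _) (𝓝 0) := by
  rw [tendsto_zero_iff_norm_tendsto_zero, Metric.tendsto_nhds]
  intro ε hε
  obtain ⟨h', hS, hh'⟩ := D.exists_isSchwartz_l1Norm_sub_lt h (half_pos hε)
  obtain ⟨C, hC0, hC⟩ := R.exists_norm_pow_mul_norm_repOp_le hS 1
  have h1 : ∀ᶠ q : Eucl n × Eucl n in cocompact _, 2 * C / ε < ‖q‖ :=
    (tendsto_norm_cocompact_atTop).eventually_gt_atTop _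
  filter_upwards [h1] with q hq
  have h2 : ‖D.repOp (R.rep q) h'‖ < ε / 2 := by
    have h3 := hC q
    rw [pow_one] at h3
    have hq0 : 0 < ‖q‖ := lt_of_le_of_lt (by positivity) hq
    rw [div_lt_iff₀ hε] at hq
    by_contra! h4
    nlinarith [mul_le_mul_of_nonneg_left h4 hq0.le]
  have h5 : D.repOp (R.rep q) h = D.repOp (R.rep q) (h - h') + D.repOp (R.rep q) h' := by
    rw [← D.repOp_add, sub_add_cancel]
  have h6 := (D.norm_repOp_le (R.rep q) (h - h'))
  rw [dist_zero_right, norm_norm, h5]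
  exact (norm_add_le _ _).trans_lt (by linarith)

end RadicalFamily

/-! ### The isometric Fourier transform on the completion. -/

section Fourier

variable {g : Type*} [NormedAddCommGroup g] [InnerProductSpace ℝ g] [FiniteDimensional ℝ g]
  [MeasurableSpace g] [BorelSpace g] [TwoStepLieAlgebra g] {d m n : ℕ} {D : QuotientData g d}
  {B : SymplecticFrame D m n} {K : Type} [NormedAddCommGroup K] [InnerProductSpace ℂ K]
  [CompleteSpace K] (R : RadicalFamily B K)
  {A : Type*} [NormedAddCommGroup A] [NormedSpace ℂ A] [CompleteSpace A]
  (ι : A →ₗᵢ[ℂ] (K →L[ℂ] K))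

/-- The embedding `ι` lets the same construction serve scalars and compact operators: once all
`π_q(h)` lie in its range, their preimages form a `C₀` function whose supremum norm is the
`C*`-norm, and the isometry extends to the completion. -/
theorem RadicalFamily.exists_linearIsometry
    (hι : ∀ (h : D.L1) q, ∃ a, ι a = D.repOp (R.rep q) h) :
    ∃ F : D.CStar →ₗᵢ[ℂ] C₀(Eucl n × Eucl n, A),
      ∀ (h : D.L1) q, ι (F (h : D.CStar) q) = D.repOp (R.rep q) h := by
  choose σ hσ using hι
  have hcont : ∀ h, Continuous (σ h) := fun h => by
    rw [ι.isometry.isEmbedding.continuous_iff]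
    simpa only [Function.comp_def, hσ] using R.continuous_repOp h
  have hzero : ∀ h, Tendsto (σ h) (cocompact _) (𝓝 0) := fun h => by
    rw [tendsto_zero_iff_norm_tendsto_zero]
    have h1 := (tendsto_zero_iff_norm_tendsto_zero).1 (R.tendsto_repOp_cocompact h)
    refine h1.congr fun q => ?_
    rw [← hσ, ι.norm_map]
  let F₀ : D.L1 →ₗᵢ[ℂ] C₀(Eucl n × Eucl n, A) :=
    { toFun := fun h => ⟨⟨σ h, hcont h⟩, hzero h⟩
      map_add' := fun h h' => by
        ext q
        apply ι.injective
        change ι (σ (h + h') q) = ι (σ h q + σ h' q)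
        rw [map_add, hσ, hσ, hσ, D.repOp_add]
      map_smul' := fun c h => by
        ext q
        apply ι.injective
        change ι (σ (c • h) q) = ι (c • σ h q)
        rw [map_smul, hσ, hσ, D.repOp_smul]
      norm_map' := fun h => by
        refine le_antisymm ?_ ?_
        · rw [← ZeroAtInftyContinuousMap.norm_toBCF_eq_norm]
          refine (BoundedContinuousFunction.norm_le (norm_nonneg _)).2 fun q => ?_
          change ‖σ h q‖ ≤ ‖h‖
          rw [← ι.norm_map, hσ]
          exact R.norm_repOp_le_norm h q
        · refine R.norm_le_of_forall_norm_repOp_le h fun q => ?_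
          rw [← hσ, ι.norm_map, ← ZeroAtInftyContinuousMap.norm_toBCF_eq_norm]
          exact BoundedContinuousFunction.norm_coe_le_norm
            (ZeroAtInftyContinuousMap.toBCF ⟨⟨σ h, hcont h⟩, hzero h⟩) q }
  let e : D.L1 →L[ℂ] D.CStar := UniformSpace.Completion.toComplL
  let F₁ : D.CStar →L[ℂ] C₀(Eucl n × Eucl n, A) := F₀.toContinuousLinearMap.extend e
  have hF₁ : ∀ h : D.L1, F₁ (h : D.CStar) = F₀ h := fun h =>
    ContinuousLinearMap.extend_eq _ (e := e) UniformSpace.Completion.denseRange_coe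
      (UniformSpace.Completion.isUniformInducing_coe D.L1) h
  refine ⟨⟨F₁.toLinearMap, fun a => ?_⟩, fun h q => ?_⟩
  · change ‖F₁ a‖ = ‖a‖
    induction a using UniformSpace.Completion.induction_on with
    | hp => exact isClosed_eq (by fun_prop) continuous_norm
    | ih h => rw [hF₁, F₀.norm_map, UniformSpace.Completion.norm_coe]
  · change ι (F₁ (h : D.CStar) q) = _
    rw [hF₁]
    exact hσ h q

theorem adjoint_fourier_eq {F : D.CStar →ₗᵢ[ℂ] C₀(Eucl n × Eucl n, A)}
    (hF : ∀ (h : D.L1) q, ι (F (h : D.CStar) q) = D.repOp (R.rep q) h) (a : D.CStar)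
    (q : Eucl n × Eucl n) :
    ι (F (D.starC a) q) = ContinuousLinearMap.adjoint (ι (F a q)) := by
  have hev : Continuous fun φ : C₀(Eucl n × Eucl n, A) => φ q :=
    (continuous_eval_const (F := BoundedContinuousFunction (Eucl n × Eucl n) A) q).comp
      ZeroAtInftyContinuousMap.isometry_toBCF.continuous
  have hstar : Continuous D.starC := UniformSpace.Completion.continuous_map
  induction a using UniformSpace.Completion.induction_on with
  | hp =>
    refine isClosed_eq (ι.continuous.comp (hev.comp (F.continuous.comp hstar))) ?_
    exact ContinuousLinearMap.adjoint.continuous.comp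
      (ι.continuous.comp (hev.comp F.continuous))
  | ih h => rw [D.starC_coe, hF, hF, D.repOp_starL1]

end Fourier

/-! ### Coherent families and their weak integrals. -/

/-- A continuous bounded family of operators `V_q : K → H` with `c ∫ ‖V_q^* ξ‖² dq ≤ ‖ξ‖²`. -/
structure IsCoherent {Q K H : Type*} [TopologicalSpace Q] [MeasureSpace Q] [NormedAddCommGroup K]
    [InnerProductSpace ℂ K] [CompleteSpace K] [NormedAddCommGroup H] [InnerProductSpace ℂ H]
    [CompleteSpace H] (c : ℝ) (V : Q → (K →L[ℂ] H)) : Prop where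
  nonneg : 0 ≤ c
  continuous : Continuous V
  bounded : ∃ M, ∀ q, ‖V q‖ ≤ M
  integrable : ∀ ξ, Integrable fun q => ‖ContinuousLinearMap.adjoint (V q) ξ‖ ^ 2
  bessel : ∀ ξ, c * ∫ q, ‖ContinuousLinearMap.adjoint (V q) ξ‖ ^ 2 ≤ ‖ξ‖ ^ 2

/-- The integrand `c V_q φ(q) V_q^*`. -/
def coherentIntegrand {Q K H : Type*} [NormedAddCommGroup K]
    [InnerProductSpace ℂ K] [CompleteSpace K] [NormedAddCommGroup H] [InnerProductSpace ℂ H]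
    [CompleteSpace H] (c : ℝ) (V : Q → (K →L[ℂ] H)) (φ : Q → (K →L[ℂ] K)) (q : Q) : H →L[ℂ] H :=
  (c : ℂ) • (V q ∘L φ q ∘L ContinuousLinearMap.adjoint (V q))

theorem isCompactOperator_coherentIntegrand {Q K H : Type*} [NormedAddCommGroup K]
    [InnerProductSpace ℂ K] [CompleteSpace K] [NormedAddCommGroup H] [InnerProductSpace ℂ H]
    [CompleteSpace H] (c : ℝ) (V : Q → (K →L[ℂ] H)) {φ : Q → (K →L[ℂ] K)} {q : Q}
    (hφ : IsCompactOperator (φ q)) : IsCompactOperator (coherentIntegrand c V φ q) :=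
  ((hφ.comp_clm (ContinuousLinearMap.adjoint (V q))).clm_comp (V q)).smul (c : ℂ)

theorem IsWeakIntegral.unique {Q H : Type*} [MeasureSpace Q] [NormedAddCommGroup H]
    [InnerProductSpace ℂ H] {T T' : H →L[ℂ] H} {Φ : Q → (H →L[ℂ] H)} (h : IsWeakIntegral T Φ)
    (h' : IsWeakIntegral T' Φ) : T = T' :=
  ContinuousLinearMap.ext fun ξ => ext_inner_left ℂ fun ψ =>
    (h ξ ψ).2.trans (h' ξ ψ).2.symm

theorem isWeakIntegral_integral {Q H : Type*} [MeasureSpace Q] [NormedAddCommGroup H]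
    [InnerProductSpace ℂ H] [CompleteSpace H] {Φ : Q → (H →L[ℂ] H)} (hΦ : Integrable Φ) :
    IsWeakIntegral (∫ q, Φ q) Φ := fun ξ ψ => by
  have h := hΦ.apply_continuousLinearMap ξ
  refine ⟨h.const_inner ψ, ?_⟩
  rw [ContinuousLinearMap.integral_apply hΦ, ← integral_inner h]

namespace IsCoherent

variable {Q K H : Type*} [TopologicalSpace Q] [MeasureSpace Q] [OpensMeasurableSpace Q]
  [SecondCountableTopology Q] [NormedAddCommGroup K]
  [InnerProductSpace ℂ K] [CompleteSpace K] [NormedAddCommGroup H] [InnerProductSpace ℂ H]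
  [CompleteSpace H] {c : ℝ} {V : Q → (K →L[ℂ] H)}

theorem inner_coherentIntegrand (φ : Q → (K →L[ℂ] K)) (q : Q) (ξ ψ : H) :
    inner ℂ ψ (coherentIntegrand c V φ q ξ) = c * inner ℂ (ContinuousLinearMap.adjoint (V q) ψ)
      (φ q (ContinuousLinearMap.adjoint (V q) ξ)) := by
  simp [coherentIntegrand, ContinuousLinearMap.adjoint_inner_left]

theorem continuous_adjoint (hV : IsCoherent c V) :
    Continuous fun q => ContinuousLinearMap.adjoint (V q) :=
  ContinuousLinearMap.adjoint.continuous.comp hV.continuous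

theorem continuous_coherentIntegrand (hV : IsCoherent c V)
    {φ : Q → (K →L[ℂ] K)} (hφ : Continuous φ) :
    Continuous (coherentIntegrand c V φ) := by
  have h := hV.continuous_adjoint
  exact (hV.continuous.clm_comp (hφ.clm_comp h)).const_smul (c : ℂ)

theorem integrable_mul (hV : IsCoherent c V) (ξ ψ : H) :
    Integrable fun q => ‖ContinuousLinearMap.adjoint (V q) ψ‖ *
    ‖ContinuousLinearMap.adjoint (V q) ξ‖ := by
  have h := hV.continuous_adjoint
  refine ((hV.integrable ψ).add (hV.integrable ξ)).mono' (Continuous.aestronglyMeasurable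
    (by fun_prop)) (Eventually.of_forall fun q => ?_)
  rw [Real.norm_of_nonneg (by positivity)]
  simp only [Pi.add_apply]
  nlinarith [sq_nonneg (‖ContinuousLinearMap.adjoint (V q) ψ‖ -
    ‖ContinuousLinearMap.adjoint (V q) ξ‖), sq_nonneg (‖ContinuousLinearMap.adjoint (V q) ψ‖),
    sq_nonneg (‖ContinuousLinearMap.adjoint (V q) ξ‖)]

/-- Cauchy-Schwarz in its polarized form: integrate `2 t a b ≤ t² a² + b²`, apply the Bessel bound
to both squares and optimize over `t`. -/
theorem mul_integral_mul_le (hV : IsCoherent c V) (ξ ψ : H) :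
    c * ∫ q, ‖ContinuousLinearMap.adjoint (V q) ψ‖ * ‖ContinuousLinearMap.adjoint (V q) ξ‖ ≤
      ‖ψ‖ * ‖ξ‖ := by
  rcases eq_or_ne ψ 0 with rfl | hψ
  · simp
  set X := ∫ q, ‖ContinuousLinearMap.adjoint (V q) ψ‖ * ‖ContinuousLinearMap.adjoint (V q) ξ‖
  have hψ0 : 0 < ‖ψ‖ := norm_pos_iff.2 hψ
  have h1 : ∀ t : ℝ, c * (2 * t * X) ≤ t ^ 2 * ‖ψ‖ ^ 2 + ‖ξ‖ ^ 2 := fun t => by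
    have h2 : 2 * t * X ≤ ∫ q, (t ^ 2 * ‖ContinuousLinearMap.adjoint (V q) ψ‖ ^ 2 +
        ‖ContinuousLinearMap.adjoint (V q) ξ‖ ^ 2) := by
      rw [← integral_const_mul]
      refine integral_mono ((hV.integrable_mul ξ ψ).const_mul _)
        (((hV.integrable ψ).const_mul _).add (hV.integrable ξ)) fun q => ?_
      simp only
      nlinarith [sq_nonneg (t * ‖ContinuousLinearMap.adjoint (V q) ψ‖ -
        ‖ContinuousLinearMap.adjoint (V q) ξ‖)]
    rw [integral_add ((hV.integrable ψ).const_mul _) (hV.integrable ξ), integral_const_mul] at h2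
    have h3 := mul_le_mul_of_nonneg_left h2 hV.nonneg
    have h4 := mul_le_mul_of_nonneg_left (hV.bessel ψ) (sq_nonneg t)
    have h5 := hV.bessel ξ
    linarith
  -- This `t` makes the two terms on the right equal.
  have h6 := h1 (‖ξ‖ / ‖ψ‖)
  have h7 : (‖ξ‖ / ‖ψ‖) ^ 2 * ‖ψ‖ ^ 2 = ‖ξ‖ ^ 2 := by
    rw [← mul_pow, div_mul_cancel₀ _ hψ0.ne']
  rw [h7] at h6
  rcases eq_or_ne ξ 0 with rfl | hξ
  · simp [X]
  have hξ0 : 0 < ‖ξ‖ := norm_pos_iff.2 hξ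
  have h8 : c * X * (‖ξ‖ / ‖ψ‖) ≤ ‖ξ‖ ^ 2 := by nlinarith
  rw [mul_div_assoc', div_le_iff₀ hψ0] at h8
  have h9 : c * X * ‖ξ‖ ≤ (‖ψ‖ * ‖ξ‖) * ‖ξ‖ := by nlinarith
  exact le_of_mul_le_mul_right h9 hξ0

theorem norm_inner_le (hV : IsCoherent c V) {φ : Q → (K →L[ℂ] K)} {M : ℝ}
    (hM : ∀ q, ‖φ q‖ ≤ M) (ξ ψ : H) (q : Q) :
    ‖inner ℂ ψ (coherentIntegrand c V φ q ξ)‖ ≤ c * M *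
      (‖ContinuousLinearMap.adjoint (V q) ψ‖ * ‖ContinuousLinearMap.adjoint (V q) ξ‖) := by
  rw [inner_coherentIntegrand, norm_mul, Complex.norm_real, Real.norm_of_nonneg hV.nonneg,
    mul_assoc]
  refine mul_le_mul_of_nonneg_left ?_ hV.nonneg
  refine (norm_inner_le_norm _ _).trans ?_
  have h1 := ((φ q).le_opNorm (ContinuousLinearMap.adjoint (V q) ξ)).trans
    (mul_le_mul_of_nonneg_right (hM q) (norm_nonneg _))
  calc _ ≤ ‖ContinuousLinearMap.adjoint (V q) ψ‖ *
        (M * ‖ContinuousLinearMap.adjoint (V q) ξ‖) :=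
        mul_le_mul_of_nonneg_left h1 (norm_nonneg _)
    _ = _ := by ring

theorem integrable_inner (hV : IsCoherent c V) {φ : Q → (K →L[ℂ] K)} (hφ : Continuous φ) {M : ℝ}
    (hM : ∀ q, ‖φ q‖ ≤ M) (ξ ψ : H) :
    Integrable fun q => inner ℂ ψ (coherentIntegrand c V φ q ξ) := by
  have h := hV.continuous_coherentIntegrand hφ
  exact ((hV.integrable_mul ξ ψ).const_mul (c * M)).mono'
    (Continuous.aestronglyMeasurable (by fun_prop))
    (Eventually.of_forall fun q => hV.norm_inner_le hM ξ ψ q)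

/-- The integrated matrix coefficients form a sesquilinear form bounded by `M`, by
`mul_integral_mul_le`; Riesz representation turns it into an operator with the same bound. -/
theorem exists_isWeakIntegral (hV : IsCoherent c V) {φ : Q → (K →L[ℂ] K)}
    (hφ : Continuous φ) {M : ℝ} (hM0 : 0 ≤ M)
    (hM : ∀ q, ‖φ q‖ ≤ M) :
    ∃ T : H →L[ℂ] H, IsWeakIntegral T (coherentIntegrand c V φ) ∧ ‖T‖ ≤ M := by
  have hi := hV.integrable_inner hφ hM
  have hb : ∀ ψ ξ : H, ‖∫ q, inner ℂ ψ (coherentIntegrand c V φ q ξ)‖ ≤ M * ‖ψ‖ * ‖ξ‖ :=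
    fun ψ ξ => by
      refine (norm_integral_le_of_norm_le ((hV.integrable_mul ξ ψ).const_mul (c * M))
        (Eventually.of_forall fun q => hV.norm_inner_le hM ξ ψ q)).trans ?_
      rw [integral_const_mul, mul_comm c, mul_assoc, mul_assoc]
      exact mul_le_mul_of_nonneg_left (hV.mul_integral_mul_le ξ ψ) hM0
  let b : H →L⋆[ℂ] H →L[ℂ] ℂ := LinearMap.mkContinuous₂
    (LinearMap.mk₂'ₛₗ (starRingEnd ℂ) (RingHom.id ℂ)
      (fun ψ ξ => ∫ q, inner ℂ ψ (coherentIntegrand c V φ q ξ))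
      (fun ψ ψ' ξ => by
        simp only [inner_add_left]
        exact integral_add (hi ξ ψ) (hi ξ ψ'))
      (fun a ψ ξ => by
        simp only [inner_smul_left, smul_eq_mul]
        exact integral_const_mul _ _)
      (fun ψ ξ ξ' => by
        simp only [map_add, inner_add_right]
        exact integral_add (hi ξ ψ) (hi ξ' ψ))
      (fun a ψ ξ => by
        simp only [map_smul, inner_smul_right, smul_eq_mul, RingHom.id_apply]
        exact integral_const_mul _ _)) M hb
  -- Riesz represents the form by an operator acting on its conjugate-linear slot, hence the
  -- adjoint.
  have hT : ∀ ξ ψ : H, inner ℂ ψ (ContinuousLinearMap.adjoint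
      (InnerProductSpace.continuousLinearMapOfBilin b) ξ) =
      ∫ q, inner ℂ ψ (coherentIntegrand c V φ q ξ) := fun ξ ψ => by
    rw [ContinuousLinearMap.adjoint_inner_right,
      InnerProductSpace.continuousLinearMapOfBilin_apply]
    rfl
  refine ⟨ContinuousLinearMap.adjoint (InnerProductSpace.continuousLinearMapOfBilin b),
    fun ξ ψ => ⟨hi ξ ψ, hT ξ ψ⟩, ?_⟩
  refine ContinuousLinearMap.opNorm_le_of_re_inner_le hM0 fun ξ ψ hξ hψ => ?_
  refine (RCLike.re_le_norm _).trans ?_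
  rw [norm_inner_symm, hT]
  simpa [hξ, hψ] using hb ψ ξ

theorem integrable_coherentIntegrand (hV : IsCoherent c V) {φ : Q → (K →L[ℂ] K)} (hφ : Continuous φ)
    (hi : Integrable fun q => ‖φ q‖) : Integrable (coherentIntegrand c V φ) := by
  obtain ⟨M, hM⟩ := hV.bounded
  refine (hi.const_mul (c * (M * M))).mono'
    (hV.continuous_coherentIntegrand hφ).aestronglyMeasurable (Eventually.of_forall fun q => ?_)
  rw [coherentIntegrand, norm_smul, Complex.norm_real, Real.norm_of_nonneg hV.nonneg, mul_assoc]
  refine mul_le_mul_of_nonneg_left ?_ hV.nonneg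
  have hM0 : 0 ≤ M := (norm_nonneg _).trans (hM q)
  calc _ ≤ ‖V q‖ * (‖φ q‖ * ‖ContinuousLinearMap.adjoint (V q)‖) :=
        (ContinuousLinearMap.opNorm_comp_le _ _).trans (mul_le_mul_of_nonneg_left
          (ContinuousLinearMap.opNorm_comp_le _ _) (norm_nonneg _))
    _ ≤ M * (‖φ q‖ * M) := by
      rw [LinearIsometryEquiv.norm_map]
      gcongr <;> exact hM q
    _ = _ := by ring

theorem isWeakIntegral_adjoint {φ φ' : Q → (K →L[ℂ] K)}
    (hφ : ∀ q, φ' q = ContinuousLinearMap.adjoint (φ q)) {T : H →L[ℂ] H}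
    (hT : IsWeakIntegral T (coherentIntegrand c V φ)) :
    IsWeakIntegral (ContinuousLinearMap.adjoint T) (coherentIntegrand c V φ') := fun ξ ψ => by
  have h1 : ∀ q, inner ℂ ψ (coherentIntegrand c V φ' q ξ) =
      (starRingEnd ℂ) (inner ℂ ξ (coherentIntegrand c V φ q ψ)) := fun q => by
    rw [inner_coherentIntegrand, inner_coherentIntegrand, hφ,
      ContinuousLinearMap.adjoint_inner_right, map_mul, Complex.conj_ofReal, inner_conj_symm]
  simp only [h1]
  refine ⟨Complex.conjCLE.toContinuousLinearMap.integrable_comp (hT ψ ξ).1, ?_⟩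
  rw [integral_conj, ← (hT ψ ξ).2, inner_conj_symm, ContinuousLinearMap.adjoint_inner_right]

end IsCoherent

theorem IsWeakIntegral.add {Q H : Type*} [MeasureSpace Q] [NormedAddCommGroup H]
    [InnerProductSpace ℂ H] {T T' : H →L[ℂ] H} {Φ Φ' : Q → (H →L[ℂ] H)} (h : IsWeakIntegral T Φ)
    (h' : IsWeakIntegral T' Φ') : IsWeakIntegral (T + T') (fun q => Φ q + Φ' q) := fun ξ ψ => by
  simp only [_root_.add_apply, inner_add_right]
  exact ⟨(h ξ ψ).1.add (h' ξ ψ).1, by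
    rw [integral_add (h ξ ψ).1 (h' ξ ψ).1, (h ξ ψ).2, (h' ξ ψ).2]⟩

theorem IsWeakIntegral.smul {Q H : Type*} [MeasureSpace Q] [NormedAddCommGroup H]
    [InnerProductSpace ℂ H] {T : H →L[ℂ] H} {Φ : Q → (H →L[ℂ] H)} (h : IsWeakIntegral T Φ)
    (a : ℂ) : IsWeakIntegral (a • T) (fun q => a • Φ q) := fun ξ ψ => by
  simp only [_root_.smul_apply, inner_smul_right]
  exact ⟨(h ξ ψ).1.const_mul a, by rw [integral_const_mul, (h ξ ψ).2]⟩

section CoherentMap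

variable {Q K H A : Type*} [TopologicalSpace Q] [MeasureSpace Q] [OpensMeasurableSpace Q]
  [SecondCountableTopology Q] [NormedAddCommGroup K]
  [InnerProductSpace ℂ K] [CompleteSpace K] [NormedAddCommGroup H] [InnerProductSpace ℂ H]
  [CompleteSpace H] [NormedAddCommGroup A] [NormedSpace ℂ A] {c : ℝ} {V : Q → (K →L[ℂ] H)}

/-- Each weak integral is unique, so its linearity in `φ` follows from linearity of the integrand.
-/
theorem IsCoherent.exists_integralMap (hV : IsCoherent c V) (ι : A →ₗᵢ[ℂ] (K →L[ℂ] K)) :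
    ∃ μ : C₀(Q, A) →L[ℂ] (H →L[ℂ] H), ∀ φ : C₀(Q, A),
      IsWeakIntegral (μ φ) (coherentIntegrand c V fun q => ι (φ q)) ∧ ‖μ φ‖ ≤ ‖φ‖ := by
  have hex : ∀ φ : C₀(Q, A), ∃ T : H →L[ℂ] H,
      IsWeakIntegral T (coherentIntegrand c V fun q => ι (φ q)) ∧ ‖T‖ ≤ ‖φ‖ := fun φ =>
    hV.exists_isWeakIntegral (ι.continuous.comp φ.continuous) (norm_nonneg _) fun q => by
      change ‖ι (φ q)‖ ≤ ‖φ‖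
      rw [ι.norm_map, ← ZeroAtInftyContinuousMap.norm_toBCF_eq_norm]
      exact φ.toBCF.norm_coe_le_norm q
  choose T hT hTn using hex
  let μ : C₀(Q, A) →ₗ[ℂ] (H →L[ℂ] H) :=
    { toFun := T
      map_add' := fun φ φ' => by
        refine (hT (φ + φ')).unique ?_
        convert (hT φ).add (hT φ') using 2 with q
        simp [coherentIntegrand, ContinuousLinearMap.comp_add, ContinuousLinearMap.add_comp]
      map_smul' := fun a φ => by
        refine (hT (a • φ)).unique ?_
        have h : coherentIntegrand c V (fun q => ι ((a • φ) q)) =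
            fun q => a • coherentIntegrand c V (fun q => ι (φ q)) q := funext fun q => by
          rw [coherentIntegrand, coherentIntegrand, smul_comm a,
            ZeroAtInftyContinuousMap.smul_apply, map_smul, ContinuousLinearMap.smul_comp,
            ContinuousLinearMap.comp_smul]
        rw [h]
        exact (hT φ).smul a }
  exact ⟨μ.mkContinuous 1 fun φ => by rw [one_mul]; exact hTn φ, fun φ => ⟨hT φ, hTn φ⟩⟩

end CoherentMap

/-! ### Coherent integrals of the Fourier transform. -/

section CoherentRep

variable {g : Type*} [NormedAddCommGroup g] [InnerProductSpace ℝ g] [FiniteDimensional ℝ g]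
  [MeasurableSpace g] [BorelSpace g] [TwoStepLieAlgebra g] {d m n : ℕ} {D : QuotientData g d}
  {B : SymplecticFrame D m n} {K : Type} [NormedAddCommGroup K] [InnerProductSpace ℂ K]
  [CompleteSpace K] (R : RadicalFamily B K)
  {A : Type*} [NormedAddCommGroup A] [NormedSpace ℂ A] [CompleteSpace A]
  {ι : A →ₗᵢ[ℂ] (K →L[ℂ] K)} {F : D.CStar →ₗᵢ[ℂ] C₀(Eucl n × Eucl n, A)}
  {H : Type*} [NormedAddCommGroup H] [InnerProductSpace ℂ H] [CompleteSpace H] {c : ℝ}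
  {V : Eucl n × Eucl n → (K →L[ℂ] H)}
  {μ : C₀(Eucl n × Eucl n, A) →L[ℂ] (H →L[ℂ] H)}

theorem RadicalFamily.integrable_coherentIntegrand
    (hF : ∀ (h : D.L1) q, ι (F (h : D.CStar) q) = D.repOp (R.rep q) h)
    (hV : IsCoherent c V) {h : D.L1} (hh : D.IsSchwartz h) :
    Integrable (coherentIntegrand c V fun q => ι (F (h : D.CStar) q)) := by
  refine hV.integrable_coherentIntegrand (ι.continuous.comp (F (h : D.CStar)).continuous) ?_
  simpa only [hF] using R.integrable_norm_repOp hh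

theorem RadicalFamily.integralMap_eq_integral
    (hF : ∀ (h : D.L1) q, ι (F (h : D.CStar) q) = D.repOp (R.rep q) h)
    (hV : IsCoherent c V) (hμ : ∀ φ : C₀(Eucl n × Eucl n, A),
      IsWeakIntegral (μ φ) (coherentIntegrand c V fun q => ι (φ q)) ∧ ‖μ φ‖ ≤ ‖φ‖)
    {h : D.L1} (hh : D.IsSchwartz h) : μ (F (h : D.CStar)) =
      ∫ q, coherentIntegrand c V (fun q => ι (F (h : D.CStar) q)) q :=
  (hμ _).1.unique (isWeakIntegral_integral (R.integrable_coherentIntegrand hF hV hh))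

theorem eq_of_eqOn_isSchwartz {E : Type*} [NormedAddCommGroup E] [NormedSpace ℂ E]
    {ν ν' : D.CStar →L[ℂ] E}
    (h : ∀ h : D.L1, D.IsSchwartz h → ν (h : D.CStar) = ν' (h : D.CStar)) : ν = ν' := by
  refine ContinuousLinearMap.coeFn_injective
    (Continuous.ext_on D.dense_isSchwartz ν.continuous ν'.continuous ?_)
  rintro _ ⟨f, hf, rfl⟩
  exact h f hf

/-- For Schwartz `h` the operator is a norm integral of compact operators, hence compact. Norm
limits preserve compactness, and Schwartz elements are dense. -/
theorem RadicalFamily.isCompactOperator_integralMap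
    (hF : ∀ (h : D.L1) q, ι (F (h : D.CStar) q) = D.repOp (R.rep q) h)
    (hV : IsCoherent c V) (hμ : ∀ φ : C₀(Eucl n × Eucl n, A),
      IsWeakIntegral (μ φ) (coherentIntegrand c V fun q => ι (φ q)) ∧ ‖μ φ‖ ≤ ‖φ‖)
    (hι : ∀ a, IsCompactOperator (ι a)) (a : D.CStar) : IsCompactOperator (μ (F a)) := by
  have hcl : IsClosed {a : D.CStar | IsCompactOperator (μ (F a))} :=
    isClosed_setOfPred_isCompactOperator.preimage (μ.continuous.comp F.continuous)
  refine hcl.closure_subset_iff.2 ?_ (D.dense_isSchwartz a)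
  rintro _ ⟨h, hh, rfl⟩
  change IsCompactOperator (μ (F (h : D.CStar)))
  rw [R.integralMap_eq_integral hF hV hμ hh]
  exact isCompactOperator_integral (fun q => isCompactOperator_coherentIntegrand c V (hι _))

/-- The Fourier transform intertwines the involution with pointwise adjoints, which pass through the
weak integral; uniqueness identifies the two operators. -/
theorem RadicalFamily.adjoint_integralMap
    (hF : ∀ (h : D.L1) q, ι (F (h : D.CStar) q) = D.repOp (R.rep q) h)
    (hμ : ∀ φ : C₀(Eucl n × Eucl n, A),
      IsWeakIntegral (μ φ) (coherentIntegrand c V fun q => ι (φ q)) ∧ ‖μ φ‖ ≤ ‖φ‖)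
    (a : D.CStar) :
    ContinuousLinearMap.adjoint (μ (F a)) = μ (F (D.starC a)) :=
  (IsCoherent.isWeakIntegral_adjoint (fun q => adjoint_fourier_eq R ι hF a q) (hμ (F a)).1).unique
    (hμ _).1

end CoherentRep

/-! ### Wave packets: normalization and continuity. -/

/-- On a sphere `‖u x - u x₀‖²` is determined by the inner product of the two vectors, so continuity
of inner products gives norm continuity. -/
theorem continuous_of_continuous_inner {X H : Type*} [TopologicalSpace X] [NormedAddCommGroup H]
    [InnerProductSpace ℂ H] {u : X → H} {N : ℝ} (hN : ∀ x, ‖u x‖ = N)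
    (hc : ∀ x₀, Continuous fun x => inner ℂ (u x₀) (u x)) : Continuous u := by
  refine continuous_iff_continuousAt.2 fun x₀ => ?_
  rw [ContinuousAt, tendsto_iff_norm_sub_tendsto_zero]
  have h3 : ∀ x, ‖u x - u x₀‖ = √(N ^ 2 + N ^ 2 - 2 * RCLike.re (inner ℂ (u x₀) (u x))) :=
    fun x => by
      rw [← Real.sqrt_sq (norm_nonneg (u x - u x₀)), norm_sub_sq (𝕜 := ℂ), hN, hN, inner_re_symm]
      congr 1
      ring
  simp only [h3]
  have h4 : Continuous fun x => √(N ^ 2 + N ^ 2 - 2 * RCLike.re (inner ℂ (u x₀) (u x))) :=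
    Real.continuous_sqrt.comp (continuous_const.sub (continuous_const.mul
      (RCLike.continuous_re.comp (hc x₀))))
  have h5 := h4.tendsto x₀
  rw [inner_self_eq_norm_sq_to_K, hN, ← RCLike.ofReal_pow, RCLike.ofReal_re] at h5
  convert h5 using 2
  rw [eq_comm, Real.sqrt_eq_zero']
  linarith

theorem inner_eq_integral_of_ae_eq {X : Type} [MeasureSpace X] {f f' : L2 X} {u u' : X → ℂ}
    (h : f =ᵐ[volume] u) (h' : f' =ᵐ[volume] u') :
    inner ℂ f f' = ∫ x, (starRingEnd ℂ) (u x) * u' x := by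
  rw [L2.inner_def]
  refine integral_congr_ae ?_
  filter_upwards [h, h'] with x hx hx'
  rw [hx, hx', RCLike.inner_apply, mul_comm]

section Packet

/-- The one-dimensional factor `|a|^{1/4} η(|a|^{1/2} (s + β / a))` of a wave packet. -/
def packetFactor (a : ℝ) (η : 𝓢(ℝ, ℂ)) (β s : ℝ) : ℂ :=
  ((|a| ^ (1 / 4 : ℝ) : ℝ) : ℂ) * η (|a| ^ (1 / 2 : ℝ) * (s + β / a))

theorem continuous_packetFactor (a : ℝ) (η : 𝓢(ℝ, ℂ)) :
    Continuous fun z : ℝ × ℝ => packetFactor a η z.1 z.2 :=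
  continuous_const.mul (η.continuous.comp (by fun_prop))

theorem exists_norm_packetFactor_le (a : ℝ) (η : 𝓢(ℝ, ℂ)) :
    ∃ M, 0 ≤ M ∧ ∀ β s, ‖packetFactor a η β s‖ ≤ M := by
  obtain ⟨C, hC⟩ := η.decay 0 0
  refine ⟨‖((|a| ^ (1 / 4 : ℝ) : ℝ) : ℂ)‖ * C, mul_nonneg (norm_nonneg _) hC.1.le,
    fun β s => ?_⟩
  rw [packetFactor, norm_mul]
  refine mul_le_mul_of_nonneg_left ?_ (norm_nonneg _)
  simpa using hC.2 (|a| ^ (1 / 2 : ℝ) * (s + β / a))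

theorem norm_packetFactor_sq (a : ℝ) (η : 𝓢(ℝ, ℂ)) (β s : ℝ) :
    ‖packetFactor a η β s‖ ^ 2 =
      |a| ^ (1 / 2 : ℝ) * ‖η (|a| ^ (1 / 2 : ℝ) * (s + β / a))‖ ^ 2 := by
  rw [packetFactor, norm_mul, mul_pow, Complex.norm_real,
    Real.norm_of_nonneg (Real.rpow_nonneg (abs_nonneg _) _), ← Real.rpow_natCast,
    ← Real.rpow_mul (abs_nonneg _)]
  norm_num

theorem integrable_norm_sq_schwartz (η : 𝓢(ℝ, ℂ)) : Integrable fun t => ‖η t‖ ^ 2 :=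
  (memLp_two_iff_integrable_sq_norm η.continuous.aestronglyMeasurable).1 (η.memLp 2 volume)

theorem rpow_half_abs_ne_zero {a : ℝ} (ha : a ≠ 0) : |a| ^ (1 / 2 : ℝ) ≠ 0 :=
  (Real.rpow_pos_of_pos (abs_pos.2 ha) _).ne'

theorem integrable_packetFactor {a : ℝ} (ha : a ≠ 0) (η : 𝓢(ℝ, ℂ)) (β : ℝ) :
    Integrable (packetFactor a η β) :=
  (((η.integrable (μ := volume)).comp_mul_left' (rpow_half_abs_ne_zero ha)).comp_add_right
    (β / a)).const_mul _

theorem integrable_norm_packetFactor_sq_left {a : ℝ} (ha : a ≠ 0) (η : 𝓢(ℝ, ℂ)) (s : ℝ) :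
    Integrable fun β => ‖packetFactor a η β s‖ ^ 2 := by
  simp only [norm_packetFactor_sq]
  have h := ((integrable_norm_sq_schwartz η).comp_mul_left'
    (rpow_half_abs_ne_zero ha)).comp_add_left s
  exact (h.comp_div ha).const_mul _

theorem integral_norm_packetFactor_sq {a : ℝ} (ha : a ≠ 0) {η : 𝓢(ℝ, ℂ)}
    (hη : ∫ t, ‖η t‖ ^ 2 = 1) (β : ℝ) : ∫ s, ‖packetFactor a η β s‖ ^ 2 = 1 := by
  simp only [norm_packetFactor_sq]
  rw [integral_const_mul, integral_add_right_eq_self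
    (fun s => ‖η (|a| ^ (1 / 2 : ℝ) * s)‖ ^ 2),
    Measure.integral_comp_mul_left (fun s => ‖η s‖ ^ 2), hη, smul_eq_mul, mul_one, abs_inv,
    abs_of_nonneg (Real.rpow_nonneg (abs_nonneg _) _)]
  exact mul_inv_cancel₀ (rpow_half_abs_ne_zero ha)

/-- The source of the weight in `ν_k`: the substitution in `β / a` contributes `|a|`, while the
dilation contributes `|a|^(-1/2)` and cancels the prefactor `|a|^(1/2)`. -/
theorem integral_norm_packetFactor_sq_left {a : ℝ} (ha : a ≠ 0) {η : 𝓢(ℝ, ℂ)}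
    (hη : ∫ t, ‖η t‖ ^ 2 = 1) (s : ℝ) : ∫ β, ‖packetFactor a η β s‖ ^ 2 = |a| := by
  simp only [norm_packetFactor_sq]
  rw [integral_const_mul, Measure.integral_comp_div
    (fun b => ‖η (|a| ^ (1 / 2 : ℝ) * (s + b))‖ ^ 2), integral_add_left_eq_self
    (fun s => ‖η (|a| ^ (1 / 2 : ℝ) * s)‖ ^ 2),
    Measure.integral_comp_mul_left (fun s => ‖η s‖ ^ 2), hη, smul_eq_mul, smul_eq_mul, mul_one,
    abs_inv, abs_of_nonneg (Real.rpow_nonneg (abs_nonneg _) _), mul_left_comm,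
    mul_inv_cancel₀ (rpow_half_abs_ne_zero ha), mul_one]

theorem integrable_eucl_prod {n : ℕ} {E : Fin n → ℝ → ℝ} (hE : ∀ j, Integrable (E j)) :
    Integrable fun s : Eucl n => ∏ j, E j (s j) :=
  (EuclideanSpace.volume_preserving_symm_measurableEquiv_toLp
    (Fin n)).integrable_comp_of_integrable (Integrable.fintype_prod hE)

theorem integral_eucl_prod {n : ℕ} (E : Fin n → ℝ → ℝ) :
    ∫ s : Eucl n, ∏ j, E j (s j) = ∏ j, ∫ t, E j t := by
  rw [← integral_fintype_prod_volume_eq_prod]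
  exact (EuclideanSpace.volume_preserving_symm_measurableEquiv_toLp (Fin n)).integral_comp
    (MeasurableEquiv.measurableEmbedding _) (fun s : Fin n → ℝ => ∏ j, E j (s j))

variable {n : ℕ}

/-- The modulus part of a wave packet. -/
def envelope (a : Fin n → ℝ) (η : Fin n → 𝓢(ℝ, ℂ)) (β s : Eucl n) : ℂ :=
  ∏ j, packetFactor (a j) (η j) (β j) (s j)

theorem packet_eq (a : Fin n → ℝ) (η : Fin n → 𝓢(ℝ, ℂ)) (q : Eucl n × Eucl n) (s : Eucl n) :
    packet a η q s = Complex.exp (2 * Real.pi * Complex.I * ((∑ j, q.1 j * s j : ℝ) : ℂ)) *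
      envelope a η q.2 s := rfl

theorem continuous_envelope (a : Fin n → ℝ) (η : Fin n → 𝓢(ℝ, ℂ)) :
    Continuous fun z : Eucl n × Eucl n => envelope a η z.1 z.2 :=
  continuous_finsetProd _ fun j _ => (continuous_packetFactor (a j) (η j)).comp
    (g := fun z : ℝ × ℝ => packetFactor (a j) (η j) z.1 z.2)
    (f := fun z : Eucl n × Eucl n => (z.1 j, z.2 j)) (by fun_prop)

theorem continuous_packet (a : Fin n → ℝ) (η : Fin n → 𝓢(ℝ, ℂ)) :
    Continuous fun z : (Eucl n × Eucl n) × Eucl n => packet a η z.1 z.2 := by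
  simp only [packet_eq]
  refine Continuous.mul (by fun_prop) ((continuous_envelope a η).comp
    (f := fun z : (Eucl n × Eucl n) × Eucl n => (z.1.2, z.2)) (by fun_prop))

theorem norm_packet (a : Fin n → ℝ) (η : Fin n → 𝓢(ℝ, ℂ)) (q : Eucl n × Eucl n) (s : Eucl n) :
    ‖packet a η q s‖ = ‖envelope a η q.2 s‖ := by
  rw [packet_eq, norm_mul, Complex.norm_exp]
  simp

theorem exists_norm_packet_le (a : Fin n → ℝ) (η : Fin n → 𝓢(ℝ, ℂ)) :
    ∃ M, ∀ q s, ‖packet a η q s‖ ≤ M := by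
  choose M hM0 hM using fun j => exists_norm_packetFactor_le (a j) (η j)
  refine ⟨∏ j, M j, fun q s => ?_⟩
  rw [norm_packet, envelope, norm_prod]
  exact Finset.prod_le_prod (fun _ _ => norm_nonneg _) fun j _ => hM j _ _

theorem integrable_packet {a : Fin n → ℝ} (ha : ∀ j, a j ≠ 0) (η : Fin n → 𝓢(ℝ, ℂ))
    (q : Eucl n × Eucl n) : Integrable (packet a η q) := by
  have h : Continuous (packet a η q) := (continuous_packet a η).comp
    (f := fun s => (q, s)) (by fun_prop)
  rw [← integrable_norm_iff h.aestronglyMeasurable]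
  simp only [norm_packet, envelope, norm_prod]
  exact integrable_eucl_prod (E := fun j t => ‖packetFactor (a j) (η j) (q.2 j) t‖)
    fun j => (integrable_packetFactor (ha j) (η j) _).norm

theorem lintegral_enorm_envelope_sq {a : Fin n → ℝ} (ha : ∀ j, a j ≠ 0) {η : Fin n → 𝓢(ℝ, ℂ)}
    (hη : ∀ j, ∫ t, ‖η j t‖ ^ 2 = 1) (s : Eucl n) :
    ∫⁻ β, ‖envelope a η β s‖ₑ ^ 2 = ENNReal.ofReal (∏ j, |a j|) := by
  have h1 : ∀ β, ‖envelope a η β s‖ₑ ^ 2 =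
      ENNReal.ofReal (∏ j, ‖packetFactor (a j) (η j) (β j) (s j)‖ ^ 2) := fun β => by
    rw [Finset.prod_pow, ← norm_prod, ENNReal.ofReal_pow (norm_nonneg _), ofReal_norm]
    rfl
  simp only [h1]
  rw [← ofReal_integral_eq_lintegral_ofReal (integrable_eucl_prod
    (E := fun j t => ‖packetFactor (a j) (η j) t (s j)‖ ^ 2)
    fun j => integrable_norm_packetFactor_sq_left (ha j) (η j) _)
    (Eventually.of_forall fun β => Finset.prod_nonneg fun _ _ => sq_nonneg _),
    integral_eucl_prod (fun j t => ‖packetFactor (a j) (η j) t (s j)‖ ^ 2)]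
  simp only [fun j => integral_norm_packetFactor_sq_left (ha j) (hη j) (s j)]

theorem norm_packetL2 {a : Fin n → ℝ} (ha : ∀ j, a j ≠ 0) {η : Fin n → 𝓢(ℝ, ℂ)}
    (hη : ∀ j, ∫ t, ‖η j t‖ ^ 2 = 1) (q : Eucl n × Eucl n) : ‖packetL2 a η q‖ = 1 := by
  have h1 : ((‖packetL2 a η q‖ ^ 2 : ℝ) : ℂ) = 1 := by
    have h := inner_self_eq_norm_sq_to_K (𝕜 := ℂ) (packetL2 a η q)
    rw [L2.inner_def] at h
    push_cast
    refine h.symm.trans ?_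
    have h2 : ∫ s, inner ℂ (packetL2 a η q s) (packetL2 a η q s) =
        ∫ s : Eucl n, ((∏ j, ‖packetFactor (a j) (η j) (q.2 j) (s j)‖ ^ 2 : ℝ) : ℂ) := by
      refine integral_congr_ae ?_
      filter_upwards [(memLp_packet a η q).coeFn_toLp] with s hs
      change packetL2 a η q s = _ at hs
      rw [hs, inner_self_eq_norm_sq_to_K, norm_packet, Finset.prod_pow, ← norm_prod]
      simp [envelope]
    rw [h2, integral_complex_ofReal,
      integral_eucl_prod (fun j t => ‖packetFactor (a j) (η j) (q.2 j) t‖ ^ 2)]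
    simp only [fun j => integral_norm_packetFactor_sq (ha j) (hη j) (q.2 j)]
    simp
  have h2 : ‖packetL2 a η q‖ ^ 2 = 1 := by exact_mod_cast h1
  exact (sq_eq_sq₀ (norm_nonneg _) zero_le_one).1 (h2.trans (one_pow 2).symm)

theorem inner_packetL2 (a : Fin n → ℝ) (η : Fin n → 𝓢(ℝ, ℂ)) (q : Eucl n × Eucl n)
    (f : L2 (Eucl n)) :
    inner ℂ (packetL2 a η q) f = ∫ s, (starRingEnd ℂ) (packet a η q s) * f s :=
  inner_eq_integral_of_ae_eq (memLp_packet a η q).coeFn_toLp (ae_eq_refl _)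

theorem continuous_packetL2 {a : Fin n → ℝ} (ha : ∀ j, a j ≠ 0) {η : Fin n → 𝓢(ℝ, ℂ)}
    (hη : ∀ j, ∫ t, ‖η j t‖ ^ 2 = 1) : Continuous (packetL2 a η) := by
  obtain ⟨M, hM⟩ := exists_norm_packet_le a η
  have hpk := continuous_packet a η
  have hc : ∀ q₀, Continuous fun q => inner ℂ (packetL2 a η q₀) (packetL2 a η q) := fun q₀ => by
    have h1 : ∀ q, inner ℂ (packetL2 a η q₀) (packetL2 a η q) =
        ∫ s, (starRingEnd ℂ) (packet a η q₀ s) * packet a η q s := fun q =>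
      inner_eq_integral_of_ae_eq (memLp_packet a η q₀).coeFn_toLp (memLp_packet a η q).coeFn_toLp
    simp only [h1]
    have h2 : ∀ q, Continuous (packet a η q) := fun q => hpk.comp
      (f := fun s => (q, s)) (by fun_prop)
    refine continuous_of_dominated (bound := fun s => ‖packet a η q₀ s‖ * M) (fun q => ?_)
      (fun q => Eventually.of_forall fun s => ?_) ((integrable_packet ha η q₀).norm.mul_const M)
      (Eventually.of_forall fun s => ?_)
    · exact ((Complex.continuous_conj.comp (h2 q₀)).mul (h2 q)).aestronglyMeasurable
    · rw [norm_mul, RCLike.norm_conj]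
      exact mul_le_mul_of_nonneg_left (hM q s) (norm_nonneg _)
    · exact continuous_const.mul (hpk.comp (f := fun q => (q, s)) (by fun_prop))
  exact continuous_of_continuous_inner (norm_packetL2 ha hη) hc

end Packet

/-! ### The Bessel inequality for wave packets. -/

section Bessel

open scoped FourierTransform

variable {n : ℕ}

theorem hasTemperateGrowth_envelope (a : Fin n → ℝ) (η : Fin n → 𝓢(ℝ, ℂ)) (β : Eucl n) :
    (fun s => (starRingEnd ℂ) (envelope a η β s)).HasTemperateGrowth := by
  have h1 : ∀ j, (fun s : Eucl n =>
      packetFactor (a j) (η j) (β j) (s j)).HasTemperateGrowth := fun j => by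
    have h2 : (fun s : Eucl n =>
        |a j| ^ (1 / 2 : ℝ) * (s j + β j / a j)).HasTemperateGrowth :=
      (Function.HasTemperateGrowth.const _).mul
        ((EuclideanSpace.proj j : Eucl n →L[ℝ] ℝ).hasTemperateGrowth.add
          (Function.HasTemperateGrowth.const _))
    exact (Function.HasTemperateGrowth.const _).mul ((η j).hasTemperateGrowth.comp h2)
  have h3 : ∀ t : Finset (Fin n), (fun s : Eucl n =>
      ∏ j ∈ t, packetFactor (a j) (η j) (β j) (s j)).HasTemperateGrowth := fun t => by
    induction t using Finset.induction_on with
    | empty => simp only [Finset.prod_empty]; exact Function.HasTemperateGrowth.const (1 : ℂ)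
    | insert i t hi ih =>
      simp only [Finset.prod_insert hi]
      exact (h1 i).mul ih
  exact Complex.conjCLE.toContinuousLinearMap.hasTemperateGrowth.comp (h3 Finset.univ)

theorem lintegral_enorm_sq_fourier (f : 𝓢(Eucl n, ℂ)) :
    ∫⁻ α, ‖𝓕 f α‖ₑ ^ 2 = ∫⁻ s, ‖f s‖ₑ ^ 2 := by
  have h : ∀ f : 𝓢(Eucl n, ℂ), ∫⁻ s, ‖f s‖ₑ ^ 2 = ENNReal.ofReal (∫ s, ‖f s‖ ^ 2) := fun f => by
    rw [ofReal_integral_eq_lintegral_ofReal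
      ((memLp_two_iff_integrable_sq_norm f.continuous.aestronglyMeasurable).1 (f.memLp 2 volume))
      (Eventually.of_forall fun _ => sq_nonneg _)]
    simp only [ENNReal.ofReal_pow (norm_nonneg _), ofReal_norm]
  rw [h, h, SchwartzMap.integral_norm_sq_fourier]

/-- For fixed `β` the plane wave in the packet is a Fourier kernel in `α`, so Plancherel becomes
available for the coefficients. -/
theorem inner_packetL2_schwartz (a : Fin n → ℝ) (η : Fin n → 𝓢(ℝ, ℂ)) (q : Eucl n × Eucl n)
    (f : 𝓢(Eucl n, ℂ)) : inner ℂ (packetL2 a η q) (f.toLp 2) =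
      𝓕 (SchwartzMap.smulLeftCLM ℂ (fun s => (starRingEnd ℂ) (envelope a η q.2 s)) f) q.1 := by
  rw [inner_packetL2, SchwartzMap.fourier_coe, Real.fourier_eq']
  refine integral_congr_ae ?_
  filter_upwards [f.coeFn_toLp 2 volume] with s hs
  rw [hs, SchwartzMap.smulLeftCLM_apply_apply (hasTemperateGrowth_envelope a η q.2), packet_eq,
    map_mul, ← Complex.exp_conj, smul_eq_mul, smul_eq_mul, mul_assoc]
  congr 2
  simp only [map_mul, Complex.conj_ofReal, Complex.conj_I, Complex.conj_ofNat,
    EuclideanSpace.inner_eq_star_dotProduct, dotProduct]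
  simp [mul_comm]
  ring

/-- Plancherel in `α` removes the modulation; Tonelli then leaves the `β`-integral of the squared
envelope, which does not depend on `s`. -/
theorem lintegral_enorm_inner_packetL2_schwartz {a : Fin n → ℝ} (ha : ∀ j, a j ≠ 0)
    {η : Fin n → 𝓢(ℝ, ℂ)} (hη : ∀ j, ∫ t, ‖η j t‖ ^ 2 = 1) (f : 𝓢(Eucl n, ℂ)) :
    ∫⁻ q, ‖inner ℂ (packetL2 a η q) (f.toLp 2)‖ₑ ^ 2 =
      ENNReal.ofReal (∏ j, |a j|) * ‖f.toLp 2 (volume : Measure (Eucl n))‖ₑ ^ 2 := by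
  have hc := continuous_packetL2 ha hη
  have hm : Measurable fun q => ‖inner ℂ (packetL2 a η q) (f.toLp 2)‖ₑ ^ 2 :=
    Continuous.measurable (by fun_prop)
  rw [Measure.volume_eq_prod, lintegral_prod_symm' _ hm]
  have h1 : ∀ β, ∫⁻ α, ‖inner ℂ (packetL2 a η (α, β)) (f.toLp 2)‖ₑ ^ 2 =
      ∫⁻ s, ‖envelope a η β s‖ₑ ^ 2 * ‖f s‖ₑ ^ 2 := fun β => by
    simp only [inner_packetL2_schwartz]
    rw [lintegral_enorm_sq_fourier]
    refine lintegral_congr fun s => ?_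
    rw [SchwartzMap.smulLeftCLM_apply_apply (hasTemperateGrowth_envelope a η β), enorm_smul,
      mul_pow, ← ofReal_norm, RCLike.norm_conj, ofReal_norm]
  simp only [h1]
  rw [lintegral_lintegral_swap]
  · have h2 : ∀ s, ∫⁻ β, ‖envelope a η β s‖ₑ ^ 2 * ‖f s‖ₑ ^ 2 =
        ENNReal.ofReal (∏ j, |a j|) * ‖f s‖ₑ ^ 2 := fun s => by
      rw [lintegral_mul_const' _ _ (by finiteness), lintegral_enorm_envelope_sq ha hη]
    simp only [h2]
    rw [lintegral_const_mul' _ _ ENNReal.ofReal_ne_top]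
    congr 1
    rw [Lp.enorm_def, eLpNorm_congr_ae (f.coeFn_toLp 2 volume),
      eLpNorm_eq_lintegral_rpow_enorm_toReal two_ne_zero ENNReal.ofNat_ne_top]
    rw [← ENNReal.rpow_natCast, ← ENNReal.rpow_mul]
    simp
  · have h3 := continuous_envelope a η
    have h4 := f.continuous
    exact Continuous.aemeasurable (by
      change Continuous fun z : Eucl n × Eucl n => ‖envelope a η z.1 z.2‖ₑ ^ 2 * ‖f z.2‖ₑ ^ 2
      have h5 : Continuous fun z : Eucl n × Eucl n =>
          (‖envelope a η z.1 z.2‖ ^ 2) * ‖f z.2‖ ^ 2 := by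
        fun_prop
      refine (ENNReal.continuous_ofReal.comp h5).congr fun z => ?_
      simp only [Function.comp]
      rw [ENNReal.ofReal_mul (by positivity), ENNReal.ofReal_pow (norm_nonneg _),
        ENNReal.ofReal_pow (norm_nonneg _), ofReal_norm, ofReal_norm])

/-- Fatou's lemma carries the identity for Schwartz functions over to `L²` as an inequality, which
is all that `IsCoherent` asks for. -/
theorem lintegral_enorm_inner_packetL2_le {a : Fin n → ℝ} (ha : ∀ j, a j ≠ 0)
    {η : Fin n → 𝓢(ℝ, ℂ)} (hη : ∀ j, ∫ t, ‖η j t‖ ^ 2 = 1) (f : L2 (Eucl n)) :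
    ∫⁻ q, ‖inner ℂ (packetL2 a η q) f‖ₑ ^ 2 ≤ ENNReal.ofReal (∏ j, |a j|) * ‖f‖ₑ ^ 2 := by
  have hc := continuous_packetL2 ha hη
  obtain ⟨F, hF, hlim⟩ := mem_closure_iff_seq_limit.1
    (SchwartzMap.denseRange_toLpCLM (F := ℂ) (E := Eucl n) (p := 2) (μ := volume)
      ENNReal.ofNat_ne_top f)
  choose φ hφ using hF
  have hφ' : ∀ k, (φ k).toLp 2 (volume : Measure (Eucl n)) = F k := hφ
  have h1 : ∀ q, Tendsto (fun k => ‖inner ℂ (packetL2 a η q) (F k)‖ₑ ^ 2) atTop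
      (𝓝 (‖inner ℂ (packetL2 a η q) f‖ₑ ^ 2)) := fun q =>
    ENNReal.Tendsto.pow ((continuous_enorm.tendsto _).comp
      (tendsto_const_nhds.inner hlim))
  have h2 : Tendsto (fun k => ENNReal.ofReal (∏ j, |a j|) * ‖F k‖ₑ ^ 2) atTop
      (𝓝 (ENNReal.ofReal (∏ j, |a j|) * ‖f‖ₑ ^ 2)) :=
    ENNReal.Tendsto.const_mul (ENNReal.Tendsto.pow ((continuous_enorm.tendsto _).comp hlim))
      (Or.inr ENNReal.ofReal_ne_top)
  calc ∫⁻ q, ‖inner ℂ (packetL2 a η q) f‖ₑ ^ 2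
      = ∫⁻ q, liminf (fun k => ‖inner ℂ (packetL2 a η q) (F k)‖ₑ ^ 2) atTop :=
        lintegral_congr fun q => (h1 q).liminf_eq.symm
    _ ≤ liminf (fun k => ∫⁻ q, ‖inner ℂ (packetL2 a η q) (F k)‖ₑ ^ 2) atTop :=
        lintegral_liminf_le fun k => Continuous.measurable (by fun_prop)
    _ = liminf (fun k => ENNReal.ofReal (∏ j, |a j|) * ‖F k‖ₑ ^ 2) atTop := by
        congr 1
        funext k
        rw [← hφ' k, lintegral_enorm_inner_packetL2_schwartz ha hη]
    _ = _ := h2.liminf_eq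

end Bessel

/-! ### The two coherent families: packets and tensoring with packets. -/

section CoherentFamilies

theorem IsCoherent.of_lintegral_le {Q K H : Type*} [TopologicalSpace Q] [MeasureSpace Q]
    [OpensMeasurableSpace Q] [SecondCountableTopology Q] [NormedAddCommGroup K]
    [InnerProductSpace ℂ K] [CompleteSpace K] [NormedAddCommGroup H] [InnerProductSpace ℂ H]
    [CompleteSpace H] {C : ℝ} (hC : 0 < C) {V : Q → (K →L[ℂ] H)} (hc : Continuous V)
    (hb : ∃ M, ∀ q, ‖V q‖ ≤ M)
    (h : ∀ ξ, ∫⁻ q, ‖ContinuousLinearMap.adjoint (V q) ξ‖ₑ ^ 2 ≤ ENNReal.ofReal C * ‖ξ‖ₑ ^ 2) :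
    IsCoherent C⁻¹ V := by
  have hadj : Continuous fun q => ContinuousLinearMap.adjoint (V q) :=
    ContinuousLinearMap.adjoint.continuous.comp hc
  have h1 : ∀ ξ, ∫⁻ q, ENNReal.ofReal (‖ContinuousLinearMap.adjoint (V q) ξ‖ ^ 2) ≤
      ENNReal.ofReal (C * ‖ξ‖ ^ 2) := fun ξ => by
    rw [ENNReal.ofReal_mul hC.le, ENNReal.ofReal_pow (norm_nonneg _), ofReal_norm]
    simpa only [ENNReal.ofReal_pow (norm_nonneg _), ofReal_norm] using h ξ
  have h2 : ∀ ξ, Integrable fun q => ‖ContinuousLinearMap.adjoint (V q) ξ‖ ^ 2 := fun ξ => by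
    have hm : Continuous fun q => ‖ContinuousLinearMap.adjoint (V q) ξ‖ ^ 2 := by fun_prop
    refine ⟨hm.aestronglyMeasurable, ?_⟩
    rw [hasFiniteIntegral_iff_ofReal (Eventually.of_forall fun _ => sq_nonneg _)]
    exact (h1 ξ).trans_lt ENNReal.ofReal_lt_top
  refine ⟨(inv_pos.2 hC).le, hc, hb, h2, fun ξ => ?_⟩
  have h3 := h1 ξ
  rw [← ofReal_integral_eq_lintegral_ofReal (h2 ξ) (Eventually.of_forall fun _ => sq_nonneg _),
    ENNReal.ofReal_le_ofReal_iff (by positivity)] at h3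
  rwa [inv_mul_le_iff₀ hC]

/-- The operator `z ↦ z η`. -/
def spanOp {H : Type*} [NormedAddCommGroup H] [InnerProductSpace ℂ H] [CompleteSpace H] (η : H) :
    ℂ →L[ℂ] H := ContinuousLinearMap.adjoint (innerSL ℂ η)

theorem adjoint_spanOp {H : Type*} [NormedAddCommGroup H] [InnerProductSpace ℂ H]
    [CompleteSpace H] (η ξ : H) : ContinuousLinearMap.adjoint (spanOp η) ξ = inner ℂ η ξ := by
  rw [spanOp, ContinuousLinearMap.adjoint_adjoint, innerSL_apply_apply]

theorem spanOp_apply {H : Type*} [NormedAddCommGroup H] [InnerProductSpace ℂ H]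
    [CompleteSpace H] (η : H) (z : ℂ) : spanOp η z = z • η := by
  refine ext_inner_left ℂ fun ψ => ?_
  rw [spanOp, ContinuousLinearMap.adjoint_inner_right, innerSL_apply_apply, inner_smul_right,
    RCLike.inner_apply, inner_conj_symm]

theorem isCoherent_packet {n : ℕ} {a : Fin n → ℝ} (ha : ∀ j, a j ≠ 0) {η : Fin n → 𝓢(ℝ, ℂ)}
    (hη : ∀ j, ∫ t, ‖η j t‖ ^ 2 = 1) :
    IsCoherent (∏ j, |a j|)⁻¹ fun q => spanOp (packetL2 a η q) := by
  refine IsCoherent.of_lintegral_le (Finset.prod_pos fun j _ => abs_pos.2 (ha j)) ?_ ⟨1, ?_⟩ ?_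
  · exact ContinuousLinearMap.adjoint.continuous.comp
      ((innerSL ℂ (E := L2 (Eucl n))).continuous.comp (continuous_packetL2 ha hη))
  · intro q
    rw [spanOp, LinearIsometryEquiv.norm_map, innerSL_apply_norm, norm_packetL2 ha hη]
  · intro ξ
    simp only [adjoint_spanOp]
    exact lintegral_enorm_inner_packetL2_le ha hη ξ

theorem coherentIntegrand_spanOp {Q H : Type*} [NormedAddCommGroup H] [InnerProductSpace ℂ H]
    [CompleteSpace H] (c : ℝ) (η : Q → H) (φ : Q → ℂ) (q : Q) :
    coherentIntegrand c (fun q => spanOp (η q))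
      (fun q => φ q • ContinuousLinearMap.id ℂ ℂ) q = (c : ℂ) • φ q • proj (η q) := by
  ext ξ
  simp [coherentIntegrand, adjoint_spanOp, spanOp_apply, proj, smul_smul]

section Tensor

variable {X Y : Type} [MeasureSpace X] [MeasureSpace Y] [SigmaFinite (volume : Measure X)]
  [SigmaFinite (volume : Measure Y)]

theorem norm_tensor (ξ : L2 X) (η : L2 Y) : ‖tensor ξ η‖ = ‖ξ‖ * ‖η‖ := by
  have h := inner_tensor ξ ξ η η
  rw [inner_self_eq_norm_sq_to_K, inner_self_eq_norm_sq_to_K, inner_self_eq_norm_sq_to_K] at h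
  have h' : ‖tensor ξ η‖ ^ 2 = (‖ξ‖ * ‖η‖) ^ 2 := by
    rw [mul_pow]; exact_mod_cast h
  exact (sq_eq_sq₀ (norm_nonneg _) (by positivity)).1 h'

/-- `η ↦ ξ ⊗ η`. -/
def tensorLeft (ξ : L2 X) : L2 Y →L[ℂ] L2 (X × Y) :=
  LinearMap.mkContinuous
    { toFun := fun η => tensor ξ η
      map_add' := fun η η' => by
        refine Lp.ext ?_
        have h := (Measure.quasiMeasurePreserving_snd
          (μ := (volume : Measure X)) (ν := (volume : Measure Y))).ae (Lp.coeFn_add η η')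
        filter_upwards [(memLp_tensor ξ (η + η')).coeFn_toLp, (memLp_tensor ξ η).coeFn_toLp,
          (memLp_tensor ξ η').coeFn_toLp, Lp.coeFn_add (tensor ξ η) (tensor ξ η'), h]
          with z h1 h2 h3 h4 h5
        rw [h4, Pi.add_apply]
        simp only [tensor]
        rw [h1, h2, h3, h5, Pi.add_apply, mul_add]
      map_smul' := fun c η => by
        refine Lp.ext ?_
        have h := (Measure.quasiMeasurePreserving_snd
          (μ := (volume : Measure X)) (ν := (volume : Measure Y))).ae (Lp.coeFn_smul c η)
        filter_upwards [(memLp_tensor ξ (c • η)).coeFn_toLp, (memLp_tensor ξ η).coeFn_toLp,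
          Lp.coeFn_smul c (tensor ξ η), h] with z h1 h2 h3 h4
        simp only [RingHom.id_apply]
        rw [h3, Pi.smul_apply]
        simp only [tensor]
        rw [h1, h2, h4, Pi.smul_apply, smul_eq_mul, smul_eq_mul, mul_left_comm] }
    ‖ξ‖ (fun η => le_of_eq (norm_tensor ξ η))

theorem tensorLeft_apply (ξ : L2 X) (η : L2 Y) : tensorLeft ξ η = tensor ξ η := rfl

theorem norm_tensorRight_le (η : L2 Y) : ‖(tensorRight η : L2 X →L[ℂ] L2 (X × Y))‖ ≤ ‖η‖ :=
  LinearMap.mkContinuous_norm_le _ (norm_nonneg _) _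

theorem tensorRight_sub (η η' : L2 Y) :
    (tensorRight (η - η') : L2 X →L[ℂ] L2 (X × Y)) = tensorRight η - tensorRight η' :=
  ContinuousLinearMap.ext fun ξ => map_sub (tensorLeft ξ) η η'

theorem continuous_tensorRight :
    Continuous (tensorRight : L2 Y → (L2 X →L[ℂ] L2 (X × Y))) := by
  refine (LipschitzWith.of_dist_le_mul (K := 1) fun η η' => ?_).continuous
  rw [dist_eq_norm, dist_eq_norm, ← tensorRight_sub, NNReal.coe_one, one_mul]
  exact norm_tensorRight_le _

/-- Bessel's inequality for partial inner products in the first variable. With `x = ∑ e_i ⊗ f_i`,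
both `⟨x, ξ⟩` and `‖x‖²` equal the sum in question, and Cauchy-Schwarz finishes. -/
theorem sum_norm_adjoint_tensorLeft_sq_le {ι : Type*} {e : ι → L2 X} (he : Orthonormal ℂ e)
    (s : Finset ι) (ξ : L2 (X × Y)) :
    ∑ i ∈ s, ‖ContinuousLinearMap.adjoint (tensorLeft (Y := Y) (e i)) ξ‖ ^ 2 ≤ ‖ξ‖ ^ 2 := by
  classical
  set f : ι → L2 Y := fun i => ContinuousLinearMap.adjoint (tensorLeft (e i)) ξ with hf
  set t := ∑ i ∈ s, ‖f i‖ ^ 2 with ht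
  set x := ∑ i ∈ s, tensor (e i) (f i) with hx
  have h1 : inner ℂ x ξ = (t : ℂ) := by
    rw [hx, sum_inner, ht, Complex.ofReal_sum]
    refine Finset.sum_congr rfl fun i _ => ?_
    rw [← tensorLeft_apply, ← ContinuousLinearMap.adjoint_inner_right, inner_self_eq_norm_sq_to_K]
    simp
  have h2 : inner ℂ x x = (t : ℂ) := by
    rw [hx, sum_inner, ht, Complex.ofReal_sum]
    refine Finset.sum_congr rfl fun i hi => ?_
    rw [inner_sum, Finset.sum_eq_single i]
    · rw [inner_tensor, inner_self_eq_norm_sq_to_K, inner_self_eq_norm_sq_to_K, he.1 i]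
      simp
    · intro j _ hj
      rw [inner_tensor, he.2 hj.symm, zero_mul]
    · exact fun h => absurd hi h
  have h3 : ‖x‖ ^ 2 = t := by
    rw [inner_self_eq_norm_sq_to_K] at h2
    exact Complex.ofReal_injective ((Complex.ofReal_pow _ _).trans h2)
  have h4 : t ≤ ‖x‖ * ‖ξ‖ := by
    have h5 := norm_inner_le_norm (𝕜 := ℂ) x ξ
    rw [h1, Complex.norm_real] at h5
    exact (le_abs_self t).trans h5
  have h6 := norm_nonneg ξ
  nlinarith [norm_nonneg x, sq_nonneg (‖x‖ - ‖ξ‖)]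

end Tensor

/-- Balls of radius `1/2` around orthonormal vectors are disjoint, the distances being `√2`; a
separable space contains only countably many disjoint nonempty open sets. -/
theorem Orthonormal.countable {ι H : Type*} [NormedAddCommGroup H] [InnerProductSpace ℂ H]
    [TopologicalSpace.SeparableSpace H] {e : ι → H} (he : Orthonormal ℂ e) : Countable ι := by
  have h : (Set.univ : Set ι).PairwiseDisjoint fun i => Metric.ball (e i) (1 / 2) := by
    intro i _ j _ hij
    refine Metric.ball_disjoint_ball ?_
    have h1 : ‖e i - e j‖ ^ 2 = 2 := by
      rw [norm_sub_sq (𝕜 := ℂ), he.2 hij, he.1 i, he.1 j]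
      norm_num
    rw [dist_eq_norm]
    nlinarith [norm_nonneg (e i - e j)]
  exact Set.countable_univ_iff.1 (h.countable_of_isOpen (fun _ _ => Metric.isOpen_ball)
    fun i _ => ⟨e i, Metric.mem_ball_self (by norm_num)⟩)

theorem HilbertBasis.enorm_sq_eq_tsum {ι H : Type*} [NormedAddCommGroup H]
    [InnerProductSpace ℂ H] (b : HilbertBasis ι ℂ H) (x : H) :
    ‖x‖ₑ ^ 2 = ∑' i, ‖inner ℂ (b i) x‖ₑ ^ 2 := by
  have h1 : HasSum (fun i => ‖inner ℂ (b i) x‖ ^ 2) (‖x‖ ^ 2) := by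
    have h := (b.hasSum_inner_mul_inner x x).mapL Complex.reCLM
    rw [inner_self_eq_norm_sq_to_K] at h
    convert h using 1
    · funext i
      rw [← inner_conj_symm, Complex.reCLM_apply, Complex.mul_conj, RCLike.norm_conj,
        Complex.normSq_eq_norm_sq, Complex.ofReal_re]
    · simp [← Complex.ofReal_pow]
  have h2 := ENNReal.ofReal_tsum_of_nonneg (fun i => sq_nonneg ‖inner ℂ (b i) x‖) h1.summable
  rw [h1.tsum_eq] at h2
  simpa only [ENNReal.ofReal_pow (norm_nonneg _), ofReal_norm] using h2

/-- Expand `V_q^* ξ` in a Hilbert basis of `L²(ℝ^m)`. Its coefficients are the packet coefficients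
of the partial inner products `f i` of `ξ`, so the packet Bessel inequality applies to each `f i`,
and the `‖f i‖²` sum to at most `‖ξ‖²`. -/
theorem isCoherent_tensorRight_packet (m : ℕ) {n : ℕ} {a : Fin n → ℝ} (ha : ∀ j, a j ≠ 0)
    {η : Fin n → 𝓢(ℝ, ℂ)} (hη : ∀ j, ∫ t, ‖η j t‖ ^ 2 = 1) :
    IsCoherent (∏ j, |a j|)⁻¹
      fun q => (tensorRight (packetL2 a η q) : L2 (Eucl m) →L[ℂ] L2 (Eucl m × Eucl n)) := by
  have hcont := continuous_packetL2 ha hη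
  refine IsCoherent.of_lintegral_le (Finset.prod_pos fun j _ => abs_pos.2 (ha j))
    (continuous_tensorRight.comp hcont) ⟨1, fun q => ?_⟩ fun ξ => ?_
  · exact (norm_tensorRight_le _).trans (norm_packetL2 ha hη q).le
  obtain ⟨w, b, -⟩ := exists_hilbertBasis ℂ (L2 (Eucl m))
  have : Fact ((2 : ENNReal) ≠ ⊤) := ⟨ENNReal.ofNat_ne_top⟩
  -- Countability permits interchanging the sum over the basis with the integral over `q`.
  have : Countable w := Orthonormal.countable b.orthonormal
  let f : w → L2 (Eucl n) := fun i => ContinuousLinearMap.adjoint (tensorLeft (b i)) ξ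
  have h1 : ∀ q, ‖ContinuousLinearMap.adjoint (tensorRight (packetL2 a η q)) ξ‖ₑ ^ 2 =
      ∑' i, ‖inner ℂ (packetL2 a η q) (f i)‖ₑ ^ 2 := fun q => by
    rw [HilbertBasis.enorm_sq_eq_tsum b]
    refine tsum_congr fun i => ?_
    rw [ContinuousLinearMap.adjoint_inner_right, ContinuousLinearMap.adjoint_inner_right]
    rfl
  simp only [h1]
  rw [lintegral_tsum fun i => Continuous.aemeasurable (by fun_prop)]
  calc ∑' i, ∫⁻ q, ‖inner ℂ (packetL2 a η q) (f i)‖ₑ ^ 2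
      ≤ ∑' i, ENNReal.ofReal (∏ j, |a j|) * ‖f i‖ₑ ^ 2 :=
        ENNReal.tsum_le_tsum fun i => lintegral_enorm_inner_packetL2_le ha hη (f i)
    _ = ENNReal.ofReal (∏ j, |a j|) * ∑' i, ‖f i‖ₑ ^ 2 := ENNReal.tsum_mul_left
    _ ≤ _ := by
      gcongr
      rw [ENNReal.tsum_eq_iSup_sum]
      refine iSup_le fun s => ?_
      have h2 := ENNReal.ofReal_le_ofReal (sum_norm_adjoint_tensorLeft_sq_le b.orthonormal s ξ)
      rw [ENNReal.ofReal_sum_of_nonneg fun _ _ => sq_nonneg _] at h2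
      simpa only [ENNReal.ofReal_pow (norm_nonneg _), ofReal_norm] using h2

end CoherentFamilies

/-! ### Structure constants of the limit and the symplectic frames. -/

namespace LimitSetting

variable {g : Type*} [NormedAddCommGroup g] [InnerProductSpace ℝ g] [FiniteDimensional ℝ g]
  [TwoStepLieAlgebra g]

theorem continuous_lie : Continuous fun z : g × g => ⁅z.1, z.2⁆ := by
  let L : g →ₗ[ℝ] g →ₗ[ℝ] g := LinearMap.mk₂ ℝ (fun x y => ⁅x, y⁆) add_lie
    (fun t x y => smul_lie t x y) lie_add (fun t x y => lie_smul t x y)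
  have h1 : Continuous ((LinearMap.toContinuousLinearMap :
      (g →ₗ[ℝ] g) ≃ₗ[ℝ] (g →L[ℝ] g)).toLinearMap ∘ₗ L) :=
    LinearMap.continuous_of_finiteDimensional _
  exact (h1.comp continuous_fst).clm_apply continuous_snd

section

variable {d p₁ p₂ : ℕ} (S : LimitSetting g d p₁ p₂)

/-- The two functionals agree on `Z_k` and vanish on the `A^k_j` that span `[g, g]` together with
it. -/
theorem ℓk_derived (k : ℕ) {y : g} (hy : y ∈ derivedSpace g) :
    S.ℓk k y = S.lam k * inner ℝ (vZ (S.bk k)) y := by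
  rw [S.derived_eq k] at hy
  let L : g →ₗ[ℝ] ℝ := (S.ℓk k : g →ₗ[ℝ] ℝ) - S.lam k • (innerₛₗ ℝ (vZ (S.bk k)))
  have h : spanZA (S.bk k) ≤ LinearMap.ker L := by
    refine Submodule.span_le.2 ?_
    rintro z (rfl | ⟨j, rfl⟩)
    · simp [L, lam, vZ]
    · have h1 : inner ℝ (vZ (S.bk k)) (vA (S.bk k) j) = (0 : ℝ) := by
        simp [vZ, vA, (S.bk k).inner_eq_ite]
      simp [L, S.ℓk_A, h1]
  have h2 := LinearMap.mem_ker.1 (h hy)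
  simpa [L, sub_eq_zero] using h2

theorem ℓk_XY_self (k : ℕ) (j : Fin d) :
    S.ℓk k ⁅vX (S.bk k) j, vY (S.bk k) j⁆ = S.lam k * S.c k j :=
  S.ℓk_derived k (Submodule.subset_span ⟨_, _, rfl⟩)

/-- If the product vanished, `X^k_j` would be `ℓ_k`-orthogonal to every basis vector and so lie in
the stabilizer, against orthonormality. This keeps the packet dilations nondegenerate at every
finite `k`, even where the limit degenerates. -/
theorem lam_mul_c_ne_zero (k : ℕ) (j : Fin d) : S.lam k * S.c k j ≠ 0 := by
  intro h0
  have hst : ∀ z ∈ spanTZA (S.bk k), ∀ x, S.ℓk k ⁅x, z⁆ = 0 := fun z hz x => by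
    rw [← S.stabilizer_eq k] at hz
    rw [← lie_skew, map_neg, hz x, neg_zero]
  have hmem : vX (S.bk k) j ∈ stabilizer (S.ℓk k) := fun y => by
    let w : Eucl d × Eucl d := (WithLp.toLp 2 fun i => inner ℝ (vX (S.bk k) i) y,
      WithLp.toLp 2 fun i => inner ℝ (vY (S.bk k) i) y)
    -- What remains of `y` after its `X, Y` part is removed lies in the stabilizer and does not
    -- contribute.
    have hu : y - secXY (S.bk k) w ∈ spanTZA (S.bk k) :=
      mem_spanTZA _ (fun i => by rw [inner_sub_right, inner_vX_secXY]; exact sub_self _)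
        fun i => by rw [inner_sub_right, inner_vY_secXY]; exact sub_self _
    rw [← add_sub_cancel (secXY (S.bk k) w) y, lie_add, map_add, hst _ hu, add_zero, secXY_apply,
      lie_add, map_add, lie_sum, lie_sum, map_sum, map_sum]
    simp only [lie_smul, map_smul, S.ℓk_XX, smul_zero, Finset.sum_const_zero, zero_add]
    refine Finset.sum_eq_zero fun i _ => ?_
    rcases eq_or_ne j i with rfl | hij
    · rw [S.ℓk_XY_self, h0, smul_zero]
    · rw [S.ℓk_XY k j i hij, smul_zero]
  rw [S.stabilizer_eq k] at hmem
  have h1 := inner_vX_spanTZA (S.bk k) hmem j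
  simp [vX] at h1

theorem tendsto_ℓk_apply {x : ℕ → g} {y : g} (h : Tendsto x atTop (𝓝 y)) :
    Tendsto (fun k => S.ℓk k (x k)) atTop (𝓝 (S.ℓ y)) :=
  (isBoundedBilinearMap_apply.continuous.tendsto (S.ℓ, y)).comp (S.tendsto_ℓ.prodMk_nhds h)

theorem tendsto_lie_bk (i j : Idx d p₁ p₂) :
    Tendsto (fun k => ⁅S.bk k i, S.bk k j⁆) atTop (𝓝 ⁅S.b i, S.b j⁆) :=
  (continuous_lie.tendsto (S.b i, S.b j)).comp ((S.tendsto_b i).prodMk_nhds (S.tendsto_b j))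

theorem ℓ_X (j : Fin d) : S.ℓ (vX S.b j) = 0 :=
  tendsto_nhds_unique (S.tendsto_ℓk_apply (S.tendsto_b (.inl j)))
    (tendsto_const_nhds.congr fun k => (S.ℓk_X k j).symm)

theorem ℓ_Y (j : Fin d) : S.ℓ (vY S.b j) = 0 :=
  tendsto_nhds_unique (S.tendsto_ℓk_apply (S.tendsto_b (.inr (.inl j))))
    (tendsto_const_nhds.congr fun k => (S.ℓk_Y k j).symm)

theorem ℓ_XX (i j : Fin d) : S.ℓ ⁅vX S.b i, vX S.b j⁆ = 0 :=
  tendsto_nhds_unique (S.tendsto_ℓk_apply (S.tendsto_lie_bk (.inl i) (.inl j)))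
    (tendsto_const_nhds.congr fun k => (S.ℓk_XX k i j).symm)

theorem ℓ_YY (i j : Fin d) : S.ℓ ⁅vY S.b i, vY S.b j⁆ = 0 :=
  tendsto_nhds_unique (S.tendsto_ℓk_apply (S.tendsto_lie_bk (.inr (.inl i)) (.inr (.inl j))))
    (tendsto_const_nhds.congr fun k => (S.ℓk_YY k i j).symm)

theorem ℓ_XY {i j : Fin d} (hij : i ≠ j) : S.ℓ ⁅vX S.b i, vY S.b j⁆ = 0 :=
  tendsto_nhds_unique (S.tendsto_ℓk_apply (S.tendsto_lie_bk (.inl i) (.inr (.inl j))))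
    (tendsto_const_nhds.congr fun k => (S.ℓk_XY k i j hij).symm)

/-- The structure constant `λ c_j = ℓ [X_j, Y_j]`. -/
def kappa (j : Fin d) : ℝ := S.lamLim * S.cLim j

theorem ℓ_XY_self (j : Fin d) : S.ℓ ⁅vX S.b j, vY S.b j⁆ = S.kappa j := by
  have hXY := S.tendsto_lie_bk (.inl j) (.inr (.inl j))
  have hZ := S.tendsto_b (.inr (.inr (.inr (.inl ()))))
  refine tendsto_nhds_unique (S.tendsto_ℓk_apply hXY) ?_
  exact ((S.tendsto_ℓk_apply hZ).mul (hZ.inner hXY)).congr fun k => (S.ℓk_XY_self k j).symm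

theorem ℓ_lie_vX (i : Fin d) (w : Eucl d × Eucl d) :
    S.ℓ ⁅vX S.b i, secXY S.b w⁆ = S.kappa i * w.2 i := by
  rw [secXY_apply, lie_add, map_add, lie_sum, lie_sum, map_sum, map_sum]
  simp only [lie_smul, map_smul, S.ℓ_XX, smul_zero, Finset.sum_const_zero, zero_add]
  rw [Finset.sum_eq_single i]
  · rw [S.ℓ_XY_self, smul_eq_mul, mul_comm]
  · intro j _ hj
    rw [S.ℓ_XY hj.symm, smul_zero]
  · simp

theorem ℓ_lie_vY (i : Fin d) (w : Eucl d × Eucl d) :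
    S.ℓ ⁅vY S.b i, secXY S.b w⁆ = -(S.kappa i * w.1 i) := by
  rw [secXY_apply, lie_add, map_add, lie_sum, lie_sum, map_sum, map_sum]
  simp only [lie_smul, map_smul, S.ℓ_YY, smul_zero, Finset.sum_const_zero, add_zero]
  rw [Finset.sum_eq_single i]
  · rw [← lie_skew, map_neg, S.ℓ_XY_self, smul_eq_mul, mul_neg, mul_comm]
  · intro j _ hj
    rw [← lie_skew, map_neg, S.ℓ_XY hj, neg_zero, smul_zero]
  · simp

/-- The form stays diagonal in the limit basis, with coefficients `kappa`. The vanishing of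
particular `kappa j` is what distinguishes the two cases. -/
theorem ℓ_lie_secXY (w w' : Eucl d × Eucl d) : S.ℓ ⁅secXY S.b w, secXY S.b w'⁆ =
    ∑ j, S.kappa j * (w.1 j * w'.2 j - w.2 j * w'.1 j) := by
  rw [secXY_apply S.b w, add_lie, map_add, sum_lie, sum_lie, map_sum, map_sum,
    ← Finset.sum_add_distrib]
  refine Finset.sum_congr rfl fun j _ => ?_
  rw [smul_lie, smul_lie, map_smul, map_smul, S.ℓ_lie_vX, S.ℓ_lie_vY, smul_eq_mul, smul_eq_mul]
  ring

/-- All of `g / u` is the radical when the form `ℓ [·, ·]` vanishes. -/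
def frameOfKappaEqZero (hκ : ∀ j, S.kappa j = 0) : SymplecticFrame S.quot 0 d where
  equiv := (LinearEquiv.ofBijective (LinearMap.snd ℝ (PhaseSpace 0) (Eucl d × Eucl d))
    ⟨fun z z' h => Prod.ext (Subsingleton.elim _ _) h, fun r => ⟨(0, r), rfl⟩⟩
    ).toContinuousLinearEquiv
  lie ζ ζ' := by
    have h : ζ.1 = 0 := Subsingleton.elim _ _
    rw [h, inner_zero_left]
    change S.ℓ ⁅secXY S.b _, secXY S.b _⁆ = 0
    rw [S.ℓ_lie_secXY]
    simp [hκ]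

end

section

variable {m n p₁ p₂ : ℕ} (S : LimitSetting g (m + n) p₁ p₂)

/-- The coordinates `(z, r) ↦ (x, y)` with `x_j = z_j`, `λ c_j y_j = z_{m+j}` for `j ≤ m`, and `r`
for the remaining coordinates. -/
def frameEquiv (hκ : ∀ j : Fin m, S.kappa (Fin.castAdd n j) ≠ 0) :
    (PhaseSpace m × (Eucl n × Eucl n)) ≃ₗ[ℝ] (Eucl (m + n) × Eucl (m + n)) where
  toFun ζ := (WithLp.toLp 2 (Fin.addCases (fun j => ζ.1 (.inl j)) fun j => ζ.2.1 j),
    WithLp.toLp 2 (Fin.addCases (fun j => ζ.1 (.inr j) / S.kappa (Fin.castAdd n j))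
      fun j => ζ.2.2 j))
  map_add' ζ ζ' := by
    refine Prod.ext (PiLp.ext fun j => ?_) (PiLp.ext fun j => ?_) <;>
      refine Fin.addCases (fun i => ?_) (fun i => ?_) j <;> simp [add_div]
  map_smul' t ζ := by
    refine Prod.ext (PiLp.ext fun j => ?_) (PiLp.ext fun j => ?_) <;>
      refine Fin.addCases (fun i => ?_) (fun i => ?_) j <;> simp [mul_div_assoc]
  invFun w := (WithLp.toLp 2 (Sum.elim (fun j => w.1 (Fin.castAdd n j))
      fun j => S.kappa (Fin.castAdd n j) * w.2 (Fin.castAdd n j)),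
    (WithLp.toLp 2 fun j => w.1 (Fin.natAdd m j), WithLp.toLp 2 fun j => w.2 (Fin.natAdd m j)))
  left_inv ζ := by
    refine Prod.ext (PiLp.ext fun j => ?_) (Prod.ext (PiLp.ext fun j => ?_)
      (PiLp.ext fun j => ?_))
    · rcases j with j | j
      · simp
      · simp [mul_div_cancel₀ _ (hκ j)]
    · simp
    · simp
  right_inv w := by
    refine Prod.ext (PiLp.ext fun j => ?_) (PiLp.ext fun j => ?_) <;>
      refine Fin.addCases (fun i => ?_) (fun i => ?_) j <;> simp [hκ]

/-- The frame with radical `span (X_j, Y_j)_{j > m}`. -/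
def frame (hκ : ∀ j : Fin m, S.kappa (Fin.castAdd n j) ≠ 0)
    (hκ' : ∀ j : Fin n, S.kappa (Fin.natAdd m j) = 0) : SymplecticFrame S.quot m n where
  equiv := (S.frameEquiv hκ).toContinuousLinearEquiv
  lie ζ ζ' := by
    change S.ℓ ⁅secXY S.b (S.frameEquiv hκ ζ), secXY S.b (S.frameEquiv hκ ζ')⁆ = _
    rw [S.ℓ_lie_secXY, inner_rot, Fin.sum_univ_add]
    simp only [hκ', zero_mul, Finset.sum_const_zero, add_zero]
    refine Finset.sum_congr rfl fun j _ => ?_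
    have := hκ j
    simp only [frameEquiv, LinearEquiv.coe_mk, LinearMap.coe_mk, AddHom.coe_mk, Fin.addCases_left]
    field_simp

end

end LimitSetting

/-! ### The second case: unitary characters. -/

section Scalar

variable {g : Type*} [NormedAddCommGroup g] [InnerProductSpace ℝ g] [TwoStepLieAlgebra g]

/-- Multiplication by `phase t` as a unitary operator. -/
def phaseEquiv (t : ℝ) : ℂ ≃ₗᵢ[ℂ] ℂ where
  toLinearEquiv := LinearEquiv.smulOfNeZero ℂ ℂ (phase t) (by
    rw [← norm_ne_zero_iff, norm_phase]; exact one_ne_zero)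
  norm_map' z := by
    change ‖phase t • z‖ = ‖z‖
    rw [norm_smul, norm_phase, one_mul]

theorem phaseEquiv_apply (t : ℝ) (z : ℂ) : phaseEquiv t z = phase t • z := rfl

/-- The unitary character `x ↦ exp(-2πi L(x))`. -/
def characterRep (L : g →L[ℝ] ℝ) (hL : ∀ x y : g, L ⁅x, y⁆ = 0) : UnitaryRep g ℂ where
  op x := phaseEquiv (L x)
  map_mul x y v := by
    simp only [phaseEquiv_apply, smul_smul, ← phase_add]
    congr 2
    simp [cbh, hL]
  continuous_op v := by
    simp only [phaseEquiv_apply]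
    fun_prop

theorem isIrreducible_characterRep (L : g →L[ℝ] ℝ) (hL : ∀ x y : g, L ⁅x, y⁆ = 0) :
    (characterRep L hL).IsIrreducible :=
  ⟨inferInstance, fun K _ _ => eq_bot_or_eq_top K⟩

/-- Complex numbers as operators on `ℂ`. -/
def scalarOp : ℂ →ₗᵢ[ℂ] (ℂ →L[ℂ] ℂ) where
  toFun z := z • ContinuousLinearMap.id ℂ ℂ
  map_add' z z' := by ext; simp
  map_smul' c z := by ext; simp
  norm_map' z := by
    change ‖z • ContinuousLinearMap.id ℂ ℂ‖ = ‖z‖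
    rw [norm_smul, ContinuousLinearMap.norm_id, mul_one]

theorem scalarOp_apply (z : ℂ) : scalarOp z = z • ContinuousLinearMap.id ℂ ℂ := rfl

theorem scalarOp_apply_one (T : ℂ →L[ℂ] ℂ) : scalarOp (T 1) = T := by
  ext
  simp [scalarOp_apply]

theorem isCompactOperator_scalarOp (z : ℂ) : IsCompactOperator (scalarOp z) :=
  isCompactOperator_of_locallyCompactSpace_dom (scalarOp z)

end Scalar

namespace LimitSetting

variable {g : Type*} [NormedAddCommGroup g] [InnerProductSpace ℝ g] [FiniteDimensional ℝ g]
  [TwoStepLieAlgebra g] {d p₁ p₂ : ℕ} (S : LimitSetting g d p₁ p₂)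

/-- The functional `ℓ + (x̃, ỹ)`. -/
def fullShift (q : Eucl d × Eucl d) : g →L[ℝ] ℝ :=
  S.ℓ + ∑ j, q.1 j • innerSL ℝ (vX S.b j) + ∑ j, q.2 j • innerSL ℝ (vY S.b j)

theorem fullShift_apply (q : Eucl d × Eucl d) (x : g) : S.fullShift q x =
    S.ℓ x + ∑ j, q.1 j * inner ℝ (vX S.b j) x + ∑ j, q.2 j * inner ℝ (vY S.b j) x := by
  simp [fullShift]

theorem ℓ_secXY (w : Eucl d × Eucl d) : S.ℓ (secXY S.b w) = 0 := by
  rw [secXY_apply]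
  simp [S.ℓ_X, S.ℓ_Y]

theorem fullShift_secXY (q w : Eucl d × Eucl d) : S.fullShift q (secXY S.b w) = pairing q w := by
  rw [fullShift_apply, ℓ_secXY, zero_add, pairing]
  simp only [inner_vX_secXY, inner_vY_secXY]

theorem fullShift_of_mem (q : Eucl d × Eucl d) {x : g} (hx : x ∈ spanTZA S.b) :
    S.fullShift q x = S.ℓ x := by
  rw [fullShift_apply]
  simp [inner_vX_spanTZA S.b hx, inner_vY_spanTZA S.b hx]

theorem sub_secXY_mem (x : g) : x - secXY S.b (WithLp.toLp 2 fun j => inner ℝ (vX S.b j) x,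
    WithLp.toLp 2 fun j => inner ℝ (vY S.b j) x) ∈ spanTZA S.b :=
  mem_spanTZA _ (fun i => by rw [inner_sub_right, inner_vX_secXY]; exact sub_self _)
    fun i => by rw [inner_sub_right, inner_vY_secXY]; exact sub_self _

theorem ℓ_lie_left {x : g} (hx : x ∈ spanTZA S.b) (y : g) : S.ℓ ⁅x, y⁆ = 0 :=
  S.quot.le_stabilizer hx y

theorem ℓ_lie_right {y : g} (hy : y ∈ spanTZA S.b) (x : g) : S.ℓ ⁅x, y⁆ = 0 := by
  rw [← lie_skew, map_neg, S.ℓ_lie_left hy, neg_zero]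

theorem ℓ_lie (x y : g) : S.ℓ ⁅x, y⁆ = ∑ j, S.kappa j *
    (inner ℝ (vX S.b j) x * inner ℝ (vY S.b j) y -
      inner ℝ (vY S.b j) x * inner ℝ (vX S.b j) y) := by
  have hx := S.sub_secXY_mem x
  have hy := S.sub_secXY_mem y
  set w : Eucl d × Eucl d := (WithLp.toLp 2 fun j => inner ℝ (vX S.b j) x,
    WithLp.toLp 2 fun j => inner ℝ (vY S.b j) x) with hw
  set w' : Eucl d × Eucl d := (WithLp.toLp 2 fun j => inner ℝ (vX S.b j) y,
    WithLp.toLp 2 fun j => inner ℝ (vY S.b j) y) with hw'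
  have h1 : S.ℓ ⁅x, y⁆ = S.ℓ ⁅secXY S.b w, secXY S.b w'⁆ := by
    rw [← add_sub_cancel (secXY S.b w) x, add_lie, map_add, S.ℓ_lie_left hx, add_zero,
      ← add_sub_cancel (secXY S.b w') y, lie_add, map_add, S.ℓ_lie_right hy, add_zero]
  rw [h1, ℓ_lie_secXY]

theorem fullShift_lie (hκ : ∀ j, S.kappa j = 0) (q : Eucl d × Eucl d) (x y : g) :
    S.fullShift q ⁅x, y⁆ = 0 := by
  have hm : ⁅x, y⁆ ∈ spanTZA S.b := S.quot.derived_le (Submodule.subset_span ⟨x, y, rfl⟩)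
  rw [S.fullShift_of_mem q hm, ℓ_lie]
  simp [hκ]

/-- The characters of `G / U` when the form `ℓ [·, ·]` vanishes. -/
def characterFamily (hκ : ∀ j, S.kappa j = 0) : RadicalFamily (S.frameOfKappaEqZero hκ) ℂ where
  rep q := characterRep (S.fullShift q) (S.fullShift_lie hκ q)
  irreducible q := isIrreducible_characterRep _ _
  restrict q x hx v := by
    change phaseEquiv (S.fullShift q x) v = phase (S.ℓ x) • v
    rw [S.fullShift_of_mem q hx, phaseEquiv_apply]
  radical q r v := by
    change phaseEquiv (S.fullShift q (secXY S.b r)) v = _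
    rw [S.fullShift_secXY, phaseEquiv_apply]
  twist q w v := by
    have h : ((S.frameOfKappaEqZero hκ).equiv.symm w).2 = w :=
      (S.frameOfKappaEqZero hκ).equiv.apply_symm_apply w
    rw [h]
    change phaseEquiv (S.fullShift q (secXY S.b w)) v =
      phase (pairing q w) • phaseEquiv (S.fullShift 0 (secXY S.b w)) v
    rw [S.fullShift_secXY, S.fullShift_secXY, phaseEquiv_apply, phaseEquiv_apply]
    simp [pairing, phase_zero]

/-- `ℓ` vanishes on the `X_j, Y_j`, so on the section the character of `ℓ + q` is the plane wave of
the Euclidean Fourier transform. -/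
theorem repOp_characterFamily [MeasurableSpace g] [BorelSpace g] (hκ : ∀ j, S.kappa j = 0)
    (h : S.quot.L1) (q : Eucl d × Eucl d) :
    S.quot.repOp ((S.characterFamily hκ).rep q) h = scalarOp (S.hhat h q) := by
  rw [← scalarOp_apply_one (S.quot.repOp _ h)]
  congr 1
  rw [QuotientData.repOp_apply, hhat]
  refine integral_congr_ae (Eventually.of_forall fun w => ?_)
  change h (S.quot.sec w) • phaseEquiv (S.fullShift q (secXY S.b w)) 1 = _
  rw [S.fullShift_secXY, phaseEquiv_apply, smul_eq_mul, smul_eq_mul, mul_one]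
  rfl

end LimitSetting

/-- Here every `kappa j` vanishes, the radical is all of `g / u`, and the coherent machinery runs
with `K = ℂ` and `A = ℂ`. -/
theorem secondCase {g : Type*} [NormedAddCommGroup g] [InnerProductSpace ℝ g]
    [FiniteDimensional ℝ g] [MeasurableSpace g] [BorelSpace g] [TwoStepLieAlgebra g]
    {d p₁ p₂ : ℕ} (S : LimitSetting g d p₁ p₂) {η : Fin d → 𝓢(ℝ, ℂ)}
    (hη : ∀ j, ∫ t, ‖η j t‖ ^ 2 = 1) (hS : S.lamLim = 0 ∨ ∀ j, S.cLim j = 0) :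
    ∃ F : S.quot.CStar →ₗᵢ[ℂ] C₀(Eucl d × Eucl d, ℂ),
      (∀ (h : S.quot.L1) (q : Eucl d × Eucl d), F (h : S.quot.CStar) q = S.hhat h q) ∧
      ∀ k : ℕ, ∃ ν : S.quot.CStar →L[ℂ] (L2 (Eucl d) →L[ℂ] L2 (Eucl d)),
        (∀ a, IsWeakIntegral (ν a) (S.integrand₂ η k (F a))) ∧
        (∀ h : S.quot.L1, S.quot.IsSchwartz h →
          Integrable (S.integrand₂ η k (S.hhat h)) ∧
          ν (h : S.quot.CStar) = ∫ q, S.integrand₂ η k (S.hhat h) q) ∧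
        (∀ ν' : S.quot.CStar →L[ℂ] (L2 (Eucl d) →L[ℂ] L2 (Eucl d)),
          (∀ h : S.quot.L1, S.quot.IsSchwartz h →
            ν' (h : S.quot.CStar) = ∫ q, S.integrand₂ η k (S.hhat h) q) → ν' = ν) ∧
        ∀ a, IsCompactOperator (ν a) ∧ ‖ν a‖ ≤ ‖a‖ ∧
          ContinuousLinearMap.adjoint (ν a) = ν (S.quot.starC a) := by
  have hκ : ∀ j, S.kappa j = 0 := fun j => by
    rcases hS with h | h <;> simp [LimitSetting.kappa, h]
  let R := S.characterFamily hκ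
  obtain ⟨F, hF⟩ := R.exists_linearIsometry scalarOp
    fun h q => ⟨_, (S.repOp_characterFamily hκ h q).symm⟩
  have hFh : ∀ (h : S.quot.L1) (q : Eucl d × Eucl d), F (h : S.quot.CStar) q = S.hhat h q :=
    fun h q => scalarOp.injective ((hF h q).trans (S.repOp_characterFamily hκ h q))
  refine ⟨F, hFh, fun k => ?_⟩
  have hV := isCoherent_packet (S.lam_mul_c_ne_zero k) hη
  obtain ⟨μ, hμ⟩ := hV.exists_integralMap scalarOp
  have hint : ∀ φ : Eucl d × Eucl d → ℂ, coherentIntegrand (∏ j, |S.lam k * S.c k j|)⁻¹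
      (fun q => spanOp (packetL2 (fun j => S.lam k * S.c k j) η q)) (fun q => scalarOp (φ q)) =
      S.integrand₂ η k φ := fun φ => funext fun q => coherentIntegrand_spanOp _ _ φ q
  have hFe : ∀ h : S.quot.L1, ⇑(F (h : S.quot.CStar)) = S.hhat h := fun h => funext (hFh h)
  have hSch : ∀ h : S.quot.L1, S.quot.IsSchwartz h →
      Integrable (S.integrand₂ η k (S.hhat h)) ∧
      μ (F (h : S.quot.CStar)) = ∫ q, S.integrand₂ η k (S.hhat h) q := fun h hh => by
    rw [← hFe, ← hint]
    exact ⟨R.integrable_coherentIntegrand hF hV hh, R.integralMap_eq_integral hF hV hμ hh⟩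
  refine ⟨μ.comp F.toContinuousLinearMap, fun a => ?_, hSch, fun ν' hν' => ?_,
    fun a => ⟨?_, ?_, ?_⟩⟩
  · rw [← hint]
    exact (hμ (F a)).1
  · exact eq_of_eqOn_isSchwartz fun h hh => (hν' h hh).trans (hSch h hh).2.symm
  · exact R.isCompactOperator_integralMap hF hV hμ isCompactOperator_scalarOp a
  · exact ((hμ (F a)).2).trans_eq (F.norm_map a)
  · exact R.adjoint_integralMap hF hμ a

/-! ### The third case: the Schrödinger model of the induced representations. -/

namespace LimitSetting

variable {g : Type*} [NormedAddCommGroup g] [InnerProductSpace ℝ g] [FiniteDimensional ℝ g]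
  [TwoStepLieAlgebra g] {m n p₁ p₂ : ℕ} (S : LimitSetting g (m + n) p₁ p₂)

/-- The vector with `ℓ [∑ r_j X_j, x] = ⟨r, momentum x⟩`. -/
def momentum (x : g) : Eucl m :=
  WithLp.toLp 2 fun j => S.kappa (Fin.castAdd n j) * inner ℝ (vY S.b (Fin.castAdd n j)) x

theorem momentum_apply (x : g) (j : Fin m) : S.momentum x j =
    S.kappa (Fin.castAdd n j) * inner ℝ (vY S.b (Fin.castAdd n j)) x := rfl

theorem coordM_apply (x : g) (j : Fin m) :
    S.coordM x j = inner ℝ (vX S.b (Fin.castAdd n j)) x := rfl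

theorem continuous_momentum : Continuous S.momentum := by
  unfold momentum
  exact (PiLp.continuous_toLp 2 _).comp (by fun_prop)

theorem coordM_add (x y : g) : S.coordM (x + y) = S.coordM x + S.coordM y :=
  PiLp.ext fun j => by simp [coordM_apply, inner_add_right]

theorem momentum_add (x y : g) : S.momentum (x + y) = S.momentum x + S.momentum y :=
  PiLp.ext fun j => by simp [momentum_apply, inner_add_right, mul_add]

theorem mem_of_lie (x y : g) : ⁅x, y⁆ ∈ spanTZA S.b :=
  S.quot.derived_le (Submodule.subset_span ⟨x, y, rfl⟩)

theorem coordM_of_mem {x : g} (hx : x ∈ spanTZA S.b) : S.coordM x = 0 :=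
  PiLp.ext fun _ => inner_vX_spanTZA S.b hx _

theorem momentum_of_mem {x : g} (hx : x ∈ spanTZA S.b) : S.momentum x = 0 :=
  PiLp.ext fun j => by simp [momentum_apply, inner_vY_spanTZA S.b hx]

theorem shift_apply (q : Eucl n × Eucl n) (x : g) : S.shift q x = S.ℓ x +
    (∑ j, q.1 j * inner ℝ (vX S.b (Fin.natAdd m j)) x +
      ∑ j, q.2 j * inner ℝ (vY S.b (Fin.natAdd m j)) x) := by
  simp [shift, add_assoc]

theorem shift_of_mem (q : Eucl n × Eucl n) {x : g} (hx : x ∈ spanTZA S.b) :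
    S.shift q x = S.ℓ x := by
  rw [shift_apply]
  simp [inner_vX_spanTZA S.b hx, inner_vY_spanTZA S.b hx]

theorem coordM_cbh_add (x y : g) : S.coordM (cbh x y) = S.coordM x + S.coordM y := by
  rw [cbh, coordM_add, coordM_add, S.coordM_of_mem (Submodule.smul_mem _ _ (S.mem_of_lie x y)),
    add_zero]

theorem momentum_cbh (x y : g) : S.momentum (cbh x y) = S.momentum x + S.momentum y := by
  rw [cbh, momentum_add, momentum_add,
    S.momentum_of_mem (Submodule.smul_mem _ _ (S.mem_of_lie x y)), add_zero]

theorem inner_vX_secM (i : Fin (m + n)) (r : Eucl m) : inner ℝ (vX S.b i) (S.secM r) =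
    ∑ j, if i = Fin.castAdd n j then r j else 0 := by
  simp [secM, inner_sum, inner_smul_right, vX, S.b.inner_eq_ite]

theorem inner_vY_secM (i : Fin (m + n)) (r : Eucl m) :
    inner ℝ (vY S.b i) (S.secM r) = (0 : ℝ) := by
  simp [secM, inner_sum, inner_smul_right, vX, vY, S.b.inner_eq_ite]

theorem shift_secM (q : Eucl n × Eucl n) (r : Eucl m) : S.shift q (S.secM r) = 0 := by
  have h1 : S.ℓ (S.secM r) = 0 := by simp [secM, S.ℓ_X]
  have h2 : ∀ (j : Fin n) (i : Fin m), Fin.natAdd m j ≠ Fin.castAdd n i := fun j i h => by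
    have := congrArg Fin.val h
    simp only [Fin.val_natAdd, Fin.val_castAdd] at this
    omega
  rw [shift_apply, h1]
  simp [inner_vX_secM, inner_vY_secM, h2]

theorem secM_sub (r r' : Eucl m) : S.secM (r - r') = S.secM r - S.secM r' := by
  simp [secM, sub_smul, Finset.sum_sub_distrib]

theorem ℓ_lie_secM (r : Eucl m) (x : g) : S.ℓ ⁅S.secM r, x⁆ = inner ℝ r (S.momentum x) := by
  rw [ℓ_lie, Fin.sum_univ_add, PiLp.inner_apply]
  have h2 : ∀ (j : Fin n) (i : Fin m), Fin.natAdd m j ≠ Fin.castAdd n i := fun j i h => by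
    have := congrArg Fin.val h
    simp only [Fin.val_natAdd, Fin.val_castAdd] at this
    omega
  simp only [inner_vY_secM, zero_mul, sub_zero, inner_vX_secM, h2, if_false,
    Finset.sum_const_zero, mul_zero, add_zero]
  refine Finset.sum_congr rfl fun j _ => ?_
  simp [momentum_apply]
  ring

theorem ℓ_lie_eq (hκ' : ∀ j : Fin n, S.kappa (Fin.natAdd m j) = 0) (x y : g) :
    S.ℓ ⁅x, y⁆ = inner ℝ (S.coordM x) (S.momentum y) - inner ℝ (S.coordM y) (S.momentum x) := by
  rw [ℓ_lie, Fin.sum_univ_add, PiLp.inner_apply, PiLp.inner_apply, ← Finset.sum_sub_distrib]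
  simp only [hκ', zero_mul, Finset.sum_const_zero, add_zero]
  refine Finset.sum_congr rfl fun j _ => ?_
  simp [momentum_apply, coordM_apply]
  ring

/-- The exponent in the Schrödinger model of `π_{ℓ+q}`. -/
def exponent (q : Eucl n × Eucl n) (x : g) (r : Eucl m) : ℝ :=
  S.shift q x - inner ℝ r (S.momentum x) + 1 / 2 * inner ℝ (S.coordM x) (S.momentum x)

/-- The cocycle identity that makes `indOp` multiplicative. The commutator term is cancelled by the
mixed terms, because `ℓ [·, ·]` involves only the first `m` coordinate pairs. -/
theorem exponent_cbh (hκ' : ∀ j : Fin n, S.kappa (Fin.natAdd m j) = 0) (q : Eucl n × Eucl n)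
    (x y : g) (r : Eucl m) :
    S.exponent q (cbh x y) r = S.exponent q x r + S.exponent q y (r - S.coordM x) := by
  have h1 : S.shift q (cbh x y) = S.shift q x + S.shift q y + 1 / 2 * S.ℓ ⁅x, y⁆ := by
    rw [cbh, map_add, map_add, map_smul, S.shift_of_mem q (S.mem_of_lie x y), smul_eq_mul]
  simp only [exponent, h1, coordM_cbh_add, momentum_cbh, S.ℓ_lie_eq hκ', inner_add_right,
    inner_add_left, inner_sub_left]
  ring

/-- Computes the `P`-component in `lift` after translation: all iterated brackets vanish, so the
character can be evaluated on an explicit element. -/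
theorem shift_neg_cbh (q : Eucl n × Eucl n) (x : g) (r : Eucl m) :
    S.shift q (-(cbh (-(S.secM (r - S.coordM x))) (cbh (-x) (S.secM r)))) =
      S.exponent q x r := by
  have h2 : ∀ a b c : g, ⁅a, ⁅b, c⁆⁆ = 0 := TwoStepLieAlgebra.two_step
  have h1 : -(cbh (-(S.secM (r - S.coordM x))) (cbh (-x) (S.secM r))) =
      x - S.secM (S.coordM x) + (1 / 2 : ℝ) • (⁅x, S.secM r⁆ +
        ⁅S.secM r - S.secM (S.coordM x), S.secM r - x⁆) := by
    simp only [cbh, secM_sub, lie_add, lie_smul, h2, neg_lie, lie_neg, lie_sub, sub_lie, lie_self]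
    module
  rw [h1, map_add, map_sub, map_smul, shift_secM, S.shift_of_mem q
    (Submodule.add_mem _ (S.mem_of_lie _ _) (S.mem_of_lie _ _)), map_add, lie_sub, sub_lie, sub_lie,
    lie_self, ← lie_skew x, map_neg, ← lie_skew _ (S.secM r)]
  simp only [map_sub, map_neg, ℓ_lie_secM, exponent, map_zero, smul_eq_mul]
  have h3 : inner ℝ r (S.momentum (S.secM (S.coordM x))) = (0 : ℝ) := by
    rw [PiLp.inner_apply]
    simp [momentum_apply, inner_vY_secM]
  rw [h3]
  ring

theorem coeFn_indOp (q : Eucl n × Eucl n) (x : g) (φ : L2 (Eucl m)) :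
    S.indOp q x φ =ᵐ[volume] fun r => phase (S.exponent q x r) * φ (r - S.coordM x) := by
  refine (S.memLp_ind q x φ).coeFn_toLp.trans (Eventually.of_forall fun r => ?_)
  simp only [lift, coordM_cbh]
  rw [chi_eq_phase, shift_neg_cbh]

theorem indOp_cbh (hκ' : ∀ j : Fin n, S.kappa (Fin.natAdd m j) = 0) (q : Eucl n × Eucl n)
    (x y : g) (φ : L2 (Eucl m)) : S.indOp q (cbh x y) φ = S.indOp q x (S.indOp q y φ) := by
  refine Lp.ext ?_
  have h := (measurePreserving_sub_right volume (S.coordM x)).quasiMeasurePreserving.ae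
    (S.coeFn_indOp q y φ)
  filter_upwards [S.coeFn_indOp q (cbh x y) φ, S.coeFn_indOp q x (S.indOp q y φ), h]
    with r h1 h2 h3
  rw [h1, h2, h3, S.exponent_cbh hκ', phase_add, coordM_cbh_add, sub_sub, mul_assoc]

theorem indOp_eq_smul (q : Eucl n × Eucl n) {x : g} (hc : S.coordM x = 0)
    (hm : S.momentum x = 0) (φ : L2 (Eucl m)) : S.indOp q x φ = phase (S.shift q x) • φ := by
  refine Lp.ext ?_
  filter_upwards [S.coeFn_indOp q x φ, Lp.coeFn_smul (phase (S.shift q x)) φ] with r h1 h2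
  rw [h1, h2, hc, sub_zero]
  simp [exponent, hm]

/-- In the exponent `q` appears only in the term independent of `r`; this is the `twist` property of
the family. -/
theorem indOp_eq_smul_indOp_zero (q : Eucl n × Eucl n) (x : g) (φ : L2 (Eucl m)) :
    S.indOp q x φ = phase (S.shift q x - S.shift 0 x) • S.indOp 0 x φ := by
  refine Lp.ext ?_
  filter_upwards [S.coeFn_indOp q x φ, S.coeFn_indOp 0 x φ,
    Lp.coeFn_smul (phase (S.shift q x - S.shift 0 x)) (S.indOp 0 x φ)] with r h1 h2 h3
  rw [h1, h3, Pi.smul_apply, h2, smul_eq_mul, ← mul_assoc, ← phase_add]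
  congr 2
  simp only [exponent]
  ring

theorem norm_indOp_apply_le (q : Eucl n × Eucl n) (x : g) (φ : L2 (Eucl m)) :
    ‖S.indOp q x φ‖ ≤ ‖φ‖ := by
  have h := (S.indOp q x).le_of_opNorm_le (LinearMap.mkContinuous_norm_le _ zero_le_one _) φ
  rwa [one_mul] at h

theorem indOp_zero (q : Eucl n × Eucl n) (φ : L2 (Eucl m)) : S.indOp q 0 φ = φ := by
  rw [S.indOp_eq_smul q (S.coordM_of_mem (Submodule.zero_mem _))
    (S.momentum_of_mem (Submodule.zero_mem _)), map_zero, phase_zero, one_smul]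

theorem indOp_indOp_neg (hκ' : ∀ j : Fin n, S.kappa (Fin.natAdd m j) = 0) (q : Eucl n × Eucl n)
    (x : g) (φ : L2 (Eucl m)) : S.indOp q x (S.indOp q (-x) φ) = φ := by
  rw [← S.indOp_cbh hκ']
  simp [cbh, indOp_zero]

/-- `π_{ℓ+q}(x)` as a unitary operator. -/
def indEquiv (hκ' : ∀ j : Fin n, S.kappa (Fin.natAdd m j) = 0) (q : Eucl n × Eucl n) (x : g) :
    L2 (Eucl m) ≃ₗᵢ[ℂ] L2 (Eucl m) where
  toLinearEquiv := LinearEquiv.ofLinearMap (S.indOp q x : L2 (Eucl m) →ₗ[ℂ] L2 (Eucl m))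
    (S.indOp q (-x) : L2 (Eucl m) →ₗ[ℂ] L2 (Eucl m))
    (LinearMap.ext fun φ => S.indOp_indOp_neg hκ' q x φ)
    (LinearMap.ext fun φ => by simpa using S.indOp_indOp_neg hκ' q (-x) φ)
  norm_map' φ := by
    refine le_antisymm (S.norm_indOp_apply_le q x φ) ?_
    have h := S.norm_indOp_apply_le q (-x) (S.indOp q x φ)
    have h2 := S.indOp_indOp_neg hκ' q (-x) φ
    rw [neg_neg] at h2
    rwa [h2] at h

theorem indEquiv_apply (hκ' : ∀ j : Fin n, S.kappa (Fin.natAdd m j) = 0) (q : Eucl n × Eucl n)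
    (x : g) (φ : L2 (Eucl m)) : S.indEquiv hκ' q x φ = S.indOp q x φ := rfl

theorem continuous_exponent (q : Eucl n × Eucl n) :
    Continuous fun z : g × Eucl m => S.exponent q z.1 z.2 := by
  have h1 := S.continuous_momentum
  have h2 := S.continuous_coordM
  unfold exponent
  fun_prop

theorem coeFn_indOp_schwartz (q : Eucl n × Eucl n) (x : g) (φ : 𝓢(Eucl m, ℂ)) :
    S.indOp q x (φ.toLp 2) =ᵐ[volume]
      fun r => phase (S.exponent q x r) * φ (r - S.coordM x) := by
  have h := (measurePreserving_sub_right volume (S.coordM x)).quasiMeasurePreserving.ae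
    (φ.coeFn_toLp 2 volume)
  filter_upwards [S.coeFn_indOp q x (φ.toLp 2), h] with r h1 h2
  rw [h1, h2]

theorem continuous_integral_exponent (q : Eucl n × Eucl n) (φ : 𝓢(Eucl m, ℂ)) {u : Eucl m → ℂ}
    (hu : Integrable u) :
    Continuous fun x => ∫ r, (starRingEnd ℂ) (u r) *
      (phase (S.exponent q x r) * φ (r - S.coordM x)) := by
  obtain ⟨C, hC⟩ := φ.decay 0 0
  have hM : ∀ r, ‖φ r‖ ≤ C := fun r => by simpa using hC.2 r
  have hφ := φ.continuous
  have hcM := S.continuous_coordM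
  have hexp : Continuous fun z : g × Eucl m =>
      phase (S.exponent q z.1 z.2) * φ (z.2 - S.coordM z.1) := by
    have := S.continuous_exponent q
    fun_prop
  refine continuous_of_dominated (bound := fun r => ‖u r‖ * C) (fun x => ?_)
    (fun x => Eventually.of_forall fun r => ?_) (hu.norm.mul_const C)
    (Eventually.of_forall fun r => ?_)
  · exact (Complex.continuous_conj.comp_aestronglyMeasurable hu.1).mul
      (hexp.comp (f := fun r => (x, r)) (by fun_prop)).aestronglyMeasurable
  · rw [norm_mul, RCLike.norm_conj, norm_mul, norm_phase, one_mul]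
    exact mul_le_mul_of_nonneg_left (hM _) (norm_nonneg _)
  · exact continuous_const.mul (hexp.comp (f := fun x => (x, r)) (by fun_prop))

theorem continuous_indOp_schwartz (hκ' : ∀ j : Fin n, S.kappa (Fin.natAdd m j) = 0)
    (q : Eucl n × Eucl n) (φ : 𝓢(Eucl m, ℂ)) :
    Continuous fun x => S.indOp q x (φ.toLp 2) := by
  refine continuous_of_continuous_inner (N := ‖φ.toLp 2 (volume : Measure (Eucl m))‖)
    (fun x => ?_) fun x₀ => ?_
  · rw [← S.indEquiv_apply hκ', LinearIsometryEquiv.norm_map]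
  · simp only [fun x => inner_eq_integral_of_ae_eq (S.coeFn_indOp_schwartz q x₀ φ)
      (S.coeFn_indOp_schwartz q x φ)]
    refine S.continuous_integral_exponent q φ ?_
    have h1 : Continuous fun r => phase (S.exponent q x₀ r) * φ (r - S.coordM x₀) := by
      have h2 : Continuous fun r => S.exponent q x₀ r :=
        (S.continuous_exponent q).comp (f := fun r => (x₀, r)) (by fun_prop)
      have h3 := φ.continuous
      fun_prop
    refine ((φ.integrable (μ := volume)).comp_sub_right (S.coordM x₀)).norm.mono'
      h1.aestronglyMeasurable (Eventually.of_forall fun r => ?_)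
    rw [norm_mul, norm_phase, one_mul]

/-- The operators are isometric, so approximating `φ` by Schwartz functions gives convergence
uniform in `x`. -/
theorem continuous_indOp (hκ' : ∀ j : Fin n, S.kappa (Fin.natAdd m j) = 0)
    (q : Eucl n × Eucl n) (φ : L2 (Eucl m)) : Continuous fun x => S.indOp q x φ := by
  obtain ⟨F, hF, hlim⟩ := mem_closure_iff_seq_limit.1
    (SchwartzMap.denseRange_toLpCLM (F := ℂ) (E := Eucl m) (p := 2) (μ := volume)
      ENNReal.ofNat_ne_top φ)
  choose f hf using hF
  have hf' : ∀ k, (f k).toLp 2 (volume : Measure (Eucl m)) = F k := hf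
  have hu : TendstoUniformly (fun k x => S.indOp q x (F k)) (fun x => S.indOp q x φ) atTop := by
    rw [Metric.tendstoUniformly_iff]
    intro ε hε
    filter_upwards [(Metric.tendsto_nhds.1 hlim) ε hε] with k hk x
    rw [dist_comm] at hk
    exact ((S.indEquiv hκ' q x).dist_map φ (F k)).trans_lt hk
  refine hu.continuous (Frequently.of_forall fun k => ?_)
  simp only [← hf']
  exact S.continuous_indOp_schwartz hκ' q (f k)

/-- The representation `π_{ℓ+q} = ind_P^G χ_{ℓ+q}`. -/
def indRep (hκ' : ∀ j : Fin n, S.kappa (Fin.natAdd m j) = 0) (q : Eucl n × Eucl n) :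
    UnitaryRep g (L2 (Eucl m)) where
  op := S.indEquiv hκ' q
  map_mul := S.indOp_cbh hκ' q
  continuous_op := S.continuous_indOp hκ' q

end LimitSetting

/-! ### Irreducibility of the induced representations. -/

theorem nontrivial_L2 (m : ℕ) : Nontrivial (L2 (Eucl m)) := by
  have hb : volume (Metric.ball (0 : Eucl m) 1) ≠ ⊤ := measure_ball_lt_top.ne
  refine ⟨⟨indicatorConstLp 2 Metric.isOpen_ball.measurableSet hb (1 : ℂ), 0, fun h => ?_⟩⟩
  have h1 := norm_indicatorConstLp (p := 2) (E := ℂ) (c := 1)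
    (hs := Metric.isOpen_ball.measurableSet)
    (hμs := hb) two_ne_zero ENNReal.ofNat_ne_top
  rw [h, norm_zero, norm_one, one_mul] at h1
  have h2 : 0 < volume.real (Metric.ball (0 : Eucl m) 1) :=
    ENNReal.toReal_pos (Metric.measure_ball_pos volume 0 one_pos).ne' hb
  exact absurd h1 (Real.rpow_pos_of_pos h2 _).ne

/-- By Tonelli the double integral of `|ψ(r)| |φ(r - c)|` is the product of the `L¹` norms, computed
in `[0, ∞]`. If it vanishes, one of the factors does. -/
theorem eq_zero_or_eq_zero_of_translates {m : ℕ} {φ ψ : L2 (Eucl m)}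
    (h : ∀ c : Eucl m, (fun r => (starRingEnd ℂ) (ψ r) * φ (r - c)) =ᵐ[volume] 0) :
    ψ = 0 ∨ φ = 0 := by
  have hφ : Measurable φ := (Lp.stronglyMeasurable φ).measurable
  have hψ : Measurable ψ := (Lp.stronglyMeasurable ψ).measurable
  have h1 : ∫⁻ c, ∫⁻ r, ‖ψ r‖ₑ * ‖φ (r - c)‖ₑ = 0 := by
    have h2 : ∀ c, ∫⁻ r, ‖ψ r‖ₑ * ‖φ (r - c)‖ₑ = 0 := fun c => by
      rw [lintegral_eq_zero_iff (by fun_prop)]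
      filter_upwards [h c] with r hr
      have hr' := congrArg (fun z : ℂ => ‖z‖ₑ) hr
      simpa using hr'
    simp [h2]
  rw [lintegral_lintegral_swap (by
    refine Measurable.aemeasurable ?_
    change Measurable fun z : Eucl m × Eucl m => ‖ψ z.2‖ₑ * ‖φ (z.2 - z.1)‖ₑ
    fun_prop)] at h1
  have h3 : ∀ r, ∫⁻ c, ‖ψ r‖ₑ * ‖φ (r - c)‖ₑ = ‖ψ r‖ₑ * ∫⁻ c, ‖φ c‖ₑ := fun r => by
    rw [lintegral_const_mul _ (by fun_prop), lintegral_sub_left_eq_self (fun c => ‖φ c‖ₑ) r]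
  simp only [h3] at h1
  rw [lintegral_mul_const _ (by fun_prop), mul_eq_zero] at h1
  have h4 : ∀ f : L2 (Eucl m), Measurable f → ∫⁻ r, ‖f r‖ₑ = 0 → f = 0 := fun f hf h0 => by
    rw [lintegral_eq_zero_iff (by fun_prop)] at h0
    rw [Lp.eq_zero_iff_ae_eq_zero]
    filter_upwards [h0] with r hr
    simpa using hr
  exact h1.imp (h4 ψ hψ) (h4 φ hφ)

namespace LimitSetting

variable {g : Type*} [NormedAddCommGroup g] [InnerProductSpace ℝ g] [FiniteDimensional ℝ g]
  [TwoStepLieAlgebra g] {m n p₁ p₂ : ℕ} (S : LimitSetting g (m + n) p₁ p₂)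

theorem exists_coordM_momentum (hκ : ∀ j : Fin m, S.kappa (Fin.castAdd n j) ≠ 0)
    (c b : Eucl m) : ∃ x, S.coordM x = c ∧ S.momentum x = b := by
  refine ⟨secXY S.b (WithLp.toLp 2 (Fin.addCases (fun j => c j) fun _ => 0),
    WithLp.toLp 2 (Fin.addCases (fun j => b j / S.kappa (Fin.castAdd n j)) fun _ => 0)),
    PiLp.ext fun j => ?_, PiLp.ext fun j => ?_⟩
  · simp [coordM_apply, inner_vX_secXY]
  · simp [momentum_apply, inner_vY_secXY, mul_div_cancel₀ _ (hκ j)]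

/-- For `φ` in an invariant subspace and `ψ` orthogonal to it, the coefficients `⟨ψ, π(x) φ⟩`
vanish. With fixed translation `c` and varying momentum they are, up to a phase, the Fourier
transform of `conj ψ · φ(· - c)`, so all these products vanish. -/
theorem isIrreducible_indRep (hκ : ∀ j : Fin m, S.kappa (Fin.castAdd n j) ≠ 0)
    (hκ' : ∀ j : Fin n, S.kappa (Fin.natAdd m j) = 0) (q : Eucl n × Eucl n) :
    (S.indRep hκ' q).IsIrreducible := by
  refine ⟨nontrivial_L2 m, fun K hK hinv => ?_⟩
  by_contra! hne
  obtain ⟨φ, hφK, hφ0⟩ := Submodule.exists_mem_ne_zero_of_ne_bot hne.1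
  have : CompleteSpace K := hK.completeSpace_coe
  have hbot : Kᗮ ≠ ⊥ := fun h => hne.2 ((Submodule.orthogonal_eq_bot_iff).1 h)
  obtain ⟨ψ, hψK, hψ0⟩ := Submodule.exists_mem_ne_zero_of_ne_bot hbot
  refine (eq_zero_or_eq_zero_of_translates (φ := φ) (ψ := ψ) fun c => ?_).elim hψ0 hφ0
  have hφc : MemLp (fun r => φ (r - c)) 2 (volume : Measure (Eucl m)) :=
    (Lp.memLp φ).comp_measurePreserving (measurePreserving_sub_right volume c)
  have hint : Integrable fun r => (starRingEnd ℂ) (ψ r) * φ (r - c) :=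
    (Lp.memLp ψ).star.integrable_mul hφc
  refine ae_eq_zero_of_fourier_eq_zero hint fun b => ?_
  -- Position and momentum can be prescribed independently since the first `m` constants `kappa` are
  -- nonzero; the sign makes the phase that of frequency `b`.
  obtain ⟨x, hx, hb⟩ := S.exists_coordM_momentum hκ c (-b)
  have h0 : inner ℂ ψ (S.indOp q x φ) = 0 :=
    Submodule.inner_left_of_mem_orthogonal (hinv x φ hφK) hψK
  rw [inner_eq_integral_of_ae_eq (ae_eq_refl _) (S.coeFn_indOp q x φ)] at h0
  set t : ℝ := S.shift q x + 1 / 2 * inner ℝ (S.coordM x) (S.momentum x) with ht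
  have h1 : ∀ r, (starRingEnd ℂ) (ψ r) * (phase (S.exponent q x r) * φ (r - S.coordM x)) =
      phase t * (Complex.exp (-(2 * Real.pi * Complex.I * (inner ℝ r b : ℝ))) *
        ((starRingEnd ℂ) (ψ r) * φ (r - c))) := fun r => by
    have h2 : S.exponent q x r = t + inner ℝ r b := by
      rw [exponent, ht, hb, inner_neg_right]
      ring
    rw [h2, phase_add, hx]
    simp only [phase]
    ring
  simp only [h1] at h0
  rw [integral_const_mul, mul_eq_zero] at h0
  exact h0.resolve_left (Complex.exp_ne_zero _)

theorem shift_secXY (q : Eucl n × Eucl n) (w : Eucl (m + n) × Eucl (m + n)) :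
    S.shift q (secXY S.b w) = pairing q (WithLp.toLp 2 fun j => w.1 (Fin.natAdd m j),
      WithLp.toLp 2 fun j => w.2 (Fin.natAdd m j)) := by
  rw [shift_apply, S.ℓ_secXY, zero_add, pairing]
  simp only [inner_vX_secXY, inner_vY_secXY]

/-- The representations `π_{ℓ+q}`. -/
def inducedFamily (hκ : ∀ j : Fin m, S.kappa (Fin.castAdd n j) ≠ 0)
    (hκ' : ∀ j : Fin n, S.kappa (Fin.natAdd m j) = 0) :
    RadicalFamily (S.frame hκ hκ') (L2 (Eucl m)) where
  rep := S.indRep hκ'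
  irreducible := S.isIrreducible_indRep hκ hκ'
  restrict q x hx v := by
    change S.indOp q x v = phase (S.ℓ x) • v
    rw [S.indOp_eq_smul q (S.coordM_of_mem hx) (S.momentum_of_mem hx), S.shift_of_mem q hx]
  radical q r v := by
    change S.indOp q (secXY S.b (S.frameEquiv hκ (0, r))) v = _
    rw [S.indOp_eq_smul, S.shift_secXY]
    · simp [frameEquiv]
    · exact PiLp.ext fun j => by simp [coordM_apply, inner_vX_secXY, frameEquiv]
    · exact PiLp.ext fun j => by simp [momentum_apply, inner_vY_secXY, frameEquiv]
  twist q w v := by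
    change S.indOp q (secXY S.b w) v =
      phase (pairing q ((S.frameEquiv hκ).symm w).2) • S.indOp 0 (secXY S.b w) v
    rw [S.indOp_eq_smul_indOp_zero, S.shift_secXY, S.shift_secXY]
    congr 2
    simp [pairing, frameEquiv]

end LimitSetting

/-! ### The third case: compact operator values and conclusion. -/

/-- A linear isometry from its underlying function. -/
def LinearIsometry.ofFun {A B : Type*} [NormedAddCommGroup A] [NormedSpace ℂ A]
    [NormedAddCommGroup B] [NormedSpace ℂ B] (f : A → B) (hadd : ∀ a a', f (a + a') = f a + f a')
    (hsmul : ∀ (c : ℂ) a, f (c • a) = c • f a) (hnorm : ∀ a, ‖f a‖ = ‖a‖) : A →ₗᵢ[ℂ] B where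
  toFun := f
  map_add' := hadd
  map_smul' := hsmul
  norm_map' := hnorm

/-- The compact operators inside all operators. -/
def compactInclusion (X : Type) [MeasureSpace X] :=
  LinearIsometry.ofFun (A := KL2 X) (B := L2 X →L[ℂ] L2 X) (fun T => (T : L2 X →L[ℂ] L2 X))
    (fun _ _ => rfl) (fun _ _ => rfl) (fun _ => rfl)

theorem compactInclusion_apply {X : Type} [MeasureSpace X] (T : KL2 X) :
    compactInclusion X T = (T : L2 X →L[ℂ] L2 X) := rfl

theorem LimitSetting.isWeakIntegral_repOp_indRep {g : Type*} [NormedAddCommGroup g]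
    [InnerProductSpace ℝ g] [FiniteDimensional ℝ g] [MeasurableSpace g] [BorelSpace g]
    [TwoStepLieAlgebra g] {m n p₁ p₂ : ℕ} (S : LimitSetting g (m + n) p₁ p₂)
    (hκ' : ∀ j : Fin n, S.kappa (Fin.natAdd m j) = 0) (h : S.quot.L1) (q : Eucl n × Eucl n) :
    IsWeakIntegral (S.quot.repOp (S.indRep hκ' q) h)
      (fun w : Eucl (m + n) × Eucl (m + n) => h (S.quot.sec w) • S.indOp q (S.quot.sec w)) :=
  fun ξ ψ => by
    refine ⟨(S.quot.integrable_rep (S.indRep hκ' q) h ξ).const_inner ψ, ?_⟩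
    rw [QuotientData.inner_repOp]
    refine integral_congr_ae (Eventually.of_forall fun w => ?_)
    simp only [_root_.smul_apply, inner_smul_right]
    rfl

theorem completeSpace_KL2 (X : Type) [MeasureSpace X] : CompleteSpace (KL2 X) := by
  have h : IsClosed {T : L2 X →L[ℂ] L2 X | IsCompactOperator T} :=
    isClosed_setOfPred_isCompactOperator
  exact h.completeSpace_coe

set_option maxHeartbeats 1000000 in
-- The coherent machinery with `K = L²(ℝ^m)`, `A` the compact operators, and `V_q` tensoring with
-- the packet in the last `n` variables.
theorem thirdCase {g : Type*} [NormedAddCommGroup g] [InnerProductSpace ℝ g]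
    [FiniteDimensional ℝ g] [MeasurableSpace g] [BorelSpace g] [TwoStepLieAlgebra g]
    {m n p₁ p₂ : ℕ} (S : LimitSetting g (m + n) p₁ p₂) {η : Fin (m + n) → 𝓢(ℝ, ℂ)}
    (hη : ∀ j, ∫ t, ‖η j t‖ ^ 2 = 1) (hlam : S.lamLim ≠ 0)
    (hc : ∀ j : Fin m, S.cLim (Fin.castAdd n j) ≠ 0)
    (hc' : ∀ j : Fin n, S.cLim (Fin.natAdd m j) = 0) :
    ∃ F : S.quot.CStar →ₗᵢ[ℂ] C₀(Eucl n × Eucl n, KL2 (Eucl m)),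
      (∀ (h : S.quot.L1) (q : Eucl n × Eucl n),
        IsWeakIntegral (F (h : S.quot.CStar) q : L2 (Eucl m) →L[ℂ] L2 (Eucl m))
          (fun w : Eucl (m + n) × Eucl (m + n) =>
            h (S.quot.sec w) • S.indOp q (S.quot.sec w))) ∧
      ∀ k : ℕ, ∃ μ : C₀(Eucl n × Eucl n, KL2 (Eucl m)) →L[ℂ]
          (L2 (Eucl m × Eucl n) →L[ℂ] L2 (Eucl m × Eucl n)),
        (∀ φ, IsWeakIntegral (μ φ) (S.integrand₃ η k φ) ∧ ‖μ φ‖ ≤ ‖φ‖) ∧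
        ∃ ν : S.quot.CStar →L[ℂ] (L2 (Eucl m × Eucl n) →L[ℂ] L2 (Eucl m × Eucl n)),
          (∀ a, ν a = μ (F a)) ∧
          (∀ h : S.quot.L1, S.quot.IsSchwartz h →
            Integrable (S.integrand₃ η k (F (h : S.quot.CStar))) ∧
            ν (h : S.quot.CStar) = ∫ q, S.integrand₃ η k (F (h : S.quot.CStar)) q) ∧
          (∀ ν' : S.quot.CStar →L[ℂ] (L2 (Eucl m × Eucl n) →L[ℂ] L2 (Eucl m × Eucl n)),
            (∀ h : S.quot.L1, S.quot.IsSchwartz h →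
              ν' (h : S.quot.CStar) = ∫ q, S.integrand₃ η k (F (h : S.quot.CStar)) q) →
            ν' = ν) ∧
          ∀ a, IsCompactOperator (ν a) ∧ ‖ν a‖ ≤ ‖a‖ ∧
            ContinuousLinearMap.adjoint (ν a) = ν (S.quot.starC a) := by
  have hκ : ∀ j : Fin m, S.kappa (Fin.castAdd n j) ≠ 0 := fun j => mul_ne_zero hlam (hc j)
  have hκ' : ∀ j : Fin n, S.kappa (Fin.natAdd m j) = 0 := fun j => by
    rw [LimitSetting.kappa, hc', mul_zero]
  let R := S.inducedFamily hκ hκ'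
  have := completeSpace_KL2 (Eucl m)
  -- Weyl smearing keeps the Fourier transform inside the compact operators, as the target of `F`
  -- requires.
  have hcomp : ∀ (h : S.quot.L1) q, ∃ T : KL2 (Eucl m),
      compactInclusion (Eucl m) T = S.quot.repOp (R.rep q) h := fun h q =>
    ⟨⟨S.quot.repOp (R.rep q) h, (S.frame hκ hκ').isCompactOperator_repOp (R.rep q) (R.restrict q)
      (R.irreducible q) h⟩, rfl⟩
  obtain ⟨F, hF⟩ := R.exists_linearIsometry (A := KL2 (Eucl m))
    (compactInclusion (Eucl m)) hcomp
  have hFw : ∀ (h : S.quot.L1) (q : Eucl n × Eucl n),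
      IsWeakIntegral (F (h : S.quot.CStar) q : L2 (Eucl m) →L[ℂ] L2 (Eucl m))
        (fun w : Eucl (m + n) × Eucl (m + n) =>
          h (S.quot.sec w) • S.indOp q (S.quot.sec w)) := fun h q => by
    rw [← compactInclusion_apply, hF]
    exact S.isWeakIntegral_repOp_indRep hκ' h q
  refine ⟨F, hFw, fun k => ?_⟩
  have hV := isCoherent_tensorRight_packet m
    (fun j => S.lam_mul_c_ne_zero k (Fin.natAdd m j)) (fun j => hη (Fin.natAdd m j))
  obtain ⟨μ, hμ⟩ := hV.exists_integralMap (A := KL2 (Eucl m)) (compactInclusion (Eucl m))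
  have hint : ∀ φ : C₀(Eucl n × Eucl n, KL2 (Eucl m)),
      coherentIntegrand (∏ j, |S.lam k * S.c k (Fin.natAdd m j)|)⁻¹
        (fun q => tensorRight (packetL2 (fun j => S.lam k * S.c k (Fin.natAdd m j))
          (fun j => η (Fin.natAdd m j)) q))
        (fun q => compactInclusion (Eucl m) (φ q)) = S.integrand₃ η k φ := fun φ => rfl
  have hμ' : ∀ φ, IsWeakIntegral (μ φ) (S.integrand₃ η k φ) ∧ ‖μ φ‖ ≤ ‖φ‖ := fun φ => by
    rw [← hint]
    exact hμ φ
  have hSch : ∀ h : S.quot.L1, S.quot.IsSchwartz h →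
      Integrable (S.integrand₃ η k (F (h : S.quot.CStar))) ∧
      μ (F (h : S.quot.CStar)) = ∫ q, S.integrand₃ η k (F (h : S.quot.CStar)) q := fun h hh => by
    rw [← hint]
    exact ⟨R.integrable_coherentIntegrand hF hV hh, R.integralMap_eq_integral hF hV hμ hh⟩
  refine ⟨μ, hμ', μ.comp F.toContinuousLinearMap, fun a => rfl, hSch, fun ν' hν' => ?_,
    fun a => ⟨?_, ?_, ?_⟩⟩
  · exact eq_of_eqOn_isSchwartz fun h hh => (hν' h hh).trans (hSch h hh).2.symm
  · exact R.isCompactOperator_integralMap hF hV hμ (fun T => T.2) a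
  · exact ((hμ (F a)).2).trans_eq (F.norm_map a)
  · exact R.adjoint_integralMap hF hμ a

end TwoStep

end

theorem mainTheorem4 {g : Type*} [NormedAddCommGroup g] [InnerProductSpace ℝ g]
    [FiniteDimensional ℝ g] [MeasurableSpace g] [BorelSpace g] [TwoStepLieAlgebra g] :
    -- second case
    (∀ (d p₁ p₂ : ℕ) (S : LimitSetting g d p₁ p₂) (η : Fin d → 𝓢(ℝ, ℂ)),
      (∀ j, ∫ t, ‖η j t‖ ^ 2 = 1) →
      (S.lamLim = 0 ∨ ∀ j, S.cLim j = 0) →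
      ∃ F : S.quot.CStar →ₗᵢ[ℂ] C₀(Eucl d × Eucl d, ℂ),
        (∀ (h : S.quot.L1) (q : Eucl d × Eucl d), F (h : S.quot.CStar) q = S.hhat h q) ∧
        ∀ k : ℕ, ∃ ν : S.quot.CStar →L[ℂ] (L2 (Eucl d) →L[ℂ] L2 (Eucl d)),
          (∀ a, IsWeakIntegral (ν a) (S.integrand₂ η k (F a))) ∧
          (∀ h : S.quot.L1, S.quot.IsSchwartz h →
            Integrable (S.integrand₂ η k (S.hhat h)) ∧
            ν (h : S.quot.CStar) = ∫ q, S.integrand₂ η k (S.hhat h) q) ∧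
          (∀ ν' : S.quot.CStar →L[ℂ] (L2 (Eucl d) →L[ℂ] L2 (Eucl d)),
            (∀ h : S.quot.L1, S.quot.IsSchwartz h →
              ν' (h : S.quot.CStar) = ∫ q, S.integrand₂ η k (S.hhat h) q) → ν' = ν) ∧
          ∀ a, IsCompactOperator (ν a) ∧ ‖ν a‖ ≤ ‖a‖ ∧
            ContinuousLinearMap.adjoint (ν a) = ν (S.quot.starC a)) ∧
    -- third case
    (∀ (m n p₁ p₂ : ℕ) (S : LimitSetting g (m + n) p₁ p₂) (η : Fin (m + n) → 𝓢(ℝ, ℂ)),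
      1 ≤ m → 1 ≤ n →
      (∀ j, ∫ t, ‖η j t‖ ^ 2 = 1) →
      S.lamLim ≠ 0 →
      (∀ j : Fin m, S.cLim (Fin.castAdd n j) ≠ 0) →
      (∀ j : Fin n, S.cLim (Fin.natAdd m j) = 0) →
      ∃ F : S.quot.CStar →ₗᵢ[ℂ] C₀(Eucl n × Eucl n, KL2 (Eucl m)),
        (∀ (h : S.quot.L1) (q : Eucl n × Eucl n),
          IsWeakIntegral (F (h : S.quot.CStar) q : L2 (Eucl m) →L[ℂ] L2 (Eucl m))
            (fun w : Eucl (m + n) × Eucl (m + n) =>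
              h (S.quot.sec w) • S.indOp q (S.quot.sec w))) ∧
        ∀ k : ℕ, ∃ μ : C₀(Eucl n × Eucl n, KL2 (Eucl m)) →L[ℂ]
            (L2 (Eucl m × Eucl n) →L[ℂ] L2 (Eucl m × Eucl n)),
          (∀ φ, IsWeakIntegral (μ φ) (S.integrand₃ η k φ) ∧ ‖μ φ‖ ≤ ‖φ‖) ∧
          ∃ ν : S.quot.CStar →L[ℂ] (L2 (Eucl m × Eucl n) →L[ℂ] L2 (Eucl m × Eucl n)),
            (∀ a, ν a = μ (F a)) ∧
            (∀ h : S.quot.L1, S.quot.IsSchwartz h →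
              Integrable (S.integrand₃ η k (F (h : S.quot.CStar))) ∧
              ν (h : S.quot.CStar) = ∫ q, S.integrand₃ η k (F (h : S.quot.CStar)) q) ∧
            (∀ ν' : S.quot.CStar →L[ℂ] (L2 (Eucl m × Eucl n) →L[ℂ] L2 (Eucl m × Eucl n)),
              (∀ h : S.quot.L1, S.quot.IsSchwartz h →
                ν' (h : S.quot.CStar) = ∫ q, S.integrand₃ η k (F (h : S.quot.CStar)) q) →
              ν' = ν) ∧
            ∀ a, IsCompactOperator (ν a) ∧ ‖ν a‖ ≤ ‖a‖ ∧
              ContinuousLinearMap.adjoint (ν a) = ν (S.quot.starC a)) :=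
  ⟨fun _ _ _ S _ hη hS => secondCase S hη hS,
    fun _ _ _ _ S _ _ _ hη hlam hc hc' => thirdCase S hη hlam hc hc'⟩
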